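/- Let $E$ be a Euclidean space and $\Phi\subset E$ an irreducible reduced (crystallographic) root system of rank $\ell$ spanning $E$, with basis (simple roots) $\Delta=\{\alpha_1,\dots,\alpha_\ell\}$ numbered as in Bourbaki's plates (type $B_2$ is numbered so that $\alpha_1$ is long). For a basis number $j$, let $w_0$ be the longest element of the Weyl group $W$ of $\Phi$ (length with respect to the simple reflections), let $w_j$ be the longest element of the subgroup of $W$ generated by the simple reflections $s_{\alpha_i}$, $i\neq j$, and put $\omega=\omega_j=w_jw_0$. Let $o(\omega)$ be the order of $\omega$, $E^\omega=\{x\in E:\omega(x)=x\}$, $$x^\omega=\frac1{o(\omega)}\sum_{t=1}^{o(\omega)}\omega^t(x)\quad(x\in E),\qquad \Phi_{\mathrm{re}}^\omega=\{\beta^\omega:\beta\in\Phi,\ \beta^\omega\neq0\}.$$ Then in each of the following cases $\Phi_{\mathrm{re}}^\omega$ is a root system in $E^\omega$ (in particular it spans $E^\omega$). It is reduced except where its type is $BC$, and its type is as follows. - $\Phi$ of type $A_\ell$ ($\ell\ge1$), $1\le j\le\ell$, $g=\gcd(\ell+1,j)$: $\Phi_{\mathrm{re}}^\omega=\varnothing$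 if $g=1$, and type $A_{g-1}$ if $g\neq1$. - $\Phi$ of type $B_2$, $j=1$: type $A_1$. - $\Phi$ of type $B_\ell$ ($\ell\ge3$), $j=1$: type $B_{\ell-1}$. - $\Phi$ of type $C_\ell$ ($\ell\ge3$ odd), $j=\ell$: type $BC_{(\ell-1)/2}$. - $\Phi$ of type $C_\ell$ ($\ell\ge4$ even), $j=\ell$: type $C_{\ell/2}$. - $\Phi$ of type $D_\ell$ ($\ell\ge4$), $j=1$: type $B_{\ell-2}$. - $\Phi$ of type $D_\ell$ ($\ell\ge4$ even), $j\in\{\ell-1,\ell\}$: type $C_{\ell/2}$ (for $\ell=4$ this is type $C_2=B_2$). - $\Phi$ of type $D_\ell$ ($\ell\ge5$ odd), $j\in\{\ell-1,\ell\}$: type $BC_{(\ell-3)/2}$. - $\Phi$ of type $E_6$, $j\in\{1,6\}$: type $G_2$. - $\Phi$ of type $E_7$, $j=7$: type $F_4$. Here the type of a reduced root system is given by its Dynkin diagram, with $C_2=B_2$. A root system of type $BC_n$ is a non-reduced root system whose Dynkin diagram is $B_n$ if $n\ge2$, and $A_1$ if $n=1$. -/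

import Mathlib

namespace Folding

variable {E : Type*} [NormedAddCommGroup E] [InnerProductSpace ℝ E]

/-- The orthogonal reflection `s_a`; it is the identity if `a = 0`. -/
noncomputable def refl (a : E) : E ≃ₗᵢ[ℝ] E :=
  Submodule.reflection (Submodule.span ℝ {a})ᗮ

/-- The number `(a^∨, x)`, where `a^∨ = 2a / (a, a)`. -/
noncomputable def corootPairing (a x : E) : ℝ :=
  2 * inner ℝ a x / inner ℝ a a

/-- `s_a(x) = x - (a^∨, x) a`. -/
theorem refl_apply (a x : E) : refl a x = x - corootPairing a x • a := by
  have h := Submodule.reflection_orthogonal_apply (K := Submodule.span ℝ {a}) x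
  unfold refl corootPairing
  rw [h, Submodule.reflection_singleton_apply]
  simp only [real_inner_self_eq_norm_sq, RCLike.ofReal_real_eq_id, id, neg_sub,
    two_smul]
  congr 1
  rw [← add_smul]
  congr 1
  ring

/-- `Φ` is a (finite, crystallographic, not necessarily reduced) root system in the Euclidean
space `V`, a subspace of `E`. -/
structure IsRootSystem (V : Submodule ℝ E) (Φ : Set E) : Prop where
  finite : Φ.Finite
  zero_notMem : (0 : E) ∉ Φ
  span_eq : Submodule.span ℝ Φ = V
  refl_mem : ∀ a ∈ Φ, ∀ b ∈ Φ, refl a b ∈ Φ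
  integral : ∀ a ∈ Φ, ∀ b ∈ Φ, ∃ k : ℤ, corootPairing a b = k

/-- A root `a` is indivisible if `a / 2` is not a root. -/
def IsIndivisible (Φ : Set E) (a : E) : Prop :=
  (1 / 2 : ℝ) • a ∉ Φ

/-- All roots are indivisible. -/
def IsReduced (Φ : Set E) : Prop :=
  ∀ a ∈ Φ, IsIndivisible Φ a

/-- The numbered family `α` is a basis (a system of simple roots) of the root system `Φ` in `V`. -/
structure IsBasis (V : Submodule ℝ E) (Φ : Set E) {n : ℕ} (α : Fin n → E) : Prop where
  mem : ∀ i, α i ∈ Φ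
  linearIndependent : LinearIndependent ℝ α
  span_eq : Submodule.span ℝ (Set.range α) = V
  nonneg_or_nonpos : ∀ b ∈ Φ, ∃ c : Fin n → ℕ, b = ∑ i, c i • α i ∨ b = -∑ i, c i • α i
  indivisible : ∀ i, IsIndivisible Φ (α i)

/-- The Cartan matrix of `α` is `M`, where `M i j = (α_i, α_j^∨)`. This is the same datum as the
Dynkin diagram of `α` with its vertices numbered. -/
def HasCartanMatrix {n : ℕ} (α : Fin n → E) (M : Matrix (Fin n) (Fin n) ℤ) : Prop :=
  ∀ i j, corootPairing (α j) (α i) = M i j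

/-- `Φ` is a reduced root system in `V` whose Dynkin diagram is that of the Cartan matrix `M`. -/
def IsReducedOfType (V : Submodule ℝ E) (Φ : Set E) {n : ℕ}
    (M : Matrix (Fin n) (Fin n) ℤ) : Prop :=
  IsRootSystem V Φ ∧ IsReduced Φ ∧ ∃ α : Fin n → E, IsBasis V Φ α ∧ HasCartanMatrix α M

/-- `Φ` is a root system of type `BC_n` in `V` (`n ≥ 1`): it is not reduced, and its Dynkin diagram
is `B_n` if `n ≥ 2` and `A_1` if `n = 1` (note `CartanMatrix.B 1 = CartanMatrix.A 1`). -/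
def IsOfTypeBC (V : Submodule ℝ E) (Φ : Set E) (n : ℕ) : Prop :=
  IsRootSystem V Φ ∧ ¬ IsReduced Φ ∧
    ∃ α : Fin n → E, IsBasis V Φ α ∧ HasCartanMatrix α (CartanMatrix.B n)

/-- The Weyl group, generated by the reflections in all roots. -/
noncomputable def weylGroup (Φ : Set E) : Subgroup (E ≃ₗᵢ[ℝ] E) :=
  Subgroup.closure (refl '' Φ)

/-- The least number of factors needed to write `w` as a product of elements of `S`. -/
noncomputable def wordLength {G : Type*} [Group G] (S : Set G) (w : G) : ℕ :=
  sInf {k | ∃ L : List G, (∀ s ∈ L, s ∈ S) ∧ L.length = k ∧ L.prod = w}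

/-- `w` is an element of `H` whose length with respect to the generators `S` is maximal. -/
def IsLongest {G : Type*} [Group G] (H : Subgroup G) (S : Set G) (w : G) : Prop :=
  w ∈ H ∧ ∀ u ∈ H, wordLength S u ≤ wordLength S w

/-- `ω = w_j w_0`, where `w_0` is the longest element of the Weyl group of `Φ` and `w_j` is the
longest element of the subgroup generated by the simple reflections other than the one at `j`. -/
def IsOmega (Φ : Set E) {n : ℕ} (α : Fin n → E) (j : Fin n) (ω : E ≃ₗᵢ[ℝ] E) : Prop :=
  ∃ w₀ wj : E ≃ₗᵢ[ℝ] E,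
    IsLongest (weylGroup Φ) (Set.range fun i => refl (α i)) w₀ ∧
    IsLongest (Subgroup.closure ((fun i => refl (α i)) '' {i | i ≠ j}))
      ((fun i => refl (α i)) '' {i | i ≠ j}) wj ∧
    ω = wj * w₀

/-- The space `E^ω` of fixed points of `ω`. -/
def fixedSpace (ω : E ≃ₗᵢ[ℝ] E) : Submodule ℝ E where
  carrier := {x | ω x = x}
  add_mem' := by
    intro x y hx hy
    simp only [Set.mem_ofPred_eq] at hx hy ⊢
    rw [map_add, hx, hy]
  zero_mem' := by simp
  smul_mem' := by
    intro c x hx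
    simp only [Set.mem_ofPred_eq] at hx ⊢
    rw [map_smul, hx]

/-- The average `x^ω` of `ω^t(x)` over `t = 1, …, o(ω)`, where `o(ω)` is the order of `ω`. -/
noncomputable def average (ω : E ≃ₗᵢ[ℝ] E) (x : E) : E :=
  (1 / (orderOf ω : ℝ)) • ∑ t ∈ Finset.Icc 1 (orderOf ω), (ω ^ t) x

/-- The set `Φ_re^ω` of the nonzero averages of roots. -/
def foldedRoots (Φ : Set E) (ω : E ≃ₗᵢ[ℝ] E) : Set E :=
  {y | y ≠ 0 ∧ ∃ b ∈ Φ, average ω b = y}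

end Folding

set_option linter.unusedSectionVars false

namespace Folding

variable {E : Type*} [NormedAddCommGroup E] [InnerProductSpace ℝ E]

/-! ### Reflections -/

/-! In every case listed, the coefficient of `α j` in the highest root θ is 1, and ω permutes the
simple roots together with -θ, sending -θ to `α j`. So ω maps each simple root either to a simple
root other than `α j` or to the negative root -θ, which involves `α j`. These sign data determine ω,
and `IsOmega.eq` turns this into a criterion that does not mention θ. If v in the Weyl group has
such data, then w₀ v⁻¹ w_j keeps all simple roots positive. By the exchange condition
(`IsBasis.exchange`, `IsBasis.eq_one`) it is trivial, so v = w_j w₀. It remains to exhibit v in each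
type.

For the classical types, a connected Cartan matrix fixes the Gram matrix of the basis up to scale,
and a basis determines a reduced root system. So Φ is a standard model in coordinates e_i, and v
permutes the e_i up to sign: a cyclic shift (A), a sign change of e_1 (B) or of e_1 and e_ℓ (D,
first node), or e_i ↦ -e_{ℓ+1-i} (C, and D at its last node, with one sign changed for D of odd
rank). The averages of the e_i are zero or, up to sign, members of a smaller family with a Gram
matrix of the same shape, so the folded set is again a standard model. In `foldedRoots_signedRoots`,
a coordinate that averages to zero creates short roots ±f, and two coordinates that merge create
long roots ±2f. This separates B, C and BC. In type A the shift has g = gcd(ℓ+1, j) orbits on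
coordinates, which leaves the differences of g vectors.

For E₆ and E₇ an explicit product of reflections gives v. The folded set is identified with the
short vectors of the lattice spanned by orbit averages γ_k of simple roots
(`foldedRoots_eq_shortVectors`). Averaging does not lengthen a vector, which gives one inclusion.
Conversely, the reflection in γ_k is induced by the product of the commuting reflections over an
orbit, so the averages of the roots are stable under it and contain the root system with basis γ.
That the short vectors form such a root system is a finite check.

In all types the average is a projection onto E^ω and Φ spans E, so the folded roots span E^ω
(`span_foldedRoots`). -/

theorem corootPairing_add (a x y : E) :
    corootPairing a (x + y) = corootPairing a x + corootPairing a y := by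
  simp only [corootPairing, inner_add_right]; ring

theorem corootPairing_smul (a : E) (c : ℝ) (x : E) :
    corootPairing a (c • x) = c * corootPairing a x := by
  simp only [corootPairing, inner_smul_right]; ring

theorem corootPairing_neg (a x : E) : corootPairing a (-x) = -corootPairing a x := by
  simp only [corootPairing, inner_neg_right]; ring

theorem corootPairing_sum {ι : Type*} (s : Finset ι) (a : E) (x : ι → E) :
    corootPairing a (∑ i ∈ s, x i) = ∑ i ∈ s, corootPairing a (x i) := by
  simp only [corootPairing, inner_sum, Finset.mul_sum, Finset.sum_div]

theorem corootPairing_self {a : E} (ha : a ≠ 0) : corootPairing a a = 2 := by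
  have : inner ℝ a a ≠ (0 : ℝ) := inner_self_ne_zero.mpr ha
  simp only [corootPairing]; field_simp

theorem corootPairing_neg_left (a x : E) : corootPairing (-a) x = -corootPairing a x := by
  simp only [corootPairing, inner_neg_left, inner_neg_right]; ring

theorem corootPairing_map (g : E ≃ₗᵢ[ℝ] E) (a x : E) :
    corootPairing (g a) (g x) = corootPairing a x := by
  simp [corootPairing]

theorem refl_self (a : E) : refl a a = -a := by
  by_cases ha : a = 0
  · simp [ha]
  · rw [refl_apply, corootPairing_self ha, two_smul]; abel

theorem refl_neg (a : E) : refl (-a) = refl a := by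
  ext x
  rw [refl_apply, refl_apply, corootPairing_neg_left, neg_smul_neg]

theorem refl_smul {c : ℝ} (hc : c ≠ 0) (a : E) : refl (c • a) = refl a := by
  ext x
  rw [refl_apply, refl_apply, smul_smul]
  congr 2
  simp only [corootPairing, inner_smul_left, inner_smul_right, conj_trivial]
  rcases eq_or_ne a 0 with rfl | ha
  · simp
  · have ha' : inner ℝ a a ≠ (0 : ℝ) := inner_self_ne_zero.mpr ha
    field_simp

theorem refl_refl (a x : E) : refl a (refl a x) = x :=
  Submodule.reflection_reflection _ x

theorem refl_mul_refl (a : E) : refl a * refl a = 1 := by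
  ext x; exact refl_refl a x

theorem refl_inv (a : E) : (refl a)⁻¹ = refl a :=
  inv_eq_of_mul_eq_one_left (refl_mul_refl a)

theorem map_refl (g : E ≃ₗᵢ[ℝ] E) (a x : E) : g (refl a x) = refl (g a) (g x) := by
  rw [refl_apply, refl_apply, map_sub, map_smul, corootPairing_map]

theorem refl_map (g : E ≃ₗᵢ[ℝ] E) (a : E) : refl (g a) = g * refl a * g⁻¹ := by
  rw [eq_mul_inv_iff_mul_eq]
  ext x
  exact (map_refl g a x).symm

theorem mem_fixedSpace {ω : E ≃ₗᵢ[ℝ] E} {x : E} : x ∈ fixedSpace ω ↔ ω x = x := Iff.rfl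

/-! ### Positive roots -/

/-- The sums of the vectors `α i`. -/
def cone {M : Type*} [AddCommMonoid M] {n : ℕ} (α : Fin n → M) : AddSubmonoid M :=
  AddSubmonoid.closure (Set.range α)

theorem apply_mem_cone {M : Type*} [AddCommMonoid M] {n : ℕ} (α : Fin n → M) (i : Fin n) : α i ∈ cone α :=
  AddSubmonoid.subset_closure ⟨i, rfl⟩

theorem mem_cone {M : Type*} [AddCommMonoid M] {n : ℕ} {α : Fin n → M} {x : M} :
    x ∈ cone α ↔ ∃ c : Fin n → ℕ, x = ∑ i, c i • α i := by
  constructor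
  · intro hx
    induction hx using AddSubmonoid.closure_induction with
    | mem x hx =>
      obtain ⟨i, rfl⟩ := hx
      exact ⟨Pi.single i 1, by simp [Pi.single_apply]⟩
    | zero => exact ⟨0, by simp⟩
    | add x y _ _ hx hy =>
      obtain ⟨c, rfl⟩ := hx
      obtain ⟨d, rfl⟩ := hy
      exact ⟨c + d, by simp [add_smul, Finset.sum_add_distrib]⟩
  · rintro ⟨c, rfl⟩
    exact sum_mem fun i _ => nsmul_mem (apply_mem_cone α i) _

theorem map_mem_cone {n m : ℕ} {α : Fin n → E} {F : Type*} [NormedAddCommGroup F]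
    [InnerProductSpace ℝ F] {β : Fin m → F} (g : E →ₗ[ℝ] F) (h : ∀ i, g (α i) ∈ cone β)
    {x : E} (hx : x ∈ cone α) : g x ∈ cone β := by
  obtain ⟨c, rfl⟩ := mem_cone.1 hx
  rw [map_sum]
  exact sum_mem fun i _ => by rw [map_nsmul]; exact nsmul_mem (h i) _

theorem mem_span_of_mem_cone {n : ℕ} {α : Fin n → E} {x : E} (hx : x ∈ cone α) :
    x ∈ Submodule.span ℝ (Set.range α) := by
  obtain ⟨c, rfl⟩ := mem_cone.1 hx
  exact sum_mem fun i _ => nsmul_mem (Submodule.subset_span (Set.mem_range_self i)) _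

/-- The coordinates of `x` and `-x` are nonnegative and cancel, so they all vanish. Hence no root is
both positive and negative. -/
theorem eq_zero_of_mem_cone {n : ℕ} {α : Fin n → E} (hα : LinearIndependent ℝ α) {x : E}
    (hx : x ∈ cone α) (hx' : -x ∈ cone α) : x = 0 := by
  obtain ⟨c, hc⟩ := mem_cone.1 hx
  obtain ⟨d, hd⟩ := mem_cone.1 hx'
  have h : ∑ i, ((c i : ℝ) + d i) • α i = 0 := by
    simp only [add_smul, Finset.sum_add_distrib, Nat.cast_smul_eq_nsmul, ← hc, ← hd]
    abel
  have h0 := Fintype.linearIndependent_iff.1 hα _ h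
  rw [hc]
  refine Finset.sum_eq_zero fun i _ => ?_
  have hi : c i + d i = 0 := by exact_mod_cast h0 i
  rw [show c i = 0 by omega, zero_smul]

theorem IsBasis.mem_cone_or {V : Submodule ℝ E} {Φ : Set E} {n : ℕ} {α : Fin n → E}
    (hα : IsBasis V Φ α) {b : E} (hb : b ∈ Φ) : b ∈ cone α ∨ -b ∈ cone α := by
  obtain ⟨c, h | h⟩ := hα.nonneg_or_nonpos b hb
  · exact .inl (mem_cone.2 ⟨c, h⟩)
  · exact .inr (mem_cone.2 ⟨c, by rw [h, neg_neg]⟩)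

theorem IsRootSystem.ne_zero {V : Submodule ℝ E} {Φ : Set E} (hΦ : IsRootSystem V Φ) {a : E}
    (ha : a ∈ Φ) : a ≠ 0 := fun h => hΦ.zero_notMem (h ▸ ha)

theorem IsRootSystem.neg_mem {V : Submodule ℝ E} {Φ : Set E} (hΦ : IsRootSystem V Φ) {a : E}
    (ha : a ∈ Φ) : -a ∈ Φ := refl_self a ▸ hΦ.refl_mem a ha a ha

section Reduced

variable {V : Submodule ℝ E} {Φ : Set E} {n : ℕ} {α : Fin n → E}

theorem IsBasis.ne_zero (hΦ : IsRootSystem V Φ) (hα : IsBasis V Φ α) (i : Fin n) : α i ≠ 0 :=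
  hΦ.ne_zero (hα.mem i)

/-- The only positive multiple of a simple root is the simple root. -/
theorem IsBasis.eq_of_nsmul_mem (hΦ : IsRootSystem V Φ) (hred : IsReduced Φ)
    (hα : IsBasis V Φ α) {i : Fin n} {m : ℕ} (hm : m • α i ∈ Φ) : m • α i = α i := by
  have hm0 : m ≠ 0 := by
    rintro rfl
    exact hΦ.zero_notMem (by simpa using hm)
  obtain ⟨k, hk⟩ := hΦ.integral _ hm _ (hα.mem i)
  have hαi : inner ℝ (α i) (α i) ≠ (0 : ℝ) := inner_self_ne_zero.mpr (hα.ne_zero hΦ i)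
  have hmR : (m : ℝ) ≠ 0 := by exact_mod_cast hm0
  -- The pairing of `α i` with the coroot of m α_i is 2/m. Its integrality leaves m = 1 or 2, and m
  -- = 2 contradicts reducedness.
  have hk' : (m : ℝ) * k = 2 := by
    rw [← hk, ← Nat.cast_smul_eq_nsmul ℝ]
    simp only [corootPairing, inner_smul_left, inner_smul_right, conj_trivial]
    field_simp
  have hk2 : (m : ℤ) * k = 2 := by exact_mod_cast hk'
  have hdvd : m ∣ 2 := by
    have : (m : ℤ) ∣ 2 := ⟨k, hk2.symm⟩
    exact_mod_cast this
  have hle := Nat.le_of_dvd two_pos hdvd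
  interval_cases m
  · simp at hm0
  · simp
  · exfalso
    apply hred _ hm
    rw [← Nat.cast_smul_eq_nsmul ℝ, smul_smul]
    norm_num
    exact hα.mem i

/-- A simple reflection permutes the positive roots other than its simple root. -/
theorem IsBasis.refl_mem_cone (hΦ : IsRootSystem V Φ) (hred : IsReduced Φ) (hα : IsBasis V Φ α)
    {i : Fin n} {b : E} (hb : b ∈ Φ) (hbc : b ∈ cone α) (hne : b ≠ α i) :
    refl (α i) b ∈ cone α := by
  obtain ⟨c, hc⟩ := mem_cone.1 hbc
  -- As `b` is not a multiple of `α i`, some other coordinate is positive. The reflection changes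
  -- only the coordinate at `i`, so that coordinate survives and the image cannot be negative.
  obtain ⟨k, hki, hk⟩ : ∃ k, k ≠ i ∧ c k ≠ 0 := by
    by_contra! h
    have hb' : b = c i • α i := by
      rw [hc]
      exact Finset.sum_eq_single i (fun k _ hk => by rw [h k hk, zero_smul]) (by simp)
    exact hne (hb'.trans (hα.eq_of_nsmul_mem hΦ hred (hb' ▸ hb)))
  refine (hα.mem_cone_or (hΦ.refl_mem _ (hα.mem i) _ hb)).resolve_right fun hneg => hk ?_
  obtain ⟨d, hd⟩ := mem_cone.1 hneg
  have h : ∑ m, ((c m : ℝ) + d m - if m = i then corootPairing (α i) b else 0) • α m = 0 := by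
    simp only [sub_smul, add_smul, Finset.sum_sub_distrib, Finset.sum_add_distrib,
      Nat.cast_smul_eq_nsmul, ← hc, ← hd, ite_smul, zero_smul, Finset.sum_ite_eq',
      Finset.mem_univ, if_true]
    rw [refl_apply]; abel
  have h0 := Fintype.linearIndependent_iff.1 hα.linearIndependent _ h k
  rw [if_neg hki, sub_zero] at h0
  have : c k + d k = 0 := by exact_mod_cast h0
  omega

/-- Every root is conjugate to a simple root under the simple reflections. -/
theorem IsBasis.exists_conj (hΦ : IsRootSystem V Φ) (hred : IsReduced Φ) (hα : IsBasis V Φ α)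
    {b : E} (hb : b ∈ Φ) :
    ∃ w ∈ Subgroup.closure (Set.range fun i => refl (α i)), ∃ i, b = w (α i) := by
  have key : ∀ (N : ℕ) (c : Fin n → ℕ), ∑ i, c i = N → ∑ i, c i • α i ∈ Φ →
      ∃ w ∈ Subgroup.closure (Set.range fun i => refl (α i)),
        ∃ i, ∑ i, c i • α i = w (α i) := by
    intro N
    induction N using Nat.strong_induction_on with
    | _ N ih =>
      intro c hcN hcΦ
      set b := ∑ i, c i • α i with hbdef
      by_cases hsimple : ∃ i, b = α i
      · obtain ⟨i, hi⟩ := hsimple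
        exact ⟨1, one_mem _, i, hi⟩
      push Not at hsimple
      -- Since (b, b) > 0 and `b` is a nonnegative combination of simple roots, one of them has
      -- positive inner product with `b`. Reflecting in it lowers the height, on which the induction
      -- runs.
      obtain ⟨i, hi⟩ : ∃ i, 0 < inner ℝ (α i) b := by
        by_contra! h
        have h1 : inner ℝ b b ≤ (0 : ℝ) := by
          nth_rewrite 1 [hbdef]
          rw [sum_inner]
          refine Finset.sum_nonpos fun i _ => ?_
          rw [← Nat.cast_smul_eq_nsmul ℝ, inner_smul_left]
          exact mul_nonpos_of_nonneg_of_nonpos (by simp) (h i)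
        exact hΦ.ne_zero hcΦ (real_inner_self_nonpos.1 h1)
      obtain ⟨k, hk⟩ := hΦ.integral _ (hα.mem i) _ hcΦ
      have hαi : 0 < inner ℝ (α i) (α i) := real_inner_self_pos.2 (hα.ne_zero hΦ i)
      have hk0 : 0 < k := by
        have : (0 : ℝ) < k := by
          rw [← hk]; unfold corootPairing; positivity
        exact_mod_cast this
      have hmem := hΦ.refl_mem _ (hα.mem i) _ hcΦ
      obtain ⟨d, hd⟩ := mem_cone.1
        (hα.refl_mem_cone hΦ hred hcΦ (mem_cone.2 ⟨c, rfl⟩) (hsimple i))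
      have hcd : ∑ m, ((c m : ℝ) - (if m = i then (k : ℝ) else 0) - d m) • α m = 0 := by
        simp only [sub_smul, Finset.sum_sub_distrib,
          Nat.cast_smul_eq_nsmul, ← hbdef, ← hd, ite_smul, zero_smul, Finset.sum_ite_eq',
          Finset.mem_univ, if_true]
        rw [refl_apply, hk]; abel
      have h0 := Fintype.linearIndependent_iff.1 hα.linearIndependent _ hcd
      have hsum : (∑ m, (c m : ℝ)) - k - ∑ m, (d m : ℝ) = 0 := by
        have := Finset.sum_congr rfl fun m (_ : m ∈ Finset.univ) => h0 m
        simpa [Finset.sum_sub_distrib] using this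
      have hlt : ∑ m, d m < N := by
        have h1 : ((∑ m, c m : ℕ) : ℤ) - k - ((∑ m, d m : ℕ) : ℤ) = 0 := by
          have : (((∑ m, c m : ℕ) : ℝ)) - k - ((∑ m, d m : ℕ) : ℝ) = 0 := by
            push_cast; exact hsum
          exact_mod_cast this
        omega
      obtain ⟨w, hw, m, hm⟩ := ih _ hlt d rfl (hd ▸ hmem)
      refine ⟨refl (α i) * w, mul_mem (Subgroup.subset_closure ⟨i, rfl⟩) hw, m, ?_⟩
      have := congrArg (refl (α i)) (hd.trans hm)
      rwa [refl_refl] at this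
  rcases hα.mem_cone_or hb with h | h
  · obtain ⟨c, rfl⟩ := mem_cone.1 h
    exact key _ c rfl hb
  · obtain ⟨c, hc⟩ := mem_cone.1 h
    obtain ⟨w, hw, i, hi⟩ := key _ c rfl (hc ▸ hΦ.neg_mem hb)
    refine ⟨w * refl (α i), mul_mem hw (Subgroup.subset_closure ⟨i, rfl⟩), i, ?_⟩
    rw [LinearIsometryEquiv.coe_mul, Function.comp_apply, refl_self, map_neg, ← hi, ← hc, neg_neg]

theorem IsBasis.closure_le_weylGroup (hα : IsBasis V Φ α) :
    Subgroup.closure (Set.range fun i => refl (α i)) ≤ weylGroup Φ :=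
  Subgroup.closure_mono (by rintro _ ⟨i, rfl⟩; exact ⟨_, hα.mem i, rfl⟩)

/-- The Weyl group is generated by the simple reflections. -/
theorem IsBasis.weylGroup_eq (hΦ : IsRootSystem V Φ) (hred : IsReduced Φ) (hα : IsBasis V Φ α) :
    weylGroup Φ = Subgroup.closure (Set.range fun i => refl (α i)) := by
  refine le_antisymm ((Subgroup.closure_le _).2 ?_) hα.closure_le_weylGroup
  rintro _ ⟨b, hb, rfl⟩
  obtain ⟨w, hw, i, rfl⟩ := hα.exists_conj hΦ hred hb
  rw [refl_map]
  exact mul_mem (mul_mem hw (Subgroup.subset_closure ⟨i, rfl⟩)) (inv_mem hw)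

theorem IsRootSystem.map_mem (hΦ : IsRootSystem V Φ) {w : E ≃ₗᵢ[ℝ] E} (hw : w ∈ weylGroup Φ)
    {b : E} (hb : b ∈ Φ) : w b ∈ Φ := by
  induction hw using Subgroup.closure_induction'' generalizing b with
  | one => exact hb
  | mem x hx =>
    obtain ⟨a, ha, rfl⟩ := hx
    exact hΦ.refl_mem a ha b hb
  | inv_mem x hx =>
    obtain ⟨a, ha, rfl⟩ := hx
    rw [refl_inv]
    exact hΦ.refl_mem a ha b hb
  | mul x y _ _ hx hy => exact hx (hy hb)

/-- A root system is contained in any set that contains a basis and is stable under the simple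
reflections. -/
theorem IsBasis.subset (hΦ : IsRootSystem V Φ) (hred : IsReduced Φ) (hα : IsBasis V Φ α)
    {Ψ : Set E} (hmem : ∀ i, α i ∈ Ψ) (hrefl : ∀ i, ∀ b ∈ Ψ, refl (α i) b ∈ Ψ) : Φ ⊆ Ψ := by
  intro b hb
  obtain ⟨w, hw, i, rfl⟩ := hα.exists_conj hΦ hred hb
  have key : ∀ b, b ∈ Ψ → w b ∈ Ψ := by
    clear hb
    induction hw using Subgroup.closure_induction'' with
    | one => exact fun b hb => hb
    | mem x hx =>
      obtain ⟨k, rfl⟩ := hx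
      exact hrefl k
    | inv_mem x hx =>
      obtain ⟨k, rfl⟩ := hx
      rw [refl_inv]
      exact hrefl k
    | mul x y _ _ hx hy => exact fun b hb => hx _ (hy _ hb)
  exact key _ (hmem i)

/-- A reduced root system is determined by a basis. -/
theorem IsBasis.eq {V' : Submodule ℝ E} {Ψ : Set E} (hΦ : IsRootSystem V Φ) (hred : IsReduced Φ)
    (hα : IsBasis V Φ α) (hΨ : IsRootSystem V' Ψ) (hred' : IsReduced Ψ) (hα' : IsBasis V' Ψ α) :
    Φ = Ψ :=
  (hα.subset hΦ hred hα'.mem fun i => hΨ.refl_mem _ (hα'.mem i)).antisymm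
    (hα'.subset hΨ hred' hα.mem fun i => hΦ.refl_mem _ (hα.mem i))

/-! ### Longest elements -/

/-- The product of simple reflections given by a word. -/
noncomputable def wordProd (α : Fin n → E) (L : List (Fin n)) : E ≃ₗᵢ[ℝ] E :=
  (L.map fun i => refl (α i)).prod

theorem wordProd_mem_closure {J : Set (Fin n)} {L : List (Fin n)} (hL : ∀ i ∈ L, i ∈ J) :
    wordProd α L ∈ Subgroup.closure ((fun i => refl (α i)) '' J) := by
  refine list_prod_mem fun x hx => ?_
  obtain ⟨i, hi, rfl⟩ := List.mem_map.1 hx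
  exact Subgroup.subset_closure ⟨i, hL i hi, rfl⟩

theorem exists_wordProd {J : Set (Fin n)} {w : E ≃ₗᵢ[ℝ] E}
    (hw : w ∈ Subgroup.closure ((fun i => refl (α i)) '' J)) :
    ∃ L : List (Fin n), (∀ i ∈ L, i ∈ J) ∧ wordProd α L = w := by
  induction hw using Subgroup.closure_induction'' with
  | one => exact ⟨[], by simp, by simp [wordProd]⟩
  | mem x hx =>
    obtain ⟨k, hk, rfl⟩ := hx
    exact ⟨[k], by simpa using hk, by simp [wordProd]⟩
  | inv_mem x hx =>
    obtain ⟨k, hk, rfl⟩ := hx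
    exact ⟨[k], by simpa using hk, by simp [wordProd, refl_inv]⟩
  | mul x y _ _ hx hy =>
    obtain ⟨L, hL, rfl⟩ := hx
    obtain ⟨M, hM, rfl⟩ := hy
    refine ⟨L ++ M, fun i hi => ?_, by simp [wordProd]⟩
    rcases List.mem_append.1 hi with h | h
    exacts [hL i h, hM i h]

theorem wordLength_wordProd_le {J : Set (Fin n)} {L : List (Fin n)} (hL : ∀ i ∈ L, i ∈ J) :
    wordLength ((fun i => refl (α i)) '' J) (wordProd α L) ≤ L.length := by
  refine Nat.sInf_le ⟨L.map fun i => refl (α i), fun s hs => ?_, by simp, rfl⟩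
  obtain ⟨i, hi, rfl⟩ := List.mem_map.1 hs
  exact ⟨i, hL i hi, rfl⟩

theorem exists_wordProd_of_image {J : Set (Fin n)} (M : List (E ≃ₗᵢ[ℝ] E))
    (hM : ∀ s ∈ M, s ∈ (fun i => refl (α i)) '' J) :
    ∃ L : List (Fin n), (∀ i ∈ L, i ∈ J) ∧ L.length = M.length ∧ wordProd α L = M.prod := by
  induction M with
  | nil => exact ⟨[], by simp, rfl, rfl⟩
  | cons s M ih =>
    obtain ⟨L, hL, hlen, hprod⟩ := ih fun t ht => hM t (List.mem_cons_of_mem _ ht)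
    obtain ⟨i, hi, rfl⟩ := hM s List.mem_cons_self
    refine ⟨i :: L, ?_, by simp [hlen], ?_⟩
    · intro k hk
      rcases List.mem_cons.1 hk with rfl | h
      exacts [hi, hL k h]
    · rw [List.prod_cons, ← hprod]; simp [wordProd]

theorem exists_wordProd_length {J : Set (Fin n)} {w : E ≃ₗᵢ[ℝ] E}
    (hw : w ∈ Subgroup.closure ((fun i => refl (α i)) '' J)) :
    ∃ L : List (Fin n), (∀ i ∈ L, i ∈ J) ∧
      L.length = wordLength ((fun i => refl (α i)) '' J) w ∧ wordProd α L = w := by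
  obtain ⟨L, hL, rfl⟩ := exists_wordProd hw
  have hne : {k | ∃ M : List (E ≃ₗᵢ[ℝ] E), (∀ s ∈ M, s ∈ (fun i => refl (α i)) '' J) ∧
      M.length = k ∧ M.prod = wordProd α L}.Nonempty := by
    refine ⟨_, L.map fun i => refl (α i), fun s hs => ?_, rfl, rfl⟩
    obtain ⟨i, hi, rfl⟩ := List.mem_map.1 hs
    exact ⟨i, hL i hi, rfl⟩
  obtain ⟨M, hM, hlen, hprod⟩ := Nat.sInf_mem hne
  obtain ⟨L', hL', hlen', hprod'⟩ := exists_wordProd_of_image M hM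
  exact ⟨L', hL', hlen'.trans hlen, hprod'.trans hprod⟩

theorem IsBasis.wordProd_mem (hΦ : IsRootSystem V Φ) (hα : IsBasis V Φ α) (L : List (Fin n))
    {b : E} (hb : b ∈ Φ) : wordProd α L b ∈ Φ := by
  refine hΦ.map_mem (hα.closure_le_weylGroup ?_) hb
  rw [← Set.image_univ]
  exact wordProd_mem_closure fun _ _ => Set.mem_univ _

/-- The exchange condition. -/
theorem IsBasis.exchange (hΦ : IsRootSystem V Φ) (hred : IsReduced Φ) (hα : IsBasis V Φ α)
    {J : Set (Fin n)} {L : List (Fin n)} (hL : ∀ i ∈ L, i ∈ J) {i : Fin n}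
    (hi : -(wordProd α L (α i)) ∈ cone α) :
    ∃ L' : List (Fin n), (∀ i ∈ L', i ∈ J) ∧ L'.length + 1 = L.length ∧
      wordProd α L * refl (α i) = wordProd α L' := by
  induction L with
  | nil =>
    exact absurd (eq_zero_of_mem_cone hα.linearIndependent (apply_mem_cone α i) hi)
      (hα.ne_zero hΦ i)
  | cons a T ih =>
    have hT : ∀ i ∈ T, i ∈ J := fun k hk => hL k (List.mem_cons_of_mem _ hk)
    have hcons : ∀ M : List (Fin n), wordProd α (a :: M) = refl (α a) * wordProd α M := by
      intro M; simp [wordProd]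
    -- If the tail `T` keeps `α i` positive, the letter `a` makes it negative. Only `α a` changes
    -- sign under its reflection, so `T` maps `α i` to `α a`, and `a` is the letter to delete.
    -- Otherwise the deletion happens inside `T`.
    rcases hα.mem_cone_or (hα.wordProd_mem hΦ T (hα.mem i)) with hpos | hneg
    · have hTa : wordProd α T (α i) = α a := by
        by_contra hne
        have h1 := hα.refl_mem_cone hΦ hred (hα.wordProd_mem hΦ T (hα.mem i)) hpos hne
        rw [hcons] at hi
        have h2 := eq_zero_of_mem_cone hα.linearIndependent h1 hi
        have h3 := hΦ.refl_mem _ (hα.mem a) _ (hα.wordProd_mem hΦ T (hα.mem i))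
        exact hΦ.ne_zero h3 h2
      refine ⟨T, hT, rfl, ?_⟩
      rw [hcons, ← hTa, refl_map]
      simp [mul_assoc, refl_mul_refl]
    · obtain ⟨L', hL', hlen, hprod⟩ := ih hT hneg
      refine ⟨a :: L', ?_, by simp [hlen], ?_⟩
      · intro k hk
        rcases List.mem_cons.1 hk with rfl | h
        exacts [hL _ List.mem_cons_self, hL' k h]
      · rw [hcons, hcons, mul_assoc, hprod]

/-- The longest element of a standard parabolic subgroup makes its simple roots negative. -/
theorem IsBasis.neg_mem_cone_of_isLongest (hΦ : IsRootSystem V Φ) (hred : IsReduced Φ)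
    (hα : IsBasis V Φ α) {J : Set (Fin n)} {w : E ≃ₗᵢ[ℝ] E}
    (hw : IsLongest (Subgroup.closure ((fun i => refl (α i)) '' J))
      ((fun i => refl (α i)) '' J) w) {i : Fin n} (hi : i ∈ J) : -(w (α i)) ∈ cone α := by
  have hmem : w * refl (α i) ∈ Subgroup.closure ((fun i => refl (α i)) '' J) :=
    mul_mem hw.1 (Subgroup.subset_closure ⟨i, hi, rfl⟩)
  obtain ⟨L, hL, hlen, hprod⟩ := exists_wordProd_length hmem
  have hwΦ : w (α i) ∈ Φ := by
    refine hΦ.map_mem (hα.closure_le_weylGroup ?_) (hα.mem i)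
    exact Subgroup.closure_mono (Set.image_subset_range _ _) hw.1
  refine (hα.mem_cone_or hwΦ).resolve_left fun hpos => ?_
  -- If `w` keeps `α i` positive, then w s_i makes it negative, and exchange in a shortest word of w
  -- s_i gives a shorter word for `w`, against maximality.
  obtain ⟨L', hL', hlen', hprod'⟩ := hα.exchange hΦ hred hL (i := i) (by
    rw [hprod, LinearIsometryEquiv.coe_mul, Function.comp_apply, refl_self, map_neg, neg_neg]; exact hpos)
  rw [hprod, mul_assoc, refl_mul_refl, mul_one] at hprod'
  have h1 := hw.2 _ hmem
  have h2 := wordLength_wordProd_le (α := α) hL'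
  rw [← hprod'] at h2
  omega

/-- An element of the Weyl group that makes no simple root negative is trivial. -/
theorem IsBasis.eq_one (hΦ : IsRootSystem V Φ) (hred : IsReduced Φ) (hα : IsBasis V Φ α)
    {w : E ≃ₗᵢ[ℝ] E} (hw : w ∈ weylGroup Φ) (h : ∀ i, w (α i) ∈ cone α) : w = 1 := by
  rw [hα.weylGroup_eq hΦ hred, ← Set.image_univ] at hw
  obtain ⟨L, hL, hlen, hprod⟩ := exists_wordProd_length hw
  rcases List.eq_nil_or_concat L with rfl | ⟨T, i, rfl⟩
  · rw [← hprod]; rfl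
  exfalso
  have hTi : wordProd α (T.concat i) = wordProd α T * refl (α i) := by simp [wordProd]
  -- A shortest word ending in `i` would have an initial part that makes `α i` negative, and
  -- exchange would shorten it by two letters.
  obtain ⟨L', hL', hlen', hprod'⟩ := hα.exchange hΦ hred (J := Set.univ) (L := T)
    (fun _ _ => Set.mem_univ _) (i := i) (by
      have := h i
      rwa [← hprod, hTi, LinearIsometryEquiv.coe_mul, Function.comp_apply, refl_self, map_neg] at this)
  have h2 := wordLength_wordProd_le (α := α) hL'
  rw [← hprod', ← hTi, hprod, ← hlen] at h2
  simp at h2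
  omega

end Reduced

end Folding

namespace Folding

variable {E : Type*} [NormedAddCommGroup E] [InnerProductSpace ℝ E]
variable {Φ : Set E} {n : ℕ} {α : Fin n → E}

/-! ### The element `ω` -/

theorem IsBasis.le_span {V : Submodule ℝ E} (hα : IsBasis V Φ α) :
    V ≤ Submodule.span ℝ (Set.range α) := hα.span_eq.ge

/-- The coordinate of a vector at a simple root. -/
noncomputable def IsBasis.coord (hα : IsBasis ⊤ Φ α) (j : Fin n) : E →ₗ[ℝ] ℝ :=
  (Module.Basis.mk hα.linearIndependent hα.le_span).coord j

theorem IsBasis.coord_apply (hα : IsBasis ⊤ Φ α) (j i : Fin n) :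
    hα.coord j (α i) = if i = j then 1 else 0 := by
  have h := (Module.Basis.mk hα.linearIndependent hα.le_span).repr_self i
  rw [Module.Basis.mk_apply] at h
  rw [IsBasis.coord, Module.Basis.coord_apply, h, Finsupp.single_apply]

theorem IsBasis.coord_nonneg (hα : IsBasis ⊤ Φ α) (j : Fin n) {x : E} (hx : x ∈ cone α) :
    0 ≤ hα.coord j x := by
  obtain ⟨c, rfl⟩ := mem_cone.1 hx
  rw [map_sum]
  refine Finset.sum_nonneg fun i _ => ?_
  rw [map_nsmul, hα.coord_apply]
  split_ifs <;> simp

/-- Each generator subtracts a multiple of a simple root other than `α j`. -/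
theorem IsBasis.coord_map_of_mem_closure (hα : IsBasis ⊤ Φ α) {j : Fin n} {w : E ≃ₗᵢ[ℝ] E}
    (hw : w ∈ Subgroup.closure ((fun i => refl (α i)) '' {i | i ≠ j})) (x : E) :
    hα.coord j (w x) = hα.coord j x := by
  have key : ∀ i, i ≠ j → ∀ x, hα.coord j (refl (α i) x) = hα.coord j x := by
    intro i hi x
    rw [refl_apply, map_sub, map_smul, hα.coord_apply, if_neg hi, smul_zero, sub_zero]
  induction hw using Subgroup.closure_induction'' generalizing x with
  | one => rfl
  | mem y hy =>
    obtain ⟨i, hi, rfl⟩ := hy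
    exact key i hi x
  | inv_mem y hy =>
    obtain ⟨i, hi, rfl⟩ := hy
    rw [refl_inv]
    exact key i hi x
  | mul y z _ _ hy hz => exact (hy _).trans (hz _)

/-- An element `v` of the Weyl group that maps each simple root to a simple root other than `α j`
or to a negative root involving `α j` is equal to `ω_j`. -/
theorem IsOmega.eq (hΦ : IsRootSystem ⊤ Φ) (hred : IsReduced Φ) (hα : IsBasis ⊤ Φ α)
    {j : Fin n} {ω v : E ≃ₗᵢ[ℝ] E} (hω : IsOmega Φ α j ω) (hv : v ∈ weylGroup Φ)
    (h : ∀ i, (∃ k, k ≠ j ∧ v (α i) = α k) ∨ ∃ p ∈ cone α, v (α i) = -(α j + p)) : ω = v := by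
  obtain ⟨w₀, wj, hw₀, hwj, rfl⟩ := hω
  have hw₀' : IsLongest (Subgroup.closure ((fun i => refl (α i)) '' Set.univ))
      ((fun i => refl (α i)) '' Set.univ) w₀ := by
    rw [Set.image_univ, ← hα.weylGroup_eq hΦ hred]
    exact hw₀
  have hwjW : wj ∈ weylGroup Φ := hα.closure_le_weylGroup
    (Subgroup.closure_mono (Set.image_subset_range _ _) hwj.1)
  have hneg₀ : ∀ x ∈ cone α, -(w₀ x) ∈ cone α := fun x hx =>
    map_mem_cone (-(w₀.toLinearEquiv : E →ₗ[ℝ] E))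
      (fun i => hα.neg_mem_cone_of_isLongest hΦ hred hw₀' (Set.mem_univ i)) hx
  -- The coordinate of v α_i at `j` is never positive, and when it vanishes v α_i is a positive
  -- root.
  have hcv : ∀ i, hα.coord j (v (α i)) = 0 ∧ v (α i) ∈ cone α ∨ hα.coord j (v (α i)) < 0 := by
    intro i
    rcases h i with ⟨k, hk, hik⟩ | ⟨p, hp, hip⟩
    · left
      rw [hik, hα.coord_apply, if_neg hk]
      exact ⟨rfl, apply_mem_cone α k⟩
    · right
      rw [hip, map_neg, map_add, hα.coord_apply, if_pos rfl]
      linarith [hα.coord_nonneg j hp]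
  have hu : w₀ * v⁻¹ * wj = 1 := by
    refine hα.eq_one hΦ hred (mul_mem (mul_mem hw₀.1 (inv_mem hv)) hwjW) fun k => ?_
    set x := v⁻¹ (wj (α k)) with hx
    have hvx : v x = wj (α k) := v.apply_symm_apply _
    have hxΦ : x ∈ Φ := hΦ.map_mem (inv_mem hv) (hΦ.map_mem hwjW (hα.mem k))
    change w₀ x ∈ cone α
    suffices hneg : -x ∈ cone α by
      have := hneg₀ _ hneg
      rwa [map_neg, neg_neg] at this
    refine (hα.mem_cone_or hxΦ).resolve_left fun hpos => ?_
    obtain ⟨c, hc⟩ := mem_cone.1 hpos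
    -- If x = v⁻¹ w_j α_k were positive, the `j`-coordinate of w_j α_k = v x would be a sum of
    -- nonpositive terms, while it equals that of α_k. For k = j this says 1 ≤ 0. For k ≠ j all
    -- terms vanish, so v x is a sum of positive roots, although w_j makes α_k negative.
    have hsum : hα.coord j (wj (α k)) = ∑ i, (c i : ℝ) * hα.coord j (v (α i)) := by
      rw [← hvx, hc, map_sum, map_sum]
      simp
    have hle : ∀ i ∈ Finset.univ, (c i : ℝ) * hα.coord j (v (α i)) ≤ 0 := fun i _ =>
      mul_nonpos_of_nonneg_of_nonpos (by simp) (by rcases hcv i with h | h; exacts [h.1.le, h.le])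
    rw [hα.coord_map_of_mem_closure hwj.1, hα.coord_apply] at hsum
    split_ifs at hsum with hkj
    · linarith [Finset.sum_nonpos hle]
    · have h0 := (Finset.sum_eq_zero_iff_of_nonpos hle).1 hsum.symm
      have hvxc : v x ∈ cone α := by
        rw [hc, map_sum]
        refine sum_mem fun i hi => ?_
        rw [map_nsmul]
        rcases hcv i with h | h
        · exact nsmul_mem h.2 _
        · have : c i = 0 := by
            rcases mul_eq_zero.1 (h0 i hi) with h' | h'
            · exact_mod_cast h'
            · exact absurd h' h.ne
          rw [this, zero_smul]
          exact zero_mem _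
      rw [hvx] at hvxc
      exact hΦ.ne_zero (hΦ.map_mem hwjW (hα.mem k)) (eq_zero_of_mem_cone hα.linearIndependent
        hvxc (hα.neg_mem_cone_of_isLongest hΦ hred hwj hkj))
  have h1 : v⁻¹ * wj = w₀⁻¹ := by
    rw [mul_assoc] at hu
    exact eq_inv_of_mul_eq_one_right hu
  have h2 : wj = v * w₀⁻¹ := by rw [← h1, mul_inv_cancel_left]
  rw [h2, inv_mul_cancel_right]

theorem IsBasis.comp_perm {V : Submodule ℝ E} (hα : IsBasis V Φ α) (σ : Equiv.Perm (Fin n)) :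
    IsBasis V Φ (α ∘ σ) where
  mem i := hα.mem _
  linearIndependent := hα.linearIndependent.comp _ σ.injective
  span_eq := by rw [σ.surjective.range_comp]; exact hα.span_eq
  nonneg_or_nonpos b hb := by
    obtain ⟨c, hc⟩ := hα.nonneg_or_nonpos b hb
    refine ⟨c ∘ σ, ?_⟩
    simp only [Function.comp_apply, Equiv.sum_comp σ fun i => c i • α i]
    exact hc
  indivisible i := hα.indivisible _

theorem IsOmega.comp_perm {j : Fin n} {ω : E ≃ₗᵢ[ℝ] E} (hω : IsOmega Φ α j ω)
    (σ : Equiv.Perm (Fin n)) : IsOmega Φ (α ∘ σ) (σ.symm j) ω := by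
  have h1 : (Set.range fun i => refl ((α ∘ σ) i)) = Set.range fun i => refl (α i) :=
    σ.surjective.range_comp fun i => refl (α i)
  have h2 : (fun i => refl ((α ∘ σ) i)) '' {i | i ≠ σ.symm j} =
      (fun i => refl (α i)) '' {i | i ≠ j} := by
    ext g
    constructor
    · rintro ⟨i, hi, rfl⟩
      exact ⟨σ i, fun h => hi (by simp [← h]), rfl⟩
    · rintro ⟨i, hi, rfl⟩
      exact ⟨σ.symm i, fun h => hi (σ.symm.injective h), by simp⟩
  unfold IsOmega
  rw [h1, h2]
  exact hω

/-! ### Averages -/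

section Average

variable {ω : E ≃ₗᵢ[ℝ] E}

/-- The terms for exponents 0 and o(ω) agree. Comparing the two forms of the sum shows that the
average is invariant under ω. -/
theorem average_eq_sum_range (ω : E ≃ₗᵢ[ℝ] E) (x : E) :
    average ω x = (1 / (orderOf ω : ℝ)) • ∑ t ∈ Finset.range (orderOf ω), (ω ^ t) x := by
  unfold average
  congr 1
  have h1 : ∑ t ∈ Finset.Icc 1 (orderOf ω), (ω ^ t) x =
      ∑ t ∈ Finset.range (orderOf ω), (ω ^ (t + 1)) x := by
    rw [← Finset.Ico_add_one_right_eq_Icc, Finset.sum_Ico_eq_sum_range]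
    simp [add_comm]
  have h2 := Finset.sum_range_succ (fun t => (ω ^ t) x) (orderOf ω)
  rw [Finset.sum_range_succ', pow_orderOf_eq_one, pow_zero] at h2
  rw [h1]
  exact add_right_cancel h2

theorem average_add (x y : E) : average ω (x + y) = average ω x + average ω y := by
  simp [average, Finset.sum_add_distrib]

theorem average_smul (c : ℝ) (x : E) : average ω (c • x) = c • average ω x := by
  simp only [average, map_smul, ← Finset.smul_sum]
  rw [smul_comm]

/-- The average as a linear map. -/
noncomputable def averageMap (ω : E ≃ₗᵢ[ℝ] E) : E →ₗ[ℝ] E where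
  toFun := average ω
  map_add' := average_add
  map_smul' := average_smul

theorem averageMap_apply (x : E) : averageMap ω x = average ω x := rfl

theorem average_neg (x : E) : average ω (-x) = -average ω x := map_neg (averageMap ω) x

theorem average_sub (x y : E) : average ω (x - y) = average ω x - average ω y :=
  map_sub (averageMap ω) x y

theorem average_map (x : E) : average ω (ω x) = average ω x := by
  rw [average_eq_sum_range]
  unfold average
  congr 1
  rw [← Finset.Ico_add_one_right_eq_Icc, Finset.sum_Ico_eq_sum_range]
  refine Finset.sum_congr rfl fun t _ => ?_
  rw [add_comm, pow_succ]
  rfl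

theorem map_average (x : E) : ω (average ω x) = average ω x := by
  conv_lhs => rw [average_eq_sum_range]
  unfold average
  rw [map_smul, map_sum]
  congr 1
  rw [← Finset.Ico_add_one_right_eq_Icc, Finset.sum_Ico_eq_sum_range]
  refine Finset.sum_congr rfl fun t _ => ?_
  rw [add_comm, pow_succ']
  rfl

theorem average_of_map_eq (hω : 0 < orderOf ω) {x : E} (hx : ω x = x) : average ω x = x := by
  have : ∀ t, (ω ^ t) x = x := by
    intro t
    induction t with
    | zero => rfl
    | succ t ih =>
      rw [pow_succ]
      change (ω ^ t) (ω x) = x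
      rw [hx, ih]
  have h0 : (orderOf ω : ℝ) ≠ 0 := by exact_mod_cast hω.ne'
  simp only [average, this, Finset.sum_const, Nat.card_Icc, Nat.add_sub_cancel]
  rw [← Nat.cast_smul_eq_nsmul ℝ, smul_smul, one_div, inv_mul_cancel₀ h0, one_smul]

theorem norm_average_le (hω : 0 < orderOf ω) (x : E) : ‖average ω x‖ ≤ ‖x‖ := by
  have h0 : (0 : ℝ) < orderOf ω := by exact_mod_cast hω
  unfold average
  rw [norm_smul, Real.norm_of_nonneg (by positivity)]
  calc 1 / (orderOf ω : ℝ) * ‖∑ t ∈ Finset.Icc 1 (orderOf ω), (ω ^ t) x‖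
      ≤ 1 / (orderOf ω : ℝ) * ∑ t ∈ Finset.Icc 1 (orderOf ω), ‖(ω ^ t) x‖ := by
        gcongr; exact norm_sum_le _ _
    _ = ‖x‖ := by
        simp only [LinearIsometryEquiv.norm_map, Finset.sum_const, Nat.card_Icc,
          Nat.add_sub_cancel, nsmul_eq_mul]
        field_simp

/-- ω permutes the finite set Φ, and a linear map is determined on the spanning set Φ, so two powers
of ω coincide. -/
theorem IsRootSystem.orderOf_pos (hΦ : IsRootSystem ⊤ Φ) (hω : ω ∈ weylGroup Φ) :
    0 < orderOf ω := by
  rw [orderOf_pos_iff]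
  by_contra hinf
  have hinj := injective_pow_iff_not_isOfFinOrder.2 hinf
  have := hΦ.finite.to_subtype
  let f : ℕ → Φ → Φ := fun t b => ⟨(ω ^ t) b, hΦ.map_mem (pow_mem hω t) b.2⟩
  obtain ⟨s, t, hst, hf⟩ := Finite.exists_ne_map_eq_of_infinite f
  refine hst (hinj (LinearIsometryEquiv.toLinearEquiv_injective (LinearEquiv.toLinearMap_injective ?_)))
  refine LinearMap.ext_on hΦ.span_eq fun b hb => ?_
  exact congrArg Subtype.val (congrFun hf ⟨b, hb⟩)

/-- A fixed vector is its own average, hence a combination of averages of roots, because Φ spans the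
space. -/
theorem span_foldedRoots (hΦ : IsRootSystem ⊤ Φ) (hω : 0 < orderOf ω) :
    Submodule.span ℝ (foldedRoots Φ ω) = fixedSpace ω := by
  apply le_antisymm
  · rw [Submodule.span_le]
    rintro _ ⟨_, b, hb, rfl⟩
    exact map_average b
  · intro x hx
    rw [← average_of_map_eq hω (mem_fixedSpace.1 hx)]
    have hx' : x ∈ Submodule.span ℝ Φ := by rw [hΦ.span_eq]; trivial
    have hle : Submodule.span ℝ Φ ≤
        (Submodule.span ℝ (foldedRoots Φ ω)).comap (averageMap ω) := by
      rw [Submodule.span_le]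
      intro b hb
      by_cases h0 : average ω b = 0
      · change average ω b ∈ Submodule.span ℝ (foldedRoots Φ ω)
        rw [h0]; exact zero_mem _
      · exact Submodule.subset_span ⟨h0, b, hb, rfl⟩
    exact hle hx'

end Average

/-! ### Criteria -/

/-- Halving divides the squared norm by 4, so `a / 2` would be shorter than every root. -/
theorem isIndivisible_of_norm_sq {m : ℝ} {a : E} (hΦ : ∀ b ∈ Φ, m ≤ inner ℝ b b)
    (ha : inner ℝ a a < 4 * m) : IsIndivisible Φ a := by
  intro h
  have := hΦ _ h
  rw [inner_smul_left, inner_smul_right] at this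
  norm_num at this
  rw [← real_inner_self_eq_norm_sq] at this
  linarith

/-- Pairing a linear relation with all the coroots gives a row vector killed by the invertible
matrix `M`. -/
theorem HasCartanMatrix.linearIndependent {M : Matrix (Fin n) (Fin n) ℤ}
    (h : HasCartanMatrix α M) (hM : M.det ≠ 0) : LinearIndependent ℝ α := by
  rw [Fintype.linearIndependent_iff]
  intro g hg
  have h1 : Matrix.vecMul g (M.map (Int.cast : ℤ → ℝ)) = 0 := by
    ext k
    have := congrArg (corootPairing (α k)) hg
    simp only [corootPairing_sum, corootPairing_smul, h _ k] at this
    simpa [Matrix.vecMul, dotProduct, corootPairing] using this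
  have h2 : (M.map (Int.cast : ℤ → ℝ)).det ≠ 0 := by
    have := Int.cast_det (R := ℝ) M
    rw [← this]
    exact_mod_cast hM
  exact congrFun (Matrix.eq_zero_of_vecMul_eq_zero h2 h1)

/-- Two families with the same Cartan matrix have proportional Gram matrices if each vertex of the
Dynkin diagram but the first is joined to an earlier one. -/
theorem HasCartanMatrix.exists_inner_eq {F : Type*} [NormedAddCommGroup F] [InnerProductSpace ℝ F]
    {M : Matrix (Fin n) (Fin n) ℤ} {β : Fin n → F} (hα : HasCartanMatrix α M)
    (hβ : HasCartanMatrix β M) (hα0 : ∀ i, α i ≠ 0) (hβ0 : ∀ i, β i ≠ 0)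
    (hM : ∀ i : Fin n, i.val ≠ 0 → ∃ p : Fin n, p < i ∧ M i p ≠ 0) :
    ∃ c : ℝ, 0 < c ∧ ∀ i k, inner ℝ (α i) (α k) = c * inner ℝ (β i) (β k) := by
  have hαp : ∀ i, 0 < inner ℝ (α i) (α i) := fun i => real_inner_self_pos.2 (hα0 i)
  have hβp : ∀ i, 0 < inner ℝ (β i) (β i) := fun i => real_inner_self_pos.2 (hβ0 i)
  have hα2 : ∀ i k, 2 * inner ℝ (α i) (α k) = M k i * inner ℝ (α i) (α i) := by
    intro i k
    rw [← hα k i, corootPairing, div_mul_cancel₀ _ (hαp i).ne']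
  have hβ2 : ∀ i k, 2 * inner ℝ (β i) (β k) = M k i * inner ℝ (β i) (β i) := by
    intro i k
    rw [← hβ k i, corootPairing, div_mul_cancel₀ _ (hβp i).ne']
  rcases n with _ | n
  · exact ⟨1, one_pos, fun i => i.elim0⟩
  refine ⟨inner ℝ (α 0) (α 0) / inner ℝ (β 0) (β 0), div_pos (hαp 0) (hβp 0), ?_⟩
  -- Along an edge of the diagram the two Cartan entries fix the ratio of the squared lengths, so
  -- the scale at the first vertex propagates to all vertices.
  have key : ∀ m : ℕ, ∀ i : Fin (n + 1), i.val = m → inner ℝ (α i) (α i) =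
      inner ℝ (α 0) (α 0) / inner ℝ (β 0) (β 0) * inner ℝ (β i) (β i) := by
    intro m
    induction m using Nat.strong_induction_on with
    | _ m ih =>
      intro i him
      rcases eq_or_ne i.val 0 with h0 | h0
      · rw [show i = 0 from Fin.ext h0, div_mul_cancel₀ _ (hβp 0).ne']
      obtain ⟨p, hpi, hMp⟩ := hM i h0
      have ihp := ih p.val (him ▸ hpi) p rfl
      have e1 := hα2 i p
      have e2 := hα2 p i
      have e3 := hβ2 i p
      have e4 := hβ2 p i
      rw [real_inner_comm] at e2 e4
      have hMp' : (M i p : ℝ) ≠ 0 := by exact_mod_cast hMp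
      have hMp2 : (M p i : ℝ) ≠ 0 := by
        intro h
        rw [h, zero_mul] at e3
        rw [e3] at e4
        exact mul_ne_zero hMp' (hβp p).ne' e4.symm
      apply mul_left_cancel₀ hMp2
      calc (M p i : ℝ) * inner ℝ (α i) (α i) = M i p * inner ℝ (α p) (α p) := by
            rw [← e1, ← e2]
        _ = inner ℝ (α 0) (α 0) / inner ℝ (β 0) (β 0) * (M i p * inner ℝ (β p) (β p)) := by
            rw [ihp]; ring
        _ = _ := by rw [← e4, e3]; ring
  intro i k
  have e1 := hα2 i k
  have e2 := hβ2 i k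
  rw [key i.val i rfl] at e1
  apply mul_left_cancel₀ (two_ne_zero (α := ℝ))
  rw [e1, mul_left_comm (2 : ℝ), e2]; ring

end Folding

namespace Folding

variable {E : Type*} [NormedAddCommGroup E] [InnerProductSpace ℝ E]
variable {n : ℕ}

/-! ### Root systems of type `A` -/

/-- The vectors `e i - e k` with `i ≠ k`. -/
def differenceRoots (e : Fin n → E) : Set E := {x | ∃ i k, i ≠ k ∧ x = e i - e k}

/-- The simple roots `e i - e (i + 1)`. -/
def differenceBasis (e : Fin (n + 1) → E) (i : Fin n) : E := e i.castSucc - e i.succ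

section TypeA

variable {c d : ℝ} {e : Fin n → E}

/-- Differences do not see the common offset `d`. It is kept because n + 1 coordinate vectors of
type A_n must fit into a space of dimension n, where they cannot be orthogonal. -/
theorem inner_sub_differenceRoots (he : ∀ i k, inner ℝ (e i) (e k) = (if i = k then c else 0) + d)
    (i k m : Fin n) :
    inner ℝ (e i - e k) (e m) = (if i = m then c else 0) - (if k = m then c else 0) := by
  rw [inner_sub_left, he, he]; ring

theorem inner_self_differenceRoots
    (he : ∀ i k, inner ℝ (e i) (e k) = (if i = k then c else 0) + d) {x : E}
    (hx : x ∈ differenceRoots e) : inner ℝ x x = 2 * c := by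
  obtain ⟨i, k, hik, rfl⟩ := hx
  rw [inner_sub_right, inner_sub_differenceRoots he, inner_sub_differenceRoots he]
  simp [hik, hik.symm]; ring

theorem corootPairing_differenceRoots (hc : 0 < c)
    (he : ∀ i k, inner ℝ (e i) (e k) = (if i = k then c else 0) + d) {i k : Fin n} (hik : i ≠ k)
    (m : Fin n) : corootPairing (e i - e k) (e m) =
      (if i = m then 1 else 0) - (if k = m then 1 else 0) := by
  rw [corootPairing, inner_self_differenceRoots he ⟨i, k, hik, rfl⟩,
    inner_sub_differenceRoots he]
  split_ifs <;> field_simp <;> ring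

theorem refl_differenceRoots (hc : 0 < c)
    (he : ∀ i k, inner ℝ (e i) (e k) = (if i = k then c else 0) + d) {i k : Fin n} (hik : i ≠ k)
    (m : Fin n) : refl (e i - e k) (e m) = e (Equiv.swap i k m) := by
  rw [refl_apply, corootPairing_differenceRoots hc he hik]
  rcases eq_or_ne m i with rfl | hi
  · simp [hik.symm]
  rcases eq_or_ne m k with rfl | hk
  · simp [hik]
  · simp [hi.symm, hk.symm, Equiv.swap_apply_of_ne_of_ne hi hk]

theorem isRootSystem_differenceRoots (hc : 0 < c)
    (he : ∀ i k, inner ℝ (e i) (e k) = (if i = k then c else 0) + d) :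
    IsRootSystem (Submodule.span ℝ (differenceRoots e)) (differenceRoots e) where
  finite := (Set.finite_range fun p : Fin n × Fin n => e p.1 - e p.2).subset (by
    rintro _ ⟨i, k, _, rfl⟩; exact ⟨(i, k), rfl⟩)
  zero_notMem h := by
    have := inner_self_differenceRoots he h
    rw [inner_zero_left] at this
    linarith
  span_eq := rfl
  refl_mem := by
    rintro _ ⟨i, k, hik, rfl⟩ _ ⟨p, q, hpq, rfl⟩
    refine ⟨Equiv.swap i k p, Equiv.swap i k q, (Equiv.injective _).ne hpq, ?_⟩
    rw [map_sub, refl_differenceRoots hc he hik, refl_differenceRoots hc he hik]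
  integral := by
    rintro _ ⟨i, k, hik, rfl⟩ _ ⟨p, q, hpq, rfl⟩
    refine ⟨((if i = p then 1 else 0) - (if k = p then 1 else 0)) -
      ((if i = q then 1 else 0) - (if k = q then 1 else 0)), ?_⟩
    rw [sub_eq_add_neg (e p), corootPairing_add, corootPairing_neg,
      corootPairing_differenceRoots hc he hik, corootPairing_differenceRoots hc he hik]
    push_cast; ring

theorem isReduced_differenceRoots (hc : 0 < c)
    (he : ∀ i k, inner ℝ (e i) (e k) = (if i = k then c else 0) + d) :
    IsReduced (differenceRoots e) := fun a ha =>
  isIndivisible_of_norm_sq (m := 2 * c) (fun _ hb => (inner_self_differenceRoots he hb).ge)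
    (by rw [inner_self_differenceRoots he ha]; linarith)

end TypeA

theorem sub_mem_cone_differenceBasis (e : Fin (n + 1) → E) {i k : Fin (n + 1)} (hik : i ≤ k) :
    e i - e k ∈ cone (differenceBasis e) := by
  induction k using Fin.induction with
  | zero => simp [Fin.le_zero_iff.1 hik]
  | succ k ih =>
    rcases hik.eq_or_lt with rfl | h
    · simp
    · rw [← sub_add_sub_cancel (e i) (e k.castSucc)]
      exact add_mem (ih (Fin.le_castSucc_iff.2 h)) (apply_mem_cone (differenceBasis e) k)

theorem isBasis_differenceRoots {c d : ℝ} {e : Fin (n + 1) → E} (hc : 0 < c)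
    (he : ∀ i k, inner ℝ (e i) (e k) = (if i = k then c else 0) + d) :
    IsBasis (Submodule.span ℝ (differenceRoots e)) (differenceRoots e) (differenceBasis e) := by
  have hmem : ∀ i, differenceBasis e i ∈ differenceRoots e := fun i =>
    ⟨i.castSucc, i.succ, (Fin.castSucc_lt_succ).ne, rfl⟩
  have hcone : ∀ b ∈ differenceRoots e,
      b ∈ cone (differenceBasis e) ∨ -b ∈ cone (differenceBasis e) := by
    rintro _ ⟨i, k, _, rfl⟩
    rcases le_total i k with h | h
    · exact .inl (sub_mem_cone_differenceBasis e h)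
    · exact .inr (by rw [neg_sub]; exact sub_mem_cone_differenceBasis e h)
  refine ⟨hmem, ?_, ?_, ?_, fun i => isReduced_differenceRoots hc he _ (hmem i)⟩
  · rw [Fintype.linearIndependent_iff]
    intro g hg k
    -- The partial sums e_0 + ... + e_k are, up to the factor `c`, dual to the simple roots, since
    -- the offset `d` cancels.
    have hw : ∀ i, inner ℝ (∑ p ∈ Finset.Iic k.castSucc, e p) (differenceBasis e i) =
        if i = k then c else 0 := by
      intro i
      simp only [differenceBasis, sum_inner, inner_sub_right, he, Finset.sum_add_distrib, Finset.sum_ite_eq', Finset.mem_Iic]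
      simp only [Fin.le_def, Fin.val_succ, Fin.val_castSucc, Fin.ext_iff]
      split_ifs <;> first | omega | ring
    have := congrArg (fun x => inner ℝ (∑ p ∈ Finset.Iic k.castSucc, e p) x) hg
    simp only [inner_sum, inner_smul_right, hw, inner_zero_right] at this
    simpa [hc.ne'] using this
  · apply le_antisymm
    · exact Submodule.span_mono (by rintro _ ⟨i, rfl⟩; exact hmem i)
    · rw [Submodule.span_le]
      intro b hb
      rcases hcone b hb with h | h
      · exact mem_span_of_mem_cone h
      · exact neg_mem_iff.1 (mem_span_of_mem_cone h)
  · intro b hb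
    rcases hcone b hb with h | h
    · obtain ⟨c, hc⟩ := mem_cone.1 h
      exact ⟨c, .inl hc⟩
    · obtain ⟨c, hc⟩ := mem_cone.1 h
      exact ⟨c, .inr (by rw [← hc, neg_neg])⟩

theorem hasCartanMatrix_differenceBasis {c d : ℝ} {e : Fin (n + 1) → E} (hc : 0 < c)
    (he : ∀ i k, inner ℝ (e i) (e k) = (if i = k then c else 0) + d) :
    HasCartanMatrix (differenceBasis e) (CartanMatrix.A n) := by
  intro i j
  unfold differenceBasis
  rw [sub_eq_add_neg (e i.castSucc), corootPairing_add, corootPairing_neg,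
    corootPairing_differenceRoots hc he (Fin.castSucc_lt_succ).ne,
    corootPairing_differenceRoots hc he (Fin.castSucc_lt_succ).ne]
  simp only [CartanMatrix.A, Matrix.of_apply, Fin.ext_iff, Fin.val_succ, Fin.val_castSucc]
  split_ifs <;> first | omega | norm_num

/-! ### Root systems of types `B`, `C`, `D` and `BC` -/

/-- The vectors `±e i ± e k` with `i ≠ k`, together with `±e i` if `s` holds and with `±2 e i` if
`l` holds. -/
def signedRoots (s l : Prop) (e : Fin n → E) : Set E :=
  {x | (∃ i k, i ≠ k ∧ ∃ ε δ : ℤˣ, x = ε • e i + δ • e k) ∨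
    (s ∧ ∃ i, ∃ ε : ℤˣ, x = ε • e i) ∨ (l ∧ ∃ i, ∃ ε : ℤˣ, x = ε • (2 : ℝ) • e i)}

section Signed

variable {s l : Prop} {c : ℝ} {e : Fin n → E}

theorem inner_units_smul_left (ε : ℤˣ) (x y : E) :
    inner ℝ (ε • x) y = ((ε : ℤ) : ℝ) * inner ℝ x y := by
  rcases Int.units_eq_one_or ε with rfl | rfl <;> simp

theorem inner_units_smul_right (ε : ℤˣ) (x y : E) :
    inner ℝ x (ε • y) = ((ε : ℤ) : ℝ) * inner ℝ x y := by
  rcases Int.units_eq_one_or ε with rfl | rfl <;> simp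

theorem map_units_smul {F : Type*} [AddCommGroup F] [Module ℝ F] (g : E →ₗ[ℝ] F) (ε : ℤˣ) (x : E) :
    g (ε • x) = ε • g x := by
  rcases Int.units_eq_one_or ε with rfl | rfl <;> simp

theorem isometry_units_smul (g : E ≃ₗᵢ[ℝ] E) (ε : ℤˣ) (x : E) : g (ε • x) = ε • g x :=
  map_units_smul g.toLinearEquiv.toLinearMap ε x

theorem units_mul_self (ε : ℤˣ) : ((ε : ℤ) : ℝ) * ((ε : ℤ) : ℝ) = 1 := by
  rcases Int.units_eq_one_or ε with rfl | rfl <;> simp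

theorem corootPairing_units_smul (a : E) (ε : ℤˣ) (x : E) :
    corootPairing a (ε • x) = ((ε : ℤ) : ℝ) * corootPairing a x := by
  rcases Int.units_eq_one_or ε with rfl | rfl <;> simp [corootPairing_neg]

theorem refl_units_smul (ε : ℤˣ) (a : E) : refl (ε • a) = refl a := by
  rcases Int.units_eq_one_or ε with rfl | rfl <;> simp [refl_neg]

theorem inner_self_signed_pair (he : ∀ i k, inner ℝ (e i) (e k) = if i = k then c else 0)
    {i k : Fin n} (hik : i ≠ k) (ε δ : ℤˣ) :
    inner ℝ (ε • e i + δ • e k) (ε • e i + δ • e k) = 2 * c := by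
  simp only [inner_add_left, inner_add_right, inner_units_smul_left, inner_units_smul_right, he,
    hik, hik.symm, if_true, if_false]
  linear_combination c * units_mul_self ε + c * units_mul_self δ

theorem inner_self_signedRoots (he : ∀ i k, inner ℝ (e i) (e k) = if i = k then c else 0) {x : E}
    (hx : x ∈ signedRoots s l e) :
    inner ℝ x x = 2 * c ∨ (s ∧ inner ℝ x x = c) ∨ (l ∧ inner ℝ x x = 4 * c) := by
  rcases hx with ⟨i, k, hik, ε, δ, rfl⟩ | ⟨hs, i, ε, rfl⟩ | ⟨hl, i, ε, rfl⟩
  · exact .inl (inner_self_signed_pair he hik ε δ)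
  · refine .inr (.inl ⟨hs, ?_⟩)
    rw [inner_units_smul_left, inner_units_smul_right, ← mul_assoc, units_mul_self, he]
    simp
  · refine .inr (.inr ⟨hl, ?_⟩)
    rw [inner_units_smul_left, inner_units_smul_right, ← mul_assoc, units_mul_self,
      inner_smul_left, inner_smul_right, he]
    simp; ring

theorem corootPairing_signed_pair (hc : 0 < c)
    (he : ∀ i k, inner ℝ (e i) (e k) = if i = k then c else 0)
    {i k : Fin n} (hik : i ≠ k) (ε δ : ℤˣ) (m : Fin n) :
    corootPairing (ε • e i + δ • e k) (e m) =
      ((ε : ℤ) : ℝ) * (if i = m then 1 else 0) + ((δ : ℤ) : ℝ) * (if k = m then 1 else 0) := by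
  rw [corootPairing, inner_self_signed_pair he hik, inner_add_left, inner_units_smul_left,
    inner_units_smul_left, he, he]
  split_ifs <;> field_simp <;> ring

theorem corootPairing_orthogonal (hc : 0 < c)
    (he : ∀ i k, inner ℝ (e i) (e k) = if i = k then c else 0) (i m : Fin n) :
    corootPairing (e i) (e m) = if i = m then 2 else 0 := by
  rw [corootPairing, he, he, if_pos rfl]
  split_ifs
  · field_simp
  · simp

/-- The reflection in `±e i ± e k` exchanges `e i` and `e k` up to sign. -/
theorem refl_signed_pair (hc : 0 < c)
    (he : ∀ i k, inner ℝ (e i) (e k) = if i = k then c else 0)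
    {i k : Fin n} (hik : i ≠ k) (ε δ : ℤˣ) (m : Fin n) :
    refl (ε • e i + δ • e k) (e m) =
      (if m = i ∨ m = k then -(ε * δ) else 1) • e (Equiv.swap i k m) := by
  rw [refl_apply, corootPairing_signed_pair hc he hik]
  rcases eq_or_ne m i with rfl | hi
  · rcases Int.units_eq_one_or ε with rfl | rfl <;> rcases Int.units_eq_one_or δ with rfl | rfl <;>
      simp [hik.symm]
  rcases eq_or_ne m k with rfl | hk
  · rcases Int.units_eq_one_or ε with rfl | rfl <;> rcases Int.units_eq_one_or δ with rfl | rfl <;>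
      simp [hik]
  · simp [hi, hk, hi.symm, hk.symm, Equiv.swap_apply_of_ne_of_ne hi hk]

theorem refl_orthogonal (hc : 0 < c)
    (he : ∀ i k, inner ℝ (e i) (e k) = if i = k then c else 0) (i m : Fin n) :
    refl (e i) (e m) = (if m = i then -1 else 1 : ℤˣ) • e m := by
  rw [refl_apply, corootPairing_orthogonal hc he]
  rcases eq_or_ne m i with rfl | hi
  · simp [two_smul]
  · simp [hi, hi.symm]

/-- Signed permutations of the vectors `e i` preserve the set `signedRoots s l e`. -/
theorem map_mem_signedRoots {g : E ≃ₗᵢ[ℝ] E} {π : Equiv.Perm (Fin n)} {η : Fin n → ℤˣ}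
    (hg : ∀ m, g (e m) = η m • e (π m)) {x : E} (hx : x ∈ signedRoots s l e) :
    g x ∈ signedRoots s l e := by
  rcases hx with ⟨i, k, hik, ε, δ, rfl⟩ | ⟨hs, i, ε, rfl⟩ | ⟨hl, i, ε, rfl⟩
  · refine .inl ⟨π i, π k, π.injective.ne hik, ε * η i, δ * η k, ?_⟩
    rw [map_add, isometry_units_smul, isometry_units_smul, hg, hg, smul_smul, smul_smul]
  · refine .inr (.inl ⟨hs, π i, ε * η i, ?_⟩)
    rw [isometry_units_smul, hg, smul_smul]
  · refine .inr (.inr ⟨hl, π i, ε * η i, ?_⟩)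
    rw [isometry_units_smul, map_smul, hg, smul_comm (2 : ℝ), smul_smul]

theorem exists_int_corootPairing (hc : 0 < c)
    (he : ∀ i k, inner ℝ (e i) (e k) = if i = k then c else 0) {a : E}
    (ha : a ∈ signedRoots s l e) (m : Fin n) : ∃ k : ℤ, corootPairing a (e m) = k := by
  rcases ha with ⟨i, k, hik, ε, δ, rfl⟩ | ⟨_, i, ε, rfl⟩ | ⟨_, i, ε, rfl⟩
  · refine ⟨ε * (if i = m then 1 else 0) + δ * (if k = m then 1 else 0), ?_⟩
    rw [corootPairing_signed_pair hc he hik]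
    push_cast; rfl
  · refine ⟨ε * (if i = m then 2 else 0), ?_⟩
    have h := corootPairing_orthogonal hc he i m
    rcases Int.units_eq_one_or ε with rfl | rfl
    · simp [h]
    · simp only [Units.neg_smul, one_smul, corootPairing_neg_left, h]
      split_ifs <;> simp
  · refine ⟨ε * (if i = m then 1 else 0), ?_⟩
    have h : corootPairing ((2 : ℝ) • e i) (e m) = if i = m then 1 else 0 := by
      simp only [corootPairing, inner_smul_left, inner_smul_right, he, conj_trivial, if_true]
      split_ifs
      · field_simp
      · simp
    rcases Int.units_eq_one_or ε with rfl | rfl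
    · simp [h]
    · simp only [Units.neg_smul, one_smul, corootPairing_neg_left, h]
      split_ifs <;> simp

theorem isRootSystem_signedRoots (hc : 0 < c)
    (he : ∀ i k, inner ℝ (e i) (e k) = if i = k then c else 0) :
    IsRootSystem (Submodule.span ℝ (signedRoots s l e)) (signedRoots s l e) where
  finite := by
    refine (((Set.finite_range fun p : (Fin n × Fin n) × (ℤˣ × ℤˣ) =>
      p.2.1 • e p.1.1 + p.2.2 • e p.1.2).union
      (Set.finite_range fun p : Fin n × ℤˣ => p.2 • e p.1)).union
      (Set.finite_range fun p : Fin n × ℤˣ => p.2 • (2 : ℝ) • e p.1)).subset ?_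
    rintro _ (⟨i, k, hik, ε, δ, rfl⟩ | ⟨_, i, ε, rfl⟩ | ⟨_, i, ε, rfl⟩)
    · exact .inl (.inl ⟨((i, k), (ε, δ)), rfl⟩)
    · exact .inl (.inr ⟨(i, ε), rfl⟩)
    · exact .inr ⟨(i, ε), rfl⟩
  zero_notMem h := by
    have := inner_self_signedRoots he h
    rw [inner_zero_left] at this
    rcases this with h | ⟨_, h⟩ | ⟨_, h⟩ <;> linarith
  span_eq := rfl
  refl_mem := by
    intro a ha b hb
    rcases ha with ⟨i, k, hik, ε, δ, rfl⟩ | ⟨_, i, ε, rfl⟩ | ⟨_, i, ε, rfl⟩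
    · exact map_mem_signedRoots (refl_signed_pair hc he hik ε δ) hb
    · rw [refl_units_smul]
      exact map_mem_signedRoots (π := 1) (refl_orthogonal hc he i) hb
    · rw [refl_units_smul, refl_smul two_ne_zero]
      exact map_mem_signedRoots (π := 1) (refl_orthogonal hc he i) hb
  integral := by
    intro a ha b hb
    have h := exists_int_corootPairing hc he ha
    rcases hb with ⟨i, k, hik, ε, δ, rfl⟩ | ⟨_, i, ε, rfl⟩ | ⟨_, i, ε, rfl⟩
    · obtain ⟨p, hp⟩ := h i
      obtain ⟨q, hq⟩ := h k
      refine ⟨ε * p + δ * q, ?_⟩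
      rw [corootPairing_add, corootPairing_units_smul, corootPairing_units_smul, hp, hq]
      push_cast; rfl
    · obtain ⟨p, hp⟩ := h i
      refine ⟨ε * p, ?_⟩
      rw [corootPairing_units_smul, hp]
      push_cast; rfl
    · obtain ⟨p, hp⟩ := h i
      refine ⟨ε * (2 * p), ?_⟩
      rw [corootPairing_units_smul, corootPairing_smul, hp]
      push_cast; rfl

theorem isReduced_signedRoots (hc : 0 < c)
    (he : ∀ i k, inner ℝ (e i) (e k) = if i = k then c else 0) (h : ¬(s ∧ l)) :
    IsReduced (signedRoots s l e) := by
  intro a ha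
  by_cases hs : s
  · refine isIndivisible_of_norm_sq (m := c) (fun b hb => ?_) ?_
    · rcases inner_self_signedRoots he hb with h | ⟨_, h⟩ | ⟨_, h⟩ <;> linarith
    · rcases inner_self_signedRoots he ha with h' | ⟨_, h'⟩ | ⟨hl, h'⟩
      · linarith
      · linarith
      · exact absurd ⟨hs, hl⟩ h
  · refine isIndivisible_of_norm_sq (m := 2 * c) (fun b hb => ?_) ?_
    · rcases inner_self_signedRoots he hb with h | ⟨hs', h⟩ | ⟨_, h⟩
      · linarith
      · exact absurd hs' hs
      · linarith
    · rcases inner_self_signedRoots he ha with h' | ⟨_, h'⟩ | ⟨hl, h'⟩ <;> linarith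

theorem not_isReduced_signedRoots (hs : s) (hl : l) (i : Fin n) :
    ¬ IsReduced (signedRoots s l e) := by
  intro h
  refine h ((2 : ℝ) • e i) (.inr (.inr ⟨hl, i, 1, by simp⟩)) (.inr (.inl ⟨hs, i, 1, ?_⟩))
  rw [smul_smul]; norm_num

end Signed

/-- The family `e 0 - e 1, e 1 - e 2, …` with last term `z`. -/
def signedBasis (e : Fin n → E) (z : E) (i : Fin n) : E :=
  if h : i.val + 1 < n then e i - e ⟨i.val + 1, h⟩ else z

/-! ### Simple roots of the systems of types `B`, `C`, `D` and `BC` -/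

section SignedBasis

variable {s l : Prop} {c : ℝ} {e : Fin n → E} {z : E}

theorem signedBasis_of_lt {i k : Fin n} (h : i.val + 1 = k.val) :
    signedBasis e z i = e i - e k := by
  have hi : i.val + 1 < n := h ▸ k.isLt
  rw [signedBasis, dif_pos hi]
  congr 2
  exact Fin.ext h

theorem signedBasis_last {t : Fin n} (ht : t.val + 1 = n) : signedBasis e z t = z := by
  rw [signedBasis, dif_neg (by omega)]

theorem sub_mem_cone_signedBasis {i k : Fin n} (hik : i ≤ k) :
    e i - e k ∈ cone (signedBasis e z) := by
  obtain ⟨k, hk⟩ := k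
  induction k with
  | zero =>
    rw [show i = ⟨0, hk⟩ from Fin.ext (Nat.le_zero.1 hik), sub_self]
    exact zero_mem _
  | succ k ih =>
    rcases hik.eq_or_lt with rfl | h
    · simp
    · have hk' : k < n := by omega
      rw [← sub_add_sub_cancel (e i) (e ⟨k, hk'⟩),
        ← signedBasis_of_lt (z := z) (i := ⟨k, hk'⟩) (k := ⟨k + 1, hk⟩) rfl]
      exact add_mem (ih hk' (Nat.lt_succ_iff.1 h)) (apply_mem_cone _ _)

theorem linearIndependent_of_orthogonal (hc : 0 < c)
    (he : ∀ i k, inner ℝ (e i) (e k) = if i = k then c else 0) : LinearIndependent ℝ e := by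
  rw [Fintype.linearIndependent_iff]
  intro g hg k
  have := congrArg (fun x => inner ℝ (e k) x) hg
  simp only [inner_sum, inner_smul_right, he, inner_zero_right] at this
  simpa [hc.ne'] using this

/-- Linear independence comes from counting: the span of the `n` vectors `α i` contains the `n`
independent vectors `e i`. -/
theorem isBasis_of_mem_cone {Φ : Set E} {α : Fin n → E} (he : LinearIndependent ℝ e)
    (hspan : ∀ i, e i ∈ Submodule.span ℝ (Set.range α)) (hmem : ∀ i, α i ∈ Φ)
    (hcone : ∀ b ∈ Φ, b ∈ cone α ∨ -b ∈ cone α) (hind : ∀ i, IsIndivisible Φ (α i)) :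
    IsBasis (Submodule.span ℝ Φ) Φ α := by
  refine ⟨hmem, ?_, ?_, ?_, hind⟩
  · rw [linearIndependent_iff_card_le_finrank_span]
    have h1 := linearIndependent_iff_card_eq_finrank_span.1 he
    rw [h1]
    have : FiniteDimensional ℝ (Submodule.span ℝ (Set.range α)) :=
      FiniteDimensional.span_of_finite ℝ (Set.finite_range α)
    refine Submodule.finrank_mono ?_
    rw [Submodule.span_le]
    rintro _ ⟨i, rfl⟩
    exact hspan i
  · apply le_antisymm
    · exact Submodule.span_mono (by rintro _ ⟨i, rfl⟩; exact hmem i)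
    · rw [Submodule.span_le]
      intro b hb
      rcases hcone b hb with h | h
      · exact mem_span_of_mem_cone h
      · exact neg_mem_iff.1 (mem_span_of_mem_cone h)
  · intro b hb
    rcases hcone b hb with h | h
    · obtain ⟨c, hc⟩ := mem_cone.1 h
      exact ⟨c, .inl hc⟩
    · obtain ⟨c, hc⟩ := mem_cone.1 h
      exact ⟨c, .inr (by rw [← hc, neg_neg])⟩

/-- Types B, C, D and BC differ only in the last simple root `z`. All e_i - e_k are sums of the
other simple roots, so positivity of the remaining roots reduces to conditions on `e t`. Sums e_i +
e_k are a separate hypothesis, and 2 e_t need only lie in the span, because in type D the vector 2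
e_t is not a sum of simple roots. -/
theorem isBasis_signedRoots (hc : 0 < c)
    (he : ∀ i k, inner ℝ (e i) (e k) = if i = k then c else 0) {t : Fin n} (ht : t.val + 1 = n)
    (hz : z ∈ signedRoots s l e)
    (hadd : ∀ i k, i < k → e i + e k ∈ cone (signedBasis e z))
    (htwo : (2 : ℝ) • e t ∈ Submodule.span ℝ (Set.range (signedBasis e z)))
    (hs : s → e t ∈ cone (signedBasis e z))
    (hl : l → (2 : ℝ) • e t ∈ cone (signedBasis e z))
    (hind : s → l → IsIndivisible (signedRoots s l e) z) :
    IsBasis (Submodule.span ℝ (signedRoots s l e)) (signedRoots s l e) (signedBasis e z) := by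
  have hle : ∀ i : Fin n, i ≤ t := fun i => by
    have := i.isLt
    exact Fin.le_def.2 (by omega)
  have hmem' : ∀ i : Fin n, i.val + 1 < n → signedBasis e z i ∈ signedRoots s l e ∧
      inner ℝ (signedBasis e z i) (signedBasis e z i) = 2 * c := by
    intro i hi
    rw [signedBasis_of_lt (i := i) (k := ⟨i + 1, hi⟩) rfl]
    have hne : i ≠ ⟨i + 1, hi⟩ := Fin.ne_of_val_ne (by simp)
    have h := inner_self_signed_pair he hne 1 (-1)
    simp only [one_smul, Units.neg_smul, ← sub_eq_add_neg] at h
    exact ⟨.inl ⟨i, _, hne, 1, -1, by simp [sub_eq_add_neg]⟩, h⟩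
  have hmem : ∀ i, signedBasis e z i ∈ signedRoots s l e := by
    intro i
    by_cases hi : i.val + 1 < n
    · exact (hmem' i hi).1
    · rw [signedBasis, dif_neg hi]; exact hz
  have het : e t ∈ Submodule.span ℝ (Set.range (signedBasis e z)) := by
    have := Submodule.smul_mem _ (2⁻¹ : ℝ) htwo
    rwa [smul_smul, inv_mul_cancel₀ two_ne_zero, one_smul] at this
  refine isBasis_of_mem_cone (linearIndependent_of_orthogonal hc he) (fun i => ?_) hmem ?_ ?_
  · rw [← sub_add_cancel (e i) (e t)]
    exact add_mem (mem_span_of_mem_cone (sub_mem_cone_signedBasis (hle i))) het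
  · have hpair : ∀ i k, i < k → ∀ ε δ : ℤˣ, ε • e i + δ • e k ∈ cone (signedBasis e z) ∨
        -(ε • e i + δ • e k) ∈ cone (signedBasis e z) := by
      intro i k hik ε δ
      have h1 := hadd i k hik
      have h2 := sub_mem_cone_signedBasis (e := e) (z := z) hik.le
      rcases Int.units_eq_one_or ε with rfl | rfl <;>
        rcases Int.units_eq_one_or δ with rfl | rfl
      · left; simpa using h1
      · left; simpa [sub_eq_add_neg] using h2
      · right; simpa [sub_eq_add_neg, add_comm] using h2
      · right; simpa [add_comm] using h1
    have hsingle : ∀ x ∈ cone (signedBasis e z), ∀ ε : ℤˣ, ε • x ∈ cone (signedBasis e z) ∨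
        -(ε • x) ∈ cone (signedBasis e z) := by
      intro x hx ε
      rcases Int.units_eq_one_or ε with rfl | rfl
      · left; simpa using hx
      · right; simpa using hx
    rintro _ (⟨i, k, hik, ε, δ, rfl⟩ | ⟨h, i, ε, rfl⟩ | ⟨h, i, ε, rfl⟩)
    · rcases lt_or_gt_of_ne hik with h | h
      · exact hpair i k h ε δ
      · rw [add_comm]; exact hpair k i h δ ε
    · refine hsingle _ ?_ ε
      rw [← sub_add_cancel (e i) (e t)]
      exact add_mem (sub_mem_cone_signedBasis (hle i)) (hs h)
    · refine hsingle _ ?_ ε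
      rw [← sub_add_cancel (e i) (e t), smul_add, two_smul]
      have := sub_mem_cone_signedBasis (e := e) (z := z) (hle i)
      exact add_mem (add_mem this this) (hl h)
  · intro i
    by_cases hsl : s ∧ l
    · by_cases hi : i.val + 1 < n
      · refine isIndivisible_of_norm_sq (m := c) (fun b hb => ?_) ?_
        · rcases inner_self_signedRoots he hb with h | ⟨_, h⟩ | ⟨_, h⟩ <;> linarith
        · rw [(hmem' i hi).2]; linarith
      · rw [signedBasis, dif_neg hi]; exact hind hsl.1 hsl.2
    · exact isReduced_signedRoots hc he hsl _ (hmem i)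

theorem add_mem_cone_signedBasis {t : Fin n} (ht : t.val + 1 = n)
    (htwo : (2 : ℝ) • e t ∈ cone (signedBasis e z)) (i k : Fin n) :
    e i + e k ∈ cone (signedBasis e z) := by
  have hle : ∀ i : Fin n, i ≤ t := fun i => by
    have := i.isLt
    exact Fin.le_def.2 (by omega)
  have : e i + e k = (e i - e t) + (e k - e t) + (2 : ℝ) • e t := by rw [two_smul]; abel
  rw [this]
  exact add_mem (add_mem (sub_mem_cone_signedBasis (hle i)) (sub_mem_cone_signedBasis (hle k))) htwo

/-- A basis of the root system of type `B` or `BC`. -/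
theorem isBasis_signedBasis_B (hc : 0 < c)
    (he : ∀ i k, inner ℝ (e i) (e k) = if i = k then c else 0) {t : Fin n} (ht : t.val + 1 = n)
    (hs : s) :
    IsBasis (Submodule.span ℝ (signedRoots s l e)) (signedRoots s l e)
      (signedBasis e (e t)) := by
  have h1 : e t ∈ cone (signedBasis e (e t)) := by
    have := apply_mem_cone (signedBasis e (e t)) t
    rwa [signedBasis_last ht] at this
  have h2 : (2 : ℝ) • e t ∈ cone (signedBasis e (e t)) := by
    rw [two_smul]; exact add_mem h1 h1
  refine isBasis_signedRoots hc he ht (.inr (.inl ⟨hs, t, 1, by simp⟩))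
    (fun i k _ => add_mem_cone_signedBasis ht h2 i k) (mem_span_of_mem_cone h2) (fun _ => h1)
    (fun _ => h2) (fun _ _ => isIndivisible_of_norm_sq (m := c) (fun b hb => ?_) ?_)
  · rcases inner_self_signedRoots he hb with h | ⟨_, h⟩ | ⟨_, h⟩ <;> linarith
  · rw [he, if_pos rfl]; linarith

/-- A basis of the root system of type `C`. -/
theorem isBasis_signedBasis_C (hc : 0 < c)
    (he : ∀ i k, inner ℝ (e i) (e k) = if i = k then c else 0) {t : Fin n} (ht : t.val + 1 = n)
    (hs : ¬ s) (hl : l) :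
    IsBasis (Submodule.span ℝ (signedRoots s l e)) (signedRoots s l e)
      (signedBasis e ((2 : ℝ) • e t)) := by
  have h2 : (2 : ℝ) • e t ∈ cone (signedBasis e ((2 : ℝ) • e t)) := by
    have := apply_mem_cone (signedBasis e ((2 : ℝ) • e t)) t
    rwa [signedBasis_last ht] at this
  exact isBasis_signedRoots hc he ht (.inr (.inr ⟨hl, t, 1, by simp⟩))
    (fun i k _ => add_mem_cone_signedBasis ht h2 i k) (mem_span_of_mem_cone h2)
    (fun h => absurd h hs) (fun _ => h2) (fun h _ => absurd h hs)

theorem add_mem_cone_signedBasis_D {u t : Fin n} (hu : u.val + 2 = n) (ht : t.val + 1 = n)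
    {i k : Fin n} (hik : i < k) : e i + e k ∈ cone (signedBasis e (e u + e t)) := by
  have h1 : e u + e t ∈ cone (signedBasis e (e u + e t)) := by
    have := apply_mem_cone (signedBasis e (e u + e t)) t
    rwa [signedBasis_last ht] at this
  have hk := k.isLt
  have hik' := Fin.lt_def.1 hik
  have h : e i + e k = (e i - e u) + (e k - e t) + (e u + e t) := by abel
  rw [h]
  exact add_mem (add_mem (sub_mem_cone_signedBasis (Fin.le_def.2 (by omega)))
    (sub_mem_cone_signedBasis (Fin.le_def.2 (by omega)))) h1

/-- A basis of the root system of type `D`. -/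
theorem isBasis_signedBasis_D (hc : 0 < c)
    (he : ∀ i k, inner ℝ (e i) (e k) = if i = k then c else 0) {u t : Fin n}
    (hu : u.val + 2 = n) (ht : t.val + 1 = n) (hs : ¬ s) (hl : ¬ l) :
    IsBasis (Submodule.span ℝ (signedRoots s l e)) (signedRoots s l e)
      (signedBasis e (e u + e t)) := by
  have hut : u < t := Fin.lt_def.2 (by omega)
  refine isBasis_signedRoots hc he ht (.inl ⟨u, t, hut.ne, 1, 1, by simp⟩)
    (fun i k hik => add_mem_cone_signedBasis_D hu ht hik) ?_
    (fun h => absurd h hs) (fun h => absurd h hl) (fun h _ => absurd h hs)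
  have h : (2 : ℝ) • e t = (e u + e t) - (e u - e t) := by rw [two_smul]; abel
  rw [h]
  exact sub_mem (mem_span_of_mem_cone (add_mem_cone_signedBasis_D hu ht hut))
    (mem_span_of_mem_cone (sub_mem_cone_signedBasis hut.le))

end SignedBasis

end Folding

namespace Folding

variable {E : Type*} [NormedAddCommGroup E] [InnerProductSpace ℝ E]
variable {n : ℕ}

/-! ### Cartan matrices of the bases of types `B`, `C` and `D` -/

section CartanMatrices

variable {c : ℝ} {e : Fin n → E}

theorem inner_signedBasis_of_lt (he : ∀ i k, inner ℝ (e i) (e k) = if i = k then c else 0)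
    {z w : E} {i k : Fin n} (hi : i.val + 1 < n) (hk : k.val + 1 < n) :
    inner ℝ (signedBasis e z i) (signedBasis e w k) =
      if i = k then 2 * c else if i.val + 1 = k.val ∨ k.val + 1 = i.val then -c else 0 := by
  rw [signedBasis_of_lt (i := i) (k := ⟨i + 1, hi⟩) rfl,
    signedBasis_of_lt (i := k) (k := ⟨k + 1, hk⟩) rfl]
  simp only [inner_sub_left, inner_sub_right, he, Fin.ext_iff]
  split_ifs <;> first | omega | ring

theorem inner_signedBasis_left (he : ∀ i k, inner ℝ (e i) (e k) = if i = k then c else 0)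
    {z : E} {i m : Fin n} (hi : i.val + 1 < n) :
    inner ℝ (signedBasis e z i) (e m) =
      if i = m then c else if i.val + 1 = m.val then -c else 0 := by
  rw [signedBasis_of_lt (i := i) (k := ⟨i + 1, hi⟩) rfl]
  simp only [inner_sub_left, he, Fin.ext_iff]
  split_ifs <;> first | omega | ring

theorem hasCartanMatrix_signedBasis_B (hc : 0 < c)
    (he : ∀ i k, inner ℝ (e i) (e k) = if i = k then c else 0) {t : Fin n} (ht : t.val + 1 = n) :
    HasCartanMatrix (signedBasis e (e t)) (CartanMatrix.B n) := by
  intro i j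
  have hi' := i.isLt
  have hj' := j.isLt
  rw [corootPairing]
  by_cases hi : i.val + 1 < n <;> by_cases hj : j.val + 1 < n
  · rw [inner_signedBasis_of_lt he hj hi, inner_signedBasis_of_lt he hj hj, if_pos rfl]
    simp only [CartanMatrix.B, Matrix.of_apply, Fin.ext_iff]
    split_ifs <;> first | omega | (field_simp; norm_num)
  · obtain rfl : j = t := Fin.ext (by omega)
    rw [signedBasis_last ht, real_inner_comm, inner_signedBasis_left he hi, he, if_pos rfl]
    simp only [CartanMatrix.B, Matrix.of_apply, Fin.ext_iff]
    split_ifs <;> first | omega | (field_simp; norm_num)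
  · obtain rfl : i = t := Fin.ext (by omega)
    rw [signedBasis_last ht, inner_signedBasis_left he hj, inner_signedBasis_of_lt he hj hj,
      if_pos rfl]
    simp only [CartanMatrix.B, Matrix.of_apply, Fin.ext_iff]
    split_ifs <;> first | omega | (field_simp; norm_num)
  · obtain rfl : i = t := Fin.ext (by omega)
    obtain rfl : j = i := Fin.ext (by omega)
    rw [signedBasis_last ht, he, if_pos rfl]
    simp only [CartanMatrix.B, Matrix.of_apply, if_pos]
    field_simp; norm_num

theorem hasCartanMatrix_signedBasis_C (hc : 0 < c)
    (he : ∀ i k, inner ℝ (e i) (e k) = if i = k then c else 0) {t : Fin n} (ht : t.val + 1 = n) :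
    HasCartanMatrix (signedBasis e ((2 : ℝ) • e t)) (CartanMatrix.C n) := by
  intro i j
  have hi' := i.isLt
  have hj' := j.isLt
  rw [corootPairing]
  by_cases hi : i.val + 1 < n <;> by_cases hj : j.val + 1 < n
  · rw [inner_signedBasis_of_lt he hj hi, inner_signedBasis_of_lt he hj hj, if_pos rfl]
    simp only [CartanMatrix.C, Matrix.of_apply, Fin.ext_iff]
    split_ifs <;> first | omega | (field_simp; norm_num)
  · obtain rfl : j = t := Fin.ext (by omega)
    rw [signedBasis_last ht, real_inner_comm, inner_smul_right, inner_smul_right,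
      inner_signedBasis_left he hi, inner_smul_left, he, if_pos rfl, conj_trivial]
    simp only [CartanMatrix.C, Matrix.of_apply, Fin.ext_iff]
    split_ifs <;> first | omega | (field_simp; norm_num)
  · obtain rfl : i = t := Fin.ext (by omega)
    rw [signedBasis_last ht, inner_smul_right, inner_signedBasis_left he hj,
      inner_signedBasis_of_lt he hj hj, if_pos rfl]
    simp only [CartanMatrix.C, Matrix.of_apply, Fin.ext_iff]
    split_ifs <;> first | omega | (field_simp; norm_num)
  · obtain rfl : i = t := Fin.ext (by omega)
    obtain rfl : j = i := Fin.ext (by omega)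
    rw [signedBasis_last ht, inner_smul_right, inner_smul_left, he, if_pos rfl, conj_trivial]
    simp only [CartanMatrix.C, Matrix.of_apply, if_pos]
    field_simp; norm_num

theorem inner_signedBasis_add (he : ∀ i k, inner ℝ (e i) (e k) = if i = k then c else 0)
    {z : E} {i u t : Fin n} (hi : i.val + 1 < n) (hu : u.val + 2 = n) (ht : t.val + 1 = n) :
    inner ℝ (signedBasis e z i) (e u + e t) = if i.val + 3 = n then -c else 0 := by
  rw [inner_add_right, inner_signedBasis_left he hi, inner_signedBasis_left he hi]
  simp only [Fin.ext_iff]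
  split_ifs <;> first | omega | ring

theorem hasCartanMatrix_signedBasis_D (hc : 0 < c)
    (he : ∀ i k, inner ℝ (e i) (e k) = if i = k then c else 0) (hn : 3 ≤ n) {u t : Fin n}
    (hu : u.val + 2 = n) (ht : t.val + 1 = n) :
    HasCartanMatrix (signedBasis e (e u + e t)) (CartanMatrix.D n) := by
  intro i j
  have hi' := i.isLt
  have hj' := j.isLt
  have hut : u ≠ t := Fin.ne_of_val_ne (by omega)
  have hz : inner ℝ (e u + e t) (e u + e t) = 2 * c := by
    rw [inner_add_left, inner_add_right, inner_add_right, he, he, he, he, if_pos rfl, if_neg hut,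
      if_neg hut.symm, if_pos rfl]
    ring
  rw [corootPairing]
  by_cases hi : i.val + 1 < n <;> by_cases hj : j.val + 1 < n
  · rw [inner_signedBasis_of_lt he hj hi, inner_signedBasis_of_lt he hj hj, if_pos rfl]
    simp only [CartanMatrix.D, Matrix.of_apply, Fin.ext_iff]
    split_ifs <;> first | omega | (field_simp; norm_num)
  · obtain rfl : j = t := Fin.ext (by omega)
    rw [signedBasis_last ht, real_inner_comm, inner_signedBasis_add he hi hu ht, hz]
    simp only [CartanMatrix.D, Matrix.of_apply, Fin.ext_iff]
    split_ifs <;> first | omega | (field_simp; norm_num)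
  · obtain rfl : i = t := Fin.ext (by omega)
    rw [signedBasis_last ht, inner_signedBasis_add he hj hu ht, inner_signedBasis_of_lt he hj hj,
      if_pos rfl]
    simp only [CartanMatrix.D, Matrix.of_apply, Fin.ext_iff]
    split_ifs <;> first | omega | (field_simp; norm_num)
  · obtain rfl : i = t := Fin.ext (by omega)
    obtain rfl : j = i := Fin.ext (by omega)
    rw [signedBasis_last ht, hz]
    simp only [CartanMatrix.D, Matrix.of_apply, if_pos]
    field_simp; norm_num

end CartanMatrices

/-! ### Coordinates for root systems of classical type -/

section Coordinates

variable {F : Type*} [NormedAddCommGroup F] [InnerProductSpace ℝ F]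

/-- A linear map between the spans of two families with the same Cartan matrix. -/
theorem HasCartanMatrix.exists_linearMap {M : Matrix (Fin n) (Fin n) ℤ} {α : Fin n → E}
    {β : Fin n → F} (hα : HasCartanMatrix α M) (hβ : HasCartanMatrix β M) (hα0 : ∀ i, α i ≠ 0)
    (hβl : LinearIndependent ℝ β)
    (hM : ∀ i : Fin n, i.val ≠ 0 → ∃ p : Fin n, p < i ∧ M i p ≠ 0) :
    ∃ c : ℝ, 0 < c ∧ ∃ T : Submodule.span ℝ (Set.range β) →ₗ[ℝ] E,
      (∀ i h, T ⟨β i, h⟩ = α i) ∧ ∀ x y, inner ℝ (T x) (T y) = c * inner ℝ (x : F) (y : F) := by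
  obtain ⟨c, hc, hin⟩ := hα.exists_inner_eq hβ hα0 hβl.ne_zero hM
  let b := Module.Basis.span hβl
  have hb : ∀ i, ((b i : Submodule.span ℝ (Set.range β)) : F) = β i := fun i =>
    congrArg Subtype.val (Module.Basis.span_apply hβl i)
  refine ⟨c, hc, b.constr ℝ α, fun i h => ?_, fun x y => ?_⟩
  · rw [show (⟨β i, h⟩ : Submodule.span ℝ (Set.range β)) = b i from Subtype.ext (hb i).symm]
    exact b.constr_basis ℝ α i
  · rw [← b.sum_repr x, ← b.sum_repr y]
    simp only [map_sum, map_smul, b.constr_basis, Submodule.coe_sum, Submodule.coe_smul, hb,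
      sum_inner, inner_sum, inner_smul_left, inner_smul_right, hin, Finset.mul_sum]
    refine Finset.sum_congr rfl fun i _ => Finset.sum_congr rfl fun k _ => ?_
    ring

theorem inner_euclideanSpace_single (i k : Fin n) :
    inner ℝ (EuclideanSpace.single i (1 : ℝ)) (EuclideanSpace.single k (1 : ℝ)) =
      if i = k then (1 : ℝ) else 0 := by
  rw [EuclideanSpace.inner_single_left]
  simp

/-- Coordinates for a basis with the Cartan matrix of `signedBasis`. -/
theorem exists_orthogonal_of_hasCartanMatrix {M : Matrix (Fin n) (Fin n) ℤ} {α : Fin n → E}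
    (hα : HasCartanMatrix α M) (hα0 : ∀ i, α i ≠ 0)
    (hM : ∀ i : Fin n, i.val ≠ 0 → ∃ p : Fin n, p < i ∧ M i p ≠ 0)
    (z : EuclideanSpace ℝ (Fin n))
    (hβ : HasCartanMatrix (signedBasis (fun i : Fin n => EuclideanSpace.single i (1 : ℝ)) z) M)
    (hβl : LinearIndependent ℝ
      (signedBasis (fun i : Fin n => EuclideanSpace.single i (1 : ℝ)) z)) :
    ∃ c : ℝ, 0 < c ∧ ∃ T : EuclideanSpace ℝ (Fin n) →ₗ[ℝ] E,
      (∀ i k, inner ℝ (T (EuclideanSpace.single i 1)) (T (EuclideanSpace.single k 1)) =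
        if i = k then c else 0) ∧
      α = signedBasis (fun i => T (EuclideanSpace.single i 1)) (T z) := by
  generalize hβdef : signedBasis (fun i : Fin n => EuclideanSpace.single i (1 : ℝ)) z = β
    at hβ hβl
  obtain ⟨c, hc, T, hT, hTin⟩ := hα.exists_linearMap hβ hα0 hβl hM
  have htop : Submodule.span ℝ (Set.range β) = ⊤ := by
    apply Submodule.eq_top_of_finrank_eq
    have := linearIndependent_iff_card_eq_finrank_span.1 hβl
    rw [Set.finrank] at this
    rw [← this]
    simp
  have hmem : ∀ y, y ∈ Submodule.span ℝ (Set.range β) := fun y => by rw [htop]; trivial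
  let T' : EuclideanSpace ℝ (Fin n) →ₗ[ℝ] E := T ∘ₗ LinearMap.codRestrict _ LinearMap.id hmem
  have hT' : ∀ i, T' (β i) = α i := fun i => hT i _
  refine ⟨c, hc, T', fun i k => ?_, ?_⟩
  · refine (hTin _ _).trans ?_
    change c * inner ℝ (EuclideanSpace.single i (1 : ℝ)) (EuclideanSpace.single k (1 : ℝ)) = _
    rw [inner_euclideanSpace_single]
    simp
  · funext i
    rw [← hT', ← hβdef, signedBasis, signedBasis]
    split_ifs
    · rw [map_sub]
    · rfl

variable {Φ : Set E} {V : Submodule ℝ E} {α : Fin n → E}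

/-- The Cartan matrix transports the orthogonal coordinates of the standard model to `E`. Then Φ and
the model share a basis, hence coincide. Types C and D are handled in the same way. -/
theorem IsBasis.exists_eq_signedRoots_B (hΦ : IsRootSystem V Φ) (hred : IsReduced Φ)
    (hα : IsBasis V Φ α) (hM : HasCartanMatrix α (CartanMatrix.B n)) {t : Fin n}
    (ht : t.val + 1 = n) :
    ∃ c : ℝ, 0 < c ∧ ∃ e : Fin n → E, (∀ i k, inner ℝ (e i) (e k) = if i = k then c else 0) ∧
      α = signedBasis e (e t) ∧ Φ = signedRoots True False e := by
  obtain ⟨c, hc, T, he, hαe⟩ := exists_orthogonal_of_hasCartanMatrix hM (hα.ne_zero hΦ)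
    (fun i hi => by
      refine ⟨⟨i - 1, by omega⟩, Fin.lt_def.2 (by simp; omega), ?_⟩
      simp only [CartanMatrix.B, Matrix.of_apply, Fin.ext_iff]
      split_ifs <;> omega)
    (EuclideanSpace.single t 1)
    (hasCartanMatrix_signedBasis_B one_pos inner_euclideanSpace_single ht)
    (isBasis_signedBasis_B (s := True) (l := False) one_pos inner_euclideanSpace_single ht trivial).linearIndependent
  refine ⟨c, hc, _, he, hαe, ?_⟩
  subst hαe
  exact hα.eq hΦ hred (isRootSystem_signedRoots hc he) (isReduced_signedRoots hc he (by simp))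
    (isBasis_signedBasis_B hc he ht trivial)

theorem IsBasis.exists_eq_signedRoots_C (hΦ : IsRootSystem V Φ) (hred : IsReduced Φ)
    (hα : IsBasis V Φ α) (hM : HasCartanMatrix α (CartanMatrix.C n)) {t : Fin n}
    (ht : t.val + 1 = n) :
    ∃ c : ℝ, 0 < c ∧ ∃ e : Fin n → E, (∀ i k, inner ℝ (e i) (e k) = if i = k then c else 0) ∧
      α = signedBasis e ((2 : ℝ) • e t) ∧ Φ = signedRoots False True e := by
  obtain ⟨c, hc, T, he, hαe⟩ := exists_orthogonal_of_hasCartanMatrix hM (hα.ne_zero hΦ)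
    (fun i hi => by
      refine ⟨⟨i - 1, by omega⟩, Fin.lt_def.2 (by simp; omega), ?_⟩
      simp only [CartanMatrix.C, Matrix.of_apply, Fin.ext_iff]
      split_ifs <;> omega)
    ((2 : ℝ) • EuclideanSpace.single t 1)
    (hasCartanMatrix_signedBasis_C one_pos inner_euclideanSpace_single ht)
    (isBasis_signedBasis_C (s := False) (l := True) one_pos inner_euclideanSpace_single ht not_false trivial).linearIndependent
  rw [map_smul] at hαe
  refine ⟨c, hc, _, he, hαe, ?_⟩
  subst hαe
  exact hα.eq hΦ hred (isRootSystem_signedRoots hc he) (isReduced_signedRoots hc he (by simp))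
    (isBasis_signedBasis_C hc he ht not_false trivial)

theorem IsBasis.exists_eq_signedRoots_D (hΦ : IsRootSystem V Φ) (hred : IsReduced Φ)
    (hα : IsBasis V Φ α) (hM : HasCartanMatrix α (CartanMatrix.D n)) (hn : 3 ≤ n) {u t : Fin n}
    (hu : u.val + 2 = n) (ht : t.val + 1 = n) :
    ∃ c : ℝ, 0 < c ∧ ∃ e : Fin n → E, (∀ i k, inner ℝ (e i) (e k) = if i = k then c else 0) ∧
      α = signedBasis e (e u + e t) ∧ Φ = signedRoots False False e := by
  obtain ⟨c, hc, T, he, hαe⟩ := exists_orthogonal_of_hasCartanMatrix hM (hα.ne_zero hΦ)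
    (fun i hi => by
      -- The last node of type D is joined to the node two places before it, not to its predecessor.
      by_cases h : i.val + 1 = n
      · refine ⟨⟨i - 2, by omega⟩, Fin.lt_def.2 (by simp; omega), ?_⟩
        simp only [CartanMatrix.D, Matrix.of_apply, Fin.ext_iff]
        split_ifs <;> omega
      · refine ⟨⟨i - 1, by omega⟩, Fin.lt_def.2 (by simp; omega), ?_⟩
        simp only [CartanMatrix.D, Matrix.of_apply, Fin.ext_iff]
        split_ifs <;> omega)
    (EuclideanSpace.single u 1 + EuclideanSpace.single t 1)
    (hasCartanMatrix_signedBasis_D one_pos inner_euclideanSpace_single hn hu ht)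
    (isBasis_signedBasis_D (s := False) (l := False) one_pos inner_euclideanSpace_single hu ht not_false not_false).linearIndependent
  rw [map_add] at hαe
  refine ⟨c, hc, _, he, hαe, ?_⟩
  subst hαe
  exact hα.eq hΦ hred (isRootSystem_signedRoots hc he) (isReduced_signedRoots hc he (by simp))
    (isBasis_signedBasis_D hc he hu ht not_false not_false)

/-- The model lives in the hyperplane of coordinate sum zero. The standard unit vectors are centred
by subtracting their mean, which preserves differences and gives the offset d = -c/(n+1). -/
theorem IsBasis.exists_eq_differenceRoots (hΦ : IsRootSystem V Φ) (hred : IsReduced Φ)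
    (hα : IsBasis V Φ α) (hM : HasCartanMatrix α (CartanMatrix.A n)) :
    ∃ c d : ℝ, 0 < c ∧ ∃ e : Fin (n + 1) → E,
      (∀ i k, inner ℝ (e i) (e k) = (if i = k then c else 0) + d) ∧
      α = differenceBasis e ∧ Φ = differenceRoots e := by
  let e₀ : Fin (n + 1) → EuclideanSpace ℝ (Fin (n + 1)) := fun i => EuclideanSpace.single i 1
  have he₀ : ∀ i k, inner ℝ (e₀ i) (e₀ k) = (if i = k then (1 : ℝ) else 0) + 0 := fun i k => by
    rw [add_zero]; exact inner_euclideanSpace_single i k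
  have hβb := isBasis_differenceRoots one_pos he₀
  obtain ⟨c, hc, T, hT, hTin⟩ := hM.exists_linearMap
    (hasCartanMatrix_differenceBasis one_pos he₀) (hα.ne_zero hΦ) hβb.linearIndependent
    (fun i hi => by
      refine ⟨⟨i - 1, by omega⟩, Fin.lt_def.2 (by simp; omega), ?_⟩
      simp only [CartanMatrix.A, Matrix.of_apply, Fin.ext_iff]
      split_ifs <;> omega)
  have hmem : ∀ i, e₀ i - e₀ (Fin.last n) ∈ Submodule.span ℝ (Set.range (differenceBasis e₀)) :=
    fun i => mem_span_of_mem_cone (sub_mem_cone_differenceBasis e₀ (Fin.le_last i))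
  set r : ℝ := 1 / (n + 1) with hr
  have hr' : r * (n + 1) = 1 := by rw [hr]; field_simp
  -- The centred vector e_i - mean, written through the differences e_k - e_n so that it visibly
  -- lies in the span of the simple roots.
  let v : Fin (n + 1) → Submodule.span ℝ (Set.range (differenceBasis e₀)) := fun i =>
    ⟨_, hmem i⟩ - r • ∑ k, ⟨_, hmem k⟩
  have hv : ∀ i, (v i : EuclideanSpace ℝ (Fin (n + 1))) = e₀ i - r • ∑ k, e₀ k := by
    intro i
    have h1 : ((n + 1 : ℕ) : ℝ) * r = 1 := by push_cast; linarith
    simp only [v, Submodule.coe_sub, Submodule.coe_smul, Submodule.coe_sum,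
      Finset.sum_sub_distrib, Finset.sum_const, Finset.card_univ, Fintype.card_fin, smul_sub]
    rw [← Nat.cast_smul_eq_nsmul ℝ, smul_smul, mul_comm r, h1, one_smul]
    abel
  have he : ∀ i k, inner ℝ (T (v i)) (T (v k)) = (if i = k then c else 0) + -(c * r) := by
    intro i k
    rw [hTin, hv, hv]
    simp only [inner_sub_left, inner_sub_right, inner_smul_left, inner_smul_right, inner_sum,
      sum_inner, he₀, conj_trivial, add_zero, Finset.sum_ite_eq', Finset.mem_univ, if_true]
    rw [Finset.sum_sub_distrib, Finset.sum_const, Finset.card_univ, Fintype.card_fin,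
      Finset.sum_ite_eq, if_pos (Finset.mem_univ _), nsmul_eq_mul]
    push_cast
    split_ifs <;> linear_combination c * r * hr'
  have hαe : α = differenceBasis fun i => T (v i) := by
    funext i
    rw [← hT i (Submodule.subset_span ⟨i, rfl⟩)]
    refine (congrArg T (Subtype.ext ?_)).trans (map_sub T (v i.castSucc) (v i.succ))
    rw [Submodule.coe_sub, hv, hv]
    exact (sub_sub_sub_cancel_right _ _ _).symm
  refine ⟨c, _, hc, _, he, hαe, ?_⟩
  subst hαe
  exact hα.eq hΦ hred (isRootSystem_differenceRoots hc he) (isReduced_differenceRoots hc he)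
    (isBasis_differenceRoots hc he)

end Coordinates

end Folding

namespace Folding

variable {E : Type*} [NormedAddCommGroup E] [InnerProductSpace ℝ E]
variable {n : ℕ}

/-! ### Folding root systems of types `B`, `C` and `D` -/

section Fold

variable {s l : Prop} {e : Fin n → E} {ω : E ≃ₗᵢ[ℝ] E}

theorem average_units_smul (ε : ℤˣ) (x : E) : average ω (ε • x) = ε • average ω x :=
  map_units_smul (averageMap ω) ε x

/-- If `ω` folds each `e i` to zero or to some `±f k`, then it folds `signedRoots` to
`signedRoots`. -/
theorem foldedRoots_signedRoots {m : ℕ} {f : Fin m → E} {s' l' : Prop} {c : ℝ} (hc : 0 < c)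
    (hf : ∀ i k, inner ℝ (f i) (f k) = if i = k then c else 0)
    (h : ∀ i, average ω (e i) = 0 ∨ ∃ k, ∃ η : ℤˣ, average ω (e i) = η • f k)
    (hsurj : ∀ k, ∃ i, ∃ η : ℤˣ, average ω (e i) = η • f k)
    (hs : s' ↔ s ∨ ∃ i, average ω (e i) = 0)
    (hl : l → l')
    (hl₁ : ∀ i i' k, ∀ η η' : ℤˣ, i ≠ i' → average ω (e i) = η • f k →
      average ω (e i') = η' • f k → l')
    (hl₂ : l' → l ∨ ∀ k, ∃ i i', i ≠ i' ∧ ∃ η η' : ℤˣ, average ω (e i) = η • f k ∧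
      average ω (e i') = η' • f k) :
    foldedRoots (signedRoots s l e) ω = signedRoots s' l' f := by
  have hne : ∀ y ∈ signedRoots s' l' f, y ≠ 0 := fun y hy =>
    (isRootSystem_signedRoots hc hf).ne_zero hy
  have hf0 : ∀ k, f k ≠ 0 := fun k => (linearIndependent_of_orthogonal hc hf).ne_zero k
  apply Set.Subset.antisymm
  · rintro y ⟨hy0, b, hb, rfl⟩
    rcases hb with ⟨i, k, hik, ε, δ, rfl⟩ | ⟨hs1, i, ε, rfl⟩ | ⟨hl1, i, ε, rfl⟩
    · rw [average_add, average_units_smul, average_units_smul] at hy0 ⊢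
      rcases h i with hi | ⟨p, η, hi⟩ <;> rcases h k with hk | ⟨q, η', hk⟩
      · simp [hi, hk] at hy0
      · rw [hi, hk, smul_zero, zero_add, smul_smul]
        exact .inr (.inl ⟨hs.2 (.inr ⟨i, hi⟩), q, _, rfl⟩)
      · rw [hi, hk, smul_zero, add_zero, smul_smul]
        exact .inr (.inl ⟨hs.2 (.inr ⟨k, hk⟩), p, _, rfl⟩)
      · rw [hi, hk, smul_smul, smul_smul] at hy0 ⊢
        -- If both coordinates fold onto the same line, the images add to ±2f or cancel.
        -- Cancellation is excluded because the average is nonzero.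
        rcases eq_or_ne p q with rfl | hpq
        · refine .inr (.inr ⟨hl₁ i k p η η' hik hi hk, p, ε * η, ?_⟩)
          rw [two_smul, smul_add, add_right_inj]
          by_contra hne'
          apply hy0
          have : δ * η' = -(ε * η) := by
            rcases Int.units_eq_one_or (δ * η') with h1 | h1 <;>
              rcases Int.units_eq_one_or (ε * η) with h2 | h2 <;> simp_all
          rw [this, Units.neg_smul, add_neg_cancel]
        · exact .inl ⟨p, q, hpq, _, _, rfl⟩
    · rw [average_units_smul] at hy0 ⊢
      rcases h i with hi | ⟨p, η, hi⟩
      · simp [hi] at hy0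
      · rw [hi, smul_smul]
        exact .inr (.inl ⟨hs.2 (.inl hs1), p, _, rfl⟩)
    · rw [average_units_smul, average_smul] at hy0 ⊢
      rcases h i with hi | ⟨p, η, hi⟩
      · simp [hi] at hy0
      · rw [hi, smul_comm (2 : ℝ), smul_smul]
        exact .inr (.inr ⟨hl hl1, p, _, rfl⟩)
  · intro y hy
    refine ⟨hne y hy, ?_⟩
    have hunit : ∀ {i k} {η : ℤˣ}, average ω (e i) = η • f k → ∀ ε : ℤˣ,
        average ω ((ε * η) • e i) = ε • f k := by
      intro i k η hi ε
      rw [average_units_smul, hi, smul_smul, mul_assoc, Int.units_mul_self, mul_one]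
    rcases hy with ⟨p, q, hpq, ε, δ, rfl⟩ | ⟨hs1, p, ε, rfl⟩ | ⟨hl1, p, ε, rfl⟩
    · obtain ⟨i, η, hi⟩ := hsurj p
      obtain ⟨k, η', hk⟩ := hsurj q
      have hik : i ≠ k := by
        rintro rfl
        have h0 := congrArg (inner ℝ (f p)) (hi.symm.trans hk)
        rw [inner_units_smul_right, inner_units_smul_right, hf, hf, if_pos rfl, if_neg hpq] at h0
        rcases Int.units_eq_one_or η with rfl | rfl <;> simp [hc.ne'] at h0
      refine ⟨_, .inl ⟨i, k, hik, ε * η, δ * η', rfl⟩, ?_⟩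
      rw [average_add, hunit hi, hunit hk]
    · obtain ⟨i, η, hi⟩ := hsurj p
      rcases hs.1 hs1 with h1 | ⟨k, hk⟩
      · exact ⟨_, .inr (.inl ⟨h1, i, ε * η, rfl⟩), hunit hi ε⟩
      -- A short root ±f_p arises from ±e_i + e_k, where e_i folds onto ±f_p and e_k folds to zero.
      · have hik : i ≠ k := by
          rintro rfl
          rw [hk] at hi
          rcases Int.units_eq_one_or η with rfl | rfl
          · exact hf0 p (by simpa using hi.symm)
          · exact hf0 p (by simpa using hi)
        refine ⟨_, .inl ⟨i, k, hik, ε * η, 1, rfl⟩, ?_⟩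
        rw [average_add, hunit hi, one_smul, hk, add_zero]
    · rcases hl₂ hl1 with h1 | h1
      · obtain ⟨i, η, hi⟩ := hsurj p
        refine ⟨_, .inr (.inr ⟨h1, i, ε * η, rfl⟩), ?_⟩
        rw [smul_comm, average_smul, hunit hi, smul_comm]
      -- A long root ±2f_p arises from two coordinates merging on the line of f_p, with signs chosen
      -- so that they add.
      · obtain ⟨i, k, hik, η, η', hi, hk⟩ := h1 p
        refine ⟨_, .inl ⟨i, k, hik, ε * η, ε * η', rfl⟩, ?_⟩
        rw [average_add, hunit hi, hunit hk, two_smul, smul_add]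

variable {m : ℕ} {f : Fin m → E} {c : ℝ} {Φ : Set E}

theorem isReducedOfType_B_of_foldedRoots_eq (hΦ : IsRootSystem ⊤ Φ) (hω : 0 < orderOf ω)
    (hc : 0 < c) (hf : ∀ i k, inner ℝ (f i) (f k) = if i = k then c else 0) (hm : 0 < m)
    (h : foldedRoots Φ ω = signedRoots True False f) :
    IsReducedOfType (fixedSpace ω) (foldedRoots Φ ω) (CartanMatrix.B m) := by
  have ht : (⟨m - 1, by omega⟩ : Fin m).val + 1 = m := by simp; omega
  rw [← span_foldedRoots hΦ hω, h]
  exact ⟨isRootSystem_signedRoots hc hf, isReduced_signedRoots hc hf (by simp), _,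
    isBasis_signedBasis_B hc hf ht trivial, hasCartanMatrix_signedBasis_B hc hf ht⟩

theorem isOfTypeBC_of_foldedRoots_eq (hΦ : IsRootSystem ⊤ Φ) (hω : 0 < orderOf ω)
    (hc : 0 < c) (hf : ∀ i k, inner ℝ (f i) (f k) = if i = k then c else 0) (hm : 0 < m)
    (h : foldedRoots Φ ω = signedRoots True True f) :
    IsOfTypeBC (fixedSpace ω) (foldedRoots Φ ω) m := by
  have ht : (⟨m - 1, by omega⟩ : Fin m).val + 1 = m := by simp; omega
  rw [← span_foldedRoots hΦ hω, h]
  exact ⟨isRootSystem_signedRoots hc hf, not_isReduced_signedRoots trivial trivial ⟨0, hm⟩, _,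
    isBasis_signedBasis_B hc hf ht trivial, hasCartanMatrix_signedBasis_B hc hf ht⟩

theorem isReducedOfType_C_of_foldedRoots_eq (hΦ : IsRootSystem ⊤ Φ) (hω : 0 < orderOf ω)
    (hc : 0 < c) (hf : ∀ i k, inner ℝ (f i) (f k) = if i = k then c else 0) (hm : 0 < m)
    (h : foldedRoots Φ ω = signedRoots False True f) :
    IsReducedOfType (fixedSpace ω) (foldedRoots Φ ω) (CartanMatrix.C m) := by
  have ht : (⟨m - 1, by omega⟩ : Fin m).val + 1 = m := by simp; omega
  rw [← span_foldedRoots hΦ hω, h]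
  exact ⟨isRootSystem_signedRoots hc hf, isReduced_signedRoots hc hf (by simp), _,
    isBasis_signedBasis_C hc hf ht not_false trivial, hasCartanMatrix_signedBasis_C hc hf ht⟩

end Fold

end Folding

namespace Folding

variable {E : Type*} [NormedAddCommGroup E] [InnerProductSpace ℝ E]
variable {n : ℕ}

theorem eq_zero_of_neg_eq_self {x : E} (h : -x = x) : x = 0 := by
  have h2 : (2 : ℝ) • x = 0 := by
    rw [two_smul]
    nth_rewrite 1 [← h]
    exact neg_add_cancel x
  simpa using h2

theorem average_eq_zero_of_map_eq_neg {ω : E ≃ₗᵢ[ℝ] E} {x : E}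
    (h : ω x = -x) : average ω x = 0 := by
  have := average_map (ω := ω) x
  rw [h, average_neg] at this
  exact eq_zero_of_neg_eq_self this

/-- The vector `x - y` is fixed, and `y` has average opposite to that of `x`. -/
theorem average_of_map_eq_neg {ω : E ≃ₗᵢ[ℝ] E} (hω : 0 < orderOf ω) {x y : E}
    (hx : ω x = -y) (hy : ω y = -x) : average ω x = (1 / 2 : ℝ) • (x - y) := by
  have h1 := average_map (ω := ω) x
  rw [hx, average_neg] at h1
  have h2 := average_of_map_eq hω (x := x - y) (by rw [map_sub, hx, hy]; abel)
  rw [← h2, average_sub, ← neg_eq_iff_eq_neg.2 h1.symm, sub_neg_eq_add, ← two_smul ℝ, smul_smul]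
  norm_num

/-! ### Elements of the Weyl groups -/

section WeylElements

variable {s l : Prop} {c : ℝ} {e : Fin n → E}

theorem refl_sub_mem_weylGroup {i k : Fin n} (hik : i ≠ k) :
    refl (e i - e k) ∈ weylGroup (signedRoots s l e) :=
  Subgroup.subset_closure ⟨_, .inl ⟨i, k, hik, 1, -1, by simp [sub_eq_add_neg]⟩, rfl⟩

theorem refl_add_mem_weylGroup {i k : Fin n} (hik : i ≠ k) :
    refl (e i + e k) ∈ weylGroup (signedRoots s l e) :=
  Subgroup.subset_closure ⟨_, .inl ⟨i, k, hik, 1, 1, by simp⟩, rfl⟩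

theorem refl_sub_apply (hc : 0 < c) (he : ∀ i k, inner ℝ (e i) (e k) = if i = k then c else 0)
    {i k : Fin n} (hik : i ≠ k) (m : Fin n) :
    refl (e i - e k) (e m) = e (Equiv.swap i k m) :=
  refl_differenceRoots (d := 0) hc (by simpa using he) hik m

/-- Every permutation of the vectors `e i` is induced by an element of the Weyl group. -/
theorem exists_mem_weylGroup_perm (hc : 0 < c)
    (he : ∀ i k, inner ℝ (e i) (e k) = if i = k then c else 0) (π : Equiv.Perm (Fin n)) :
    ∃ w ∈ weylGroup (signedRoots s l e), ∀ i, w (e i) = e (π i) := by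
  induction π using Equiv.Perm.swap_induction_on with
  | one => exact ⟨1, one_mem _, fun i => rfl⟩
  | swap_mul σ x y hxy ih =>
    obtain ⟨w, hw, h⟩ := ih
    refine ⟨refl (e x - e y) * w, mul_mem (refl_sub_mem_weylGroup hxy) hw, fun i => ?_⟩
    rw [LinearIsometryEquiv.coe_mul, Function.comp_apply, h, refl_sub_apply hc he hxy]
    rfl

theorem refl_sub_refl_add (hc : 0 < c)
    (he : ∀ i k, inner ℝ (e i) (e k) = if i = k then c else 0) {i k : Fin n} (hik : i ≠ k)
    (m : Fin n) :
    refl (e i - e k) (refl (e i + e k) (e m)) = if m = i ∨ m = k then -e m else e m := by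
  have h := refl_signed_pair hc he hik 1 1 m
  simp only [one_smul, mul_one] at h
  rw [h, isometry_units_smul, refl_sub_apply hc he hik, Equiv.swap_apply_self]
  split_ifs <;> simp

/-- Any number of the vectors `e i` other than `e t` can be negated by the Weyl group. -/
theorem exists_mem_weylGroup_neg (hc : 0 < c)
    (he : ∀ i k, inner ℝ (e i) (e k) = if i = k then c else 0) (t : Fin n) (S : Finset (Fin n))
    (hS : t ∉ S) : ∃ w ∈ weylGroup (signedRoots s l e),
      (∀ i, i ≠ t → w (e i) = if i ∈ S then -e i else e i) ∧ w (e t) = (-1 : ℤˣ) ^ S.card • e t := by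
  induction S using Finset.induction_on with
  | empty => exact ⟨1, one_mem _, fun i _ => by simp, by simp⟩
  | insert a S ha ih =>
    obtain ⟨hta, htS⟩ := not_or.1 (Finset.mem_insert.not.1 hS)
    obtain ⟨w, hw, h1, h2⟩ := ih htS
    have hat : a ≠ t := Ne.symm hta
    have hr := refl_sub_refl_add hc he hat
    refine ⟨refl (e a - e t) * refl (e a + e t) * w,
      mul_mem (mul_mem (refl_sub_mem_weylGroup hat) (refl_add_mem_weylGroup hat)) hw,
      fun i hi => ?_, ?_⟩
    · change refl (e a - e t) (refl (e a + e t) (w (e i))) = _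
      rw [h1 i hi]
      rcases eq_or_ne i a with rfl | hia
      · simp [ha, hr]
      · by_cases hiS : i ∈ S <;> simp [hiS, hia, hr, hi]
    · change refl (e a - e t) (refl (e a + e t) (w (e t))) = _
      rw [h2, isometry_units_smul, isometry_units_smul, hr, if_pos (.inr rfl),
        Finset.card_insert_of_notMem ha, pow_succ, mul_neg_one, Units.neg_smul, smul_neg]

end WeylElements

variable {Φ : Set E} {α : Fin n → E} {j : Fin n} {ω : E ≃ₗᵢ[ℝ] E}

/-! ### The first node of types `B` and `D` -/

/-- Here ω is the reflection in the short root e_1. It sends e_1 - e_2 to -(e_1 + e_2) and fixes the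
other simple roots. Folding deletes the coordinate e_1 and keeps the others. -/
theorem fold_B (hΦ : IsRootSystem ⊤ Φ) (hred : IsReduced Φ) (hα : IsBasis ⊤ Φ α)
    (hω : IsOmega Φ α j ω) (hn : 2 ≤ n) (hM : HasCartanMatrix α (CartanMatrix.B n))
    (hj : j.val = 0) :
    IsReducedOfType (fixedSpace ω) (foldedRoots Φ ω) (CartanMatrix.B (n - 1)) := by
  obtain ⟨t, ht⟩ : ∃ t : Fin n, t.val + 1 = n := ⟨⟨n - 1, by omega⟩, by simp; omega⟩
  obtain ⟨c, hc, e, he, rfl, rfl⟩ := hα.exists_eq_signedRoots_B hΦ hred hM ht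
  have hv : refl (e j) ∈ weylGroup (signedRoots True False e) :=
    Subgroup.subset_closure ⟨_, .inr (.inl ⟨trivial, j, 1, by simp⟩), rfl⟩
  have hneg : refl (e j) (e j) = -e j := refl_self _
  have hfix : ∀ i, i ≠ j → refl (e j) (e i) = e i := fun i hi => by
    rw [refl_orthogonal hc he, if_neg hi, one_smul]
  have hωv : ω = refl (e j) := by
    refine hω.eq hΦ hred hα hv fun i => ?_
    by_cases hi : i = j
    · right
      subst hi
      have het : e t ∈ cone (signedBasis e (e t)) := by
        have := apply_mem_cone (signedBasis e (e t)) t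
        rwa [signedBasis_last ht] at this
      obtain ⟨k, hk⟩ : ∃ k : Fin n, i.val + 1 = k.val := ⟨⟨i + 1, by omega⟩, rfl⟩
      have hki : k ≠ i := Fin.ne_of_val_ne (by omega)
      have hek : e k ∈ cone (signedBasis e (e t)) := by
        rw [← sub_add_cancel (e k) (e t)]
        exact add_mem (sub_mem_cone_signedBasis (Fin.le_def.2 (by omega))) het
      refine ⟨e k + e k, add_mem hek hek, ?_⟩
      rw [signedBasis_of_lt hk, map_sub, hneg, hfix k hki]
      abel
    · left
      have hi0 : i.val ≠ 0 := fun h => hi (Fin.ext (by omega))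
      refine ⟨i, hi, ?_⟩
      by_cases hin : i.val + 1 < n
      · rw [signedBasis_of_lt (k := ⟨i + 1, hin⟩) rfl, map_sub, hfix i hi,
          hfix _ (Fin.ne_of_val_ne (by simp; omega))]
      · obtain rfl : i = t := Fin.ext (by omega)
        rw [signedBasis_last ht, hfix i hi]
  have hord : 0 < orderOf ω := hΦ.orderOf_pos (hωv ▸ hv)
  have hj0 : average ω (e j) = 0 := average_eq_zero_of_map_eq_neg (hωv ▸ hneg)
  have hav : ∀ i, i ≠ j → average ω (e i) = e i := fun i hi =>
    average_of_map_eq hord (hωv ▸ hfix i hi)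
  have hinj : ∀ {i k : Fin n} {η : ℤˣ}, i ≠ j → average ω (e i) = η • e k → i = k := by
    intro i k η hi h
    by_contra hik
    rw [hav i hi] at h
    have h0 := congrArg (inner ℝ (e i)) h
    rw [inner_units_smul_right, he, he, if_pos rfl, if_neg hik, mul_zero] at h0
    exact hc.ne' h0
  let f : Fin (n - 1) → E := fun k => e ⟨k + 1, by omega⟩
  have hfj : ∀ k : Fin (n - 1), (⟨k + 1, by omega⟩ : Fin n) ≠ j := fun k =>
    Fin.ne_of_val_ne (by simp [hj])
  refine isReducedOfType_B_of_foldedRoots_eq (f := f) hΦ hord hc (fun i k => ?_) (by omega) ?_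
  · simp only [f, he, Fin.ext_iff, Nat.add_right_cancel_iff]
  · have hne0 : ∀ k, e k ≠ 0 := (linearIndependent_of_orthogonal hc he).ne_zero
    refine foldedRoots_signedRoots (f := f) hc ?_ ?_ ?_ ?_ ?_ ?_ ?_
    · intro i k
      simp only [f, he, Fin.ext_iff, Nat.add_right_cancel_iff]
    · intro i
      by_cases hi : i = j
      · exact .inl (hi ▸ hj0)
      · right
        have hi0 : i.val ≠ 0 := fun h => hi (Fin.ext (by omega))
        refine ⟨⟨i - 1, by omega⟩, 1, ?_⟩
        rw [hav i hi, one_smul]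
        exact congrArg e (Fin.ext (by simp; omega))
    · exact fun k => ⟨_, 1, by rw [hav _ (hfj k), one_smul]⟩
    · simp
    · exact id
    · intro i i' k η η' hii' hi hi'
      have hij : i ≠ j := by
        rintro rfl
        rw [hj0] at hi
        rcases Int.units_eq_one_or η with rfl | rfl <;> exact hne0 _ (by simpa using hi.symm)
      have hij' : i' ≠ j := by
        rintro rfl
        rw [hj0] at hi'
        rcases Int.units_eq_one_or η' with rfl | rfl <;> exact hne0 _ (by simpa using hi'.symm)
      exact hii' ((hinj hij hi).trans (hinj hij' hi').symm)
    · exact False.elim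

/-- Here ω negates e_1 and e_ℓ. It exchanges the last two simple roots and sends e_1 - e_2 to -(e_1
+ e_2). The two negated coordinates fold to zero, so sums such as e_1 + e_i become the short roots
of type B. -/
theorem fold_D_first (hΦ : IsRootSystem ⊤ Φ) (hred : IsReduced Φ) (hα : IsBasis ⊤ Φ α)
    (hω : IsOmega Φ α j ω) (hn : 4 ≤ n) (hM : HasCartanMatrix α (CartanMatrix.D n))
    (hj : j.val = 0) :
    IsReducedOfType (fixedSpace ω) (foldedRoots Φ ω) (CartanMatrix.B (n - 2)) := by
  obtain ⟨t, ht⟩ : ∃ t : Fin n, t.val + 1 = n := ⟨⟨n - 1, by omega⟩, by simp; omega⟩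
  obtain ⟨u, hu⟩ : ∃ u : Fin n, u.val + 2 = n := ⟨⟨n - 2, by omega⟩, by simp; omega⟩
  obtain ⟨c, hc, e, he, rfl, rfl⟩ := hα.exists_eq_signedRoots_D hΦ hred hM (by omega) hu ht
  have hjt : j ≠ t := Fin.ne_of_val_ne (by omega)
  set v := refl (e j - e t) * refl (e j + e t) with hvdef
  have hv : v ∈ weylGroup (signedRoots False False e) :=
    mul_mem (refl_sub_mem_weylGroup hjt) (refl_add_mem_weylGroup hjt)
  have hve : ∀ m, v (e m) = if m = j ∨ m = t then -e m else e m :=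
    refl_sub_refl_add hc he hjt
  have hfix : ∀ i, i ≠ j → i ≠ t → v (e i) = e i := fun i hi hi' => by simp [hve, hi, hi']
  have hvj : v (e j) = -e j := by simp [hve]
  have hvt : v (e t) = -e t := by simp [hve]
  have hωv : ω = v := by
    refine hω.eq hΦ hred hα hv fun i => ?_
    by_cases hi : i = j
    · right
      subst hi
      obtain ⟨k, hk⟩ : ∃ k : Fin n, i.val + 1 = k.val := ⟨⟨i + 1, by omega⟩, rfl⟩
      have hki : k ≠ i := Fin.ne_of_val_ne (by omega)
      have hkt : k < t := Fin.lt_def.2 (by omega)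
      refine ⟨(e k - e t) + (e k + e t), add_mem (sub_mem_cone_signedBasis hkt.le)
        (add_mem_cone_signedBasis_D hu ht hkt), ?_⟩
      rw [signedBasis_of_lt hk, map_sub, hvj, hfix k hki hkt.ne]
      abel
    · left
      have hi0 : i.val ≠ 0 := fun h => hi (Fin.ext (by omega))
      by_cases hin : i.val + 1 < n
      · by_cases hiu : i = u
        · subst hiu
          refine ⟨t, hjt.symm, ?_⟩
          rw [signedBasis_of_lt (i := i) (k := t) (by omega), signedBasis_last ht, map_sub, hvt,
            hfix i hi (Fin.ne_of_val_ne (by omega)), sub_neg_eq_add]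
        · have hiu' : i.val ≠ u.val := fun h => hiu (Fin.ext h)
          refine ⟨i, hi, ?_⟩
          rw [signedBasis_of_lt (k := ⟨i + 1, hin⟩) rfl, map_sub,
            hfix i hi (Fin.ne_of_val_ne (by omega)),
            hfix _ (Fin.ne_of_val_ne (by simp; omega)) (Fin.ne_of_val_ne (by simp; omega))]
      · obtain rfl : i = t := Fin.ext (by omega)
        refine ⟨u, Fin.ne_of_val_ne (by omega), ?_⟩
        rw [signedBasis_of_lt (i := u) (k := i) (by omega), signedBasis_last ht, map_add, hvt,
          hfix u (Fin.ne_of_val_ne (by omega)) (Fin.ne_of_val_ne (by omega)), sub_eq_add_neg]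
  have hord : 0 < orderOf ω := hΦ.orderOf_pos (hωv ▸ hv)
  have h0 : ∀ i, i = j ∨ i = t → average ω (e i) = 0 := fun i hi =>
    average_eq_zero_of_map_eq_neg (by rw [hωv, hve, if_pos hi])
  have hav : ∀ i, ¬(i = j ∨ i = t) → average ω (e i) = e i := fun i hi =>
    average_of_map_eq hord (by rw [hωv, hve, if_neg hi])
  have hinj : ∀ {i k : Fin n} {η : ℤˣ}, ¬(i = j ∨ i = t) → average ω (e i) = η • e k →
      i = k := by
    intro i k η hi h
    by_contra hik
    rw [hav i hi] at h
    have h0 := congrArg (inner ℝ (e i)) h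
    rw [inner_units_smul_right, he, he, if_pos rfl, if_neg hik, mul_zero] at h0
    exact hc.ne' h0
  let f : Fin (n - 2) → E := fun k => e ⟨k + 1, by omega⟩
  have hfj : ∀ k : Fin (n - 2), ¬((⟨k + 1, by omega⟩ : Fin n) = j ∨
      (⟨k + 1, by omega⟩ : Fin n) = t) := fun k => by
    simp only [Fin.ext_iff]
    omega
  have hf : ∀ i k, inner ℝ (f i) (f k) = if i = k then c else 0 := fun i k => by
    simp only [f, he, Fin.ext_iff, Nat.add_right_cancel_iff]
  refine isReducedOfType_B_of_foldedRoots_eq hΦ hord hc hf (by omega) ?_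
  have hne0 : ∀ k, e k ≠ 0 := (linearIndependent_of_orthogonal hc he).ne_zero
  refine foldedRoots_signedRoots hc hf ?_ ?_ ?_ ?_ ?_ ?_
  · intro i
    by_cases hi : i = j ∨ i = t
    · exact .inl (h0 i hi)
    · right
      have hi' := hi
      simp only [Fin.ext_iff] at hi'
      refine ⟨⟨i - 1, by omega⟩, 1, ?_⟩
      rw [hav i hi, one_smul]
      exact congrArg e (Fin.ext (by simp; omega))
  · exact fun k => ⟨_, 1, by rw [hav _ (hfj k), one_smul]⟩
  · exact ⟨fun _ => .inr ⟨j, h0 j (.inl rfl)⟩, fun _ => trivial⟩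
  · exact id
  · intro i i' k η η' hii' hi hi'
    have hij : ¬(i = j ∨ i = t) := by
      intro h
      rw [h0 i h] at hi
      rcases Int.units_eq_one_or η with rfl | rfl <;> exact hne0 _ (by simpa using hi.symm)
    have hij' : ¬(i' = j ∨ i' = t) := by
      intro h
      rw [h0 i' h] at hi'
      rcases Int.units_eq_one_or η' with rfl | rfl <;> exact hne0 _ (by simpa using hi'.symm)
    exact hii' ((hinj hij hi).trans (hinj hij' hi').symm)
  · exact False.elim

/-! ### The last node of types `C` and `D` -/

section Reversal

variable {c : ℝ} {e : Fin n → E} {m r : ℕ}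

/-- The vectors obtained by averaging `e i` and `-e (rev i)`, without the first `r`. -/
noncomputable def reversalFamily (e : Fin n → E) (m r : ℕ) (h : m + r ≤ n) (k : Fin m) : E :=
  (1 / 2 : ℝ) • (e ⟨k + r, by omega⟩ - e (Fin.rev ⟨k + r, by omega⟩))

theorem inner_reversalFamily (he : ∀ i k, inner ℝ (e i) (e k) = if i = k then c else 0)
    (hn : 2 * m + 2 * r = n ∨ 2 * m + 2 * r + 1 = n) (h : m + r ≤ n) (i k : Fin m) :
    inner ℝ (reversalFamily e m r h i) (reversalFamily e m r h k) =
      if i = k then c / 2 else 0 := by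
  have hi := i.isLt
  have hk := k.isLt
  simp only [reversalFamily, inner_smul_left, inner_smul_right, inner_sub_left, inner_sub_right,
    he, Fin.ext_iff, Fin.val_rev, conj_trivial]
  split_ifs <;> first | omega | ring

/-- If `ω` maps `e i` to `-e (rev i)` but for the first and last `r` indices, where the average is
zero, then it folds `signedRoots` to a root system of type `C` or `BC`. -/
theorem foldedRoots_of_reversal (hc : 0 < c)
    (he : ∀ i k, inner ℝ (e i) (e k) = if i = k then c else 0) (hord : 0 < orderOf ω)
    (hn : 2 * m + 2 * r = n ∨ 2 * m + 2 * r + 1 = n) (h : m + r ≤ n)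
    (hrev : ∀ i : Fin n, r ≤ i.val → i.val + r < n → ω (e i) = -e (Fin.rev i))
    (hzero : ∀ i : Fin n, i.val < r ∨ n ≤ i.val + r → average ω (e i) = 0)
    {l s' : Prop} (hs : s' ↔ r ≠ 0 ∨ Odd n) :
    foldedRoots (signedRoots False l e) ω = signedRoots s' True (reversalFamily e m r h) := by
  have hav : ∀ i : Fin n, r ≤ i.val → i.val + r < n →
      average ω (e i) = (1 / 2 : ℝ) • (e i - e (Fin.rev i)) := fun i h1 h2 =>
    average_of_map_eq_neg hord (hrev i h1 h2) (by
      rw [hrev _ (by rw [Fin.val_rev]; omega) (by rw [Fin.val_rev]; omega), Fin.rev_rev])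
  have hf := inner_reversalFamily he hn h
  have hli := linearIndependent_of_orthogonal (half_pos hc) hf
  have hlow : ∀ k : Fin m, average ω (e ⟨k + r, by omega⟩) =
      (1 : ℤˣ) • reversalFamily e m r h k := fun k => by
    rw [hav _ (by simp) (by simp; omega), one_smul, reversalFamily]
  have hhigh : ∀ k : Fin m, average ω (e (Fin.rev ⟨k + r, by omega⟩)) =
      (-1 : ℤˣ) • reversalFamily e m r h k := fun k => by
    rw [hav _ (by rw [Fin.val_rev]; simp; omega) (by rw [Fin.val_rev]; simp; omega), Fin.rev_rev,
      Units.neg_smul, one_smul, reversalFamily, ← smul_neg, neg_sub]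
  -- The indices are those whose coordinates vanish at both ends, a possible middle one, and the two
  -- halves exchanged by reversal. The middle coordinate is sent to its negative, unless it is
  -- already among the ends.
  have hcases : ∀ i : Fin n, (i.val < r ∨ n ≤ i.val + r) ∨ 2 * i.val + 1 = n ∨
      (∃ k : Fin m, i = ⟨k + r, by omega⟩) ∨ ∃ k : Fin m, i = Fin.rev ⟨k + r, by omega⟩ := by
    intro i
    by_cases h1 : i.val < r ∨ n ≤ i.val + r
    · exact .inl h1
    by_cases h2 : 2 * i.val + 1 = n
    · exact .inr (.inl h2)
    by_cases h3 : 2 * i.val + 1 < n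
    · exact .inr (.inr (.inl ⟨⟨i - r, by omega⟩, Fin.ext (by simp; omega)⟩))
    · refine .inr (.inr (.inr ⟨⟨n - 1 - i - r, by omega⟩, Fin.ext ?_⟩))
      rw [Fin.val_rev]
      simp only []
      omega
  have hmid : ∀ i : Fin n, 2 * i.val + 1 = n → average ω (e i) = 0 := by
    intro i hi
    by_cases h1 : i.val < r ∨ n ≤ i.val + r
    · exact hzero i h1
    · rw [hav i (by omega) (by omega),
        show Fin.rev i = i from Fin.ext (by rw [Fin.val_rev]; omega), sub_self, smul_zero]
  -- Every f_k is hit by e_i and, with opposite sign, by e_{rev i}. So all ±2 f_k occur whether or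
  -- not the ±2 e_i are roots.
  refine foldedRoots_signedRoots (half_pos hc) hf ?_ ?_ ?_ (fun _ => trivial)
    (fun _ _ _ _ _ _ _ _ => trivial) (fun _ => .inr fun k => ?_)
  · intro i
    rcases hcases i with h1 | h1 | ⟨k, rfl⟩ | ⟨k, rfl⟩
    · exact .inl (hzero i h1)
    · exact .inl (hmid i h1)
    · exact .inr ⟨k, 1, hlow k⟩
    · exact .inr ⟨k, -1, hhigh k⟩
  · exact fun k => ⟨_, 1, hlow k⟩
  · rw [hs, false_or]
    constructor
    · rintro (h1 | ⟨q, hq⟩)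
      · exact ⟨⟨0, by omega⟩, hzero _ (.inl (Nat.pos_of_ne_zero h1))⟩
      · exact ⟨⟨q, by omega⟩, hmid _ hq.symm⟩
    · rintro ⟨i, hi⟩
      rcases hcases i with h1 | h1 | ⟨k, rfl⟩ | ⟨k, rfl⟩
      · left; omega
      · exact .inr ⟨i, h1.symm⟩
      · rw [hlow, one_smul] at hi
        exact absurd hi (hli.ne_zero k)
      · rw [hhigh, Units.neg_smul, one_smul, neg_eq_zero] at hi
        exact absurd hi (hli.ne_zero k)
  · refine ⟨_, _, Fin.ne_of_val_ne ?_, _, _, hlow k, hhigh k⟩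
    rw [Fin.val_rev]
    simp only []
    omega

end Reversal

/-- In type D only an even number of signs can be changed. Negating the n - 1 coordinates other than
e_t, two at a time with e_t as partner, leaves the sign (-1)^(n-1) on e_t. A reversal of the indices
follows. -/
theorem exists_mem_weylGroup_neg_rev {s l : Prop} {c : ℝ} {e : Fin n → E} (hc : 0 < c)
    (he : ∀ i k, inner ℝ (e i) (e k) = if i = k then c else 0) (t : Fin n) :
    ∃ w ∈ weylGroup (signedRoots s l e), (∀ i, i ≠ t → w (e i) = -e (Fin.rev i)) ∧
      w (e t) = (-1 : ℤˣ) ^ (n - 1) • e (Fin.rev t) := by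
  obtain ⟨w, hw, h1⟩ := exists_mem_weylGroup_perm (s := s) (l := l) hc he Fin.revPerm
  obtain ⟨v, hv, h2, h3⟩ := exists_mem_weylGroup_neg (s := s) (l := l) hc he t
    (Finset.univ.erase t) (by simp)
  refine ⟨w * v, mul_mem hw hv, fun i hi => ?_, ?_⟩
  · rw [LinearIsometryEquiv.coe_mul, Function.comp_apply, h2 i hi, if_pos (by simp [hi]), map_neg,
      h1, Fin.revPerm_apply]
  · rw [LinearIsometryEquiv.coe_mul, Function.comp_apply, h3, isometry_units_smul, h1,
      Fin.revPerm_apply, Finset.card_erase_of_mem (Finset.mem_univ _), Finset.card_univ,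
      Fintype.card_fin]

theorem map_signedBasis_of_neg_rev {e : Fin n → E} {z : E} {v : E ≃ₗᵢ[ℝ] E} {i i' k : Fin n}
    (hi : i.val + 1 = i'.val) (hk : i.val + k.val + 2 = n)
    (h : v (e i) = -e (Fin.rev i)) (h' : v (e i') = -e (Fin.rev i')) :
    v (signedBasis e z i) = signedBasis e z k := by
  rw [signedBasis_of_lt hi, signedBasis_of_lt (i := k) (k := Fin.rev i)
    (by rw [Fin.val_rev]; omega), map_sub, h, h',
    show Fin.rev i' = k from Fin.ext (by rw [Fin.val_rev]; omega)]
  abel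

/-- Here ω sends e_i to -e_{ℓ+1-i}: it reverses the chain of the simple roots other than the last
and sends 2 e_ℓ to -2 e_1. For odd ℓ the middle coordinate folds to zero and adds short roots, which
gives BC instead of C. -/
theorem fold_C (hΦ : IsRootSystem ⊤ Φ) (hred : IsReduced Φ) (hα : IsBasis ⊤ Φ α)
    (hω : IsOmega Φ α j ω) (hn : 3 ≤ n) (hM : HasCartanMatrix α (CartanMatrix.C n))
    (hj : j.val + 1 = n) :
    (Odd n → IsOfTypeBC (fixedSpace ω) (foldedRoots Φ ω) ((n - 1) / 2)) ∧
    (Even n → IsReducedOfType (fixedSpace ω) (foldedRoots Φ ω) (CartanMatrix.C (n / 2))) := by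
  obtain ⟨c, hc, e, he, rfl, rfl⟩ := hα.exists_eq_signedRoots_C hΦ hred hM hj
  obtain ⟨v, hv, hve⟩ : ∃ v ∈ weylGroup (signedRoots False True e),
      ∀ i, v (e i) = -e (Fin.rev i) := by
    obtain ⟨w, hw, h1, h2⟩ := exists_mem_weylGroup_neg_rev (s := False) (l := True) hc he j
    -- If the sign left on `e j` is wrong, the reflection in the long root 2 e_j, available in type
    -- C, corrects it.
    rcases neg_one_pow_eq_or ℤˣ (n - 1) with hp | hp <;> rw [hp] at h2
    · refine ⟨w * refl (e j), mul_mem hw ?_, fun i => ?_⟩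
      · rw [← refl_smul two_ne_zero]
        exact Subgroup.subset_closure ⟨_, .inr (.inr ⟨trivial, j, 1, by simp⟩), rfl⟩
      · rw [LinearIsometryEquiv.coe_mul, Function.comp_apply, refl_orthogonal hc he,
          isometry_units_smul]
        by_cases hi : i = j
        · rw [if_pos hi, hi, h2]; simp
        · rw [if_neg hi, h1 i hi, one_smul]
    · refine ⟨w, hw, fun i => ?_⟩
      by_cases hi : i = j
      · rw [hi, h2]; simp
      · exact h1 i hi
  have hωv : ω = v := by
    refine hω.eq hΦ hred hα hv fun i => ?_
    by_cases hi : i = j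
    · right
      subst hi
      have hle : Fin.rev i ≤ i := Fin.le_def.2 (by rw [Fin.val_rev]; omega)
      have := sub_mem_cone_signedBasis (e := e) (z := (2 : ℝ) • e i) hle
      refine ⟨_, add_mem this this, ?_⟩
      rw [signedBasis_last hj, map_smul, hve, two_smul, two_smul]
      abel
    · left
      have hi' : i.val ≠ j.val := fun h => hi (Fin.ext h)
      refine ⟨⟨n - 2 - i, by omega⟩, Fin.ne_of_val_ne (by simp; omega), ?_⟩
      exact map_signedBasis_of_neg_rev (i' := ⟨i + 1, by omega⟩) rfl (by simp; omega) (hve _) (hve _)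
  have hord : 0 < orderOf ω := hΦ.orderOf_pos (hωv ▸ hv)
  constructor
  · rintro hodd
    have hn2 : 2 * ((n - 1) / 2) + 2 * 0 + 1 = n := by obtain ⟨q, rfl⟩ := hodd; omega
    have hle : (n - 1) / 2 + 0 ≤ n := by omega
    exact isOfTypeBC_of_foldedRoots_eq hΦ hord (half_pos hc)
      (inner_reversalFamily he (.inr hn2) hle) (by omega)
      (foldedRoots_of_reversal hc he hord (.inr hn2) hle (fun i _ _ => hωv ▸ hve i)
        (fun i hi => by omega) (by simp [hodd]))
  · rintro heven
    have hn2 : 2 * (n / 2) + 2 * 0 = n := by obtain ⟨q, rfl⟩ := heven; omega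
    have hle : n / 2 + 0 ≤ n := by omega
    exact isReducedOfType_C_of_foldedRoots_eq hΦ hord (half_pos hc)
      (inner_reversalFamily he (.inl hn2) hle) (by omega)
      (foldedRoots_of_reversal hc he hord (.inl hn2) hle (fun i _ _ => hωv ▸ hve i)
        (fun i hi => by omega) (by simp [heven]))

/-- For even ℓ the map e_i ↦ -e_{ℓ+1-i} changes an even number of signs and is ω. For odd ℓ the sign
at e_ℓ must be positive. Then e_ℓ ↦ e_1 ↦ -e_ℓ, so these two coordinates also fold to zero, and the
rank drops to (ℓ-3)/2. -/
theorem fold_D_last (hΦ : IsRootSystem ⊤ Φ) (hred : IsReduced Φ) (hα : IsBasis ⊤ Φ α)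
    (hω : IsOmega Φ α j ω) (hn : 4 ≤ n) (hM : HasCartanMatrix α (CartanMatrix.D n))
    (hj : j.val + 1 = n) :
    (Even n → IsReducedOfType (fixedSpace ω) (foldedRoots Φ ω) (CartanMatrix.C (n / 2))) ∧
    (Odd n → IsOfTypeBC (fixedSpace ω) (foldedRoots Φ ω) ((n - 3) / 2)) := by
  obtain ⟨u, hu⟩ : ∃ u : Fin n, u.val + 2 = n := ⟨⟨n - 2, by omega⟩, by simp; omega⟩
  obtain ⟨c, hc, e, he, rfl, rfl⟩ := hα.exists_eq_signedRoots_D hΦ hred hM (by omega) hu hj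
  obtain ⟨v, hv, hve, hvj⟩ :=
    exists_mem_weylGroup_neg_rev (s := False) (l := False) hc he j
  have huj : u ≠ j := Fin.ne_of_val_ne (by omega)
  have hneg : ∃ p ∈ cone (signedBasis e (e u + e j)),
      -e (Fin.rev u) - e (Fin.rev j) = -(signedBasis e (e u + e j) j + p) := by
    refine ⟨(e (Fin.rev j) - e u) + (e (Fin.rev u) - e j), add_mem
      (sub_mem_cone_signedBasis (Fin.le_def.2 (by rw [Fin.val_rev]; omega)))
      (sub_mem_cone_signedBasis (Fin.le_def.2 (by rw [Fin.val_rev]; omega))), ?_⟩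
    rw [signedBasis_last hj]
    abel
  have hlt : ∀ i : Fin n, i.val + 2 < n →
      ∃ k, k ≠ j ∧ v (signedBasis e (e u + e j) i) = signedBasis e (e u + e j) k := by
    intro i hi
    refine ⟨⟨n - 2 - i, by omega⟩, Fin.ne_of_val_ne (by simp; omega), ?_⟩
    exact map_signedBasis_of_neg_rev (i' := ⟨i + 1, by omega⟩) rfl (by simp; omega)
      (hve _ (Fin.ne_of_val_ne (by omega))) (hve _ (Fin.ne_of_val_ne (by simp; omega)))
  have hcases : ∀ i : Fin n, i.val + 2 < n ∨ i = u ∨ i = j := by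
    intro i
    simp only [Fin.ext_iff]
    omega
  have hru : (Fin.rev u).val = 1 := by rw [Fin.val_rev]; omega
  have hrj : (Fin.rev j).val = 0 := by rw [Fin.val_rev]; omega
  constructor
  · intro heven
    have hp : (-1 : ℤˣ) ^ (n - 1) = -1 := by
      obtain ⟨q, rfl⟩ := heven
      exact Odd.neg_one_pow ⟨q - 1, by omega⟩
    have hve' : ∀ i, v (e i) = -e (Fin.rev i) := by
      intro i
      by_cases hi : i = j
      · rw [hi, hvj, hp]; simp
      · exact hve i hi
    have hωv : ω = v := by
      refine hω.eq hΦ hred hα hv fun i => ?_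
      rcases hcases i with hi | rfl | rfl
      · exact .inl (hlt i hi)
      · refine .inl ⟨⟨0, by omega⟩, Fin.ne_of_val_ne (by simp; omega), ?_⟩
        exact map_signedBasis_of_neg_rev (i' := j) (by omega) (by simp; omega) (hve' _) (hve' _)
      · right
        rw [signedBasis_last hj, map_add, hve', hve', ← sub_eq_add_neg]
        rw [signedBasis_last hj] at hneg
        exact hneg
    have hord : 0 < orderOf ω := hΦ.orderOf_pos (hωv ▸ hv)
    have hn2 : 2 * (n / 2) + 2 * 0 = n := by obtain ⟨q, rfl⟩ := heven; omega
    have hle : n / 2 + 0 ≤ n := by omega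
    exact isReducedOfType_C_of_foldedRoots_eq hΦ hord (half_pos hc)
      (inner_reversalFamily he (.inl hn2) hle) (by omega)
      (foldedRoots_of_reversal hc he hord (.inl hn2) hle (fun i _ _ => hωv ▸ hve' i)
        (fun i hi => by omega) (by simp [heven]))
  · intro hodd
    have hp : (-1 : ℤˣ) ^ (n - 1) = 1 := by
      obtain ⟨q, rfl⟩ := hodd
      exact Even.neg_one_pow ⟨q, by omega⟩
    rw [hp, one_smul] at hvj
    have hωv : ω = v := by
      refine hω.eq hΦ hred hα hv fun i => ?_
      rcases hcases i with hi | rfl | rfl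
      · exact .inl (hlt i hi)
      · right
        rw [signedBasis_of_lt (i := i) (k := j) (by omega), map_sub, hve i huj, hvj]
        exact hneg
      · refine .inl ⟨Fin.rev i, Fin.ne_of_val_ne (by omega), ?_⟩
        rw [signedBasis_last hj, map_add, hve u huj, hvj,
          signedBasis_of_lt (i := Fin.rev i) (k := Fin.rev u) (by omega)]
        abel
    have hord : 0 < orderOf ω := hΦ.orderOf_pos (hωv ▸ hv)
    -- The square of ω negates `e j`, so its average is its own negative.
    have hj0 : average ω (e j) = 0 := by
      have h1 := average_map (ω := ω) (e j)
      have h2 := average_map (ω := ω) (e (Fin.rev j))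
      rw [hωv, hvj, ← hωv] at h1
      rw [hωv, hve _ (Fin.ne_of_val_ne (by omega)), Fin.rev_rev, ← hωv, average_neg, h1] at h2
      exact eq_zero_of_neg_eq_self h2
    have hrj0 : average ω (e (Fin.rev j)) = 0 := by
      have h1 := average_map (ω := ω) (e j)
      rw [hωv, hvj, ← hωv] at h1
      rw [h1, hj0]
    have hn2 : 2 * ((n - 3) / 2) + 2 * 1 + 1 = n := by obtain ⟨q, rfl⟩ := hodd; omega
    have hle : (n - 3) / 2 + 1 ≤ n := by omega
    refine isOfTypeBC_of_foldedRoots_eq hΦ hord (half_pos hc)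
      (inner_reversalFamily he (.inr hn2) hle) (by omega)
      (foldedRoots_of_reversal hc he hord (.inr hn2) hle
        (fun i _ _ => hωv ▸ hve i (Fin.ne_of_val_ne (by omega))) (fun i hi => ?_) (by simp))
    rcases hi with hi | hi
    · rw [show i = Fin.rev j from Fin.ext (by omega)]; exact hrj0
    · rw [show i = j from Fin.ext (by omega)]; exact hj0

/-- The graph automorphism exchanging the last two nodes of type `D`. -/
theorem hasCartanMatrix_D_swap (hΦ : IsRootSystem ⊤ Φ) (hred : IsReduced Φ) (hα : IsBasis ⊤ Φ α)
    (hn : 4 ≤ n) (hM : HasCartanMatrix α (CartanMatrix.D n)) {u t : Fin n} (hu : u.val + 2 = n)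
    (ht : t.val + 1 = n) : HasCartanMatrix (α ∘ Equiv.swap u t) (CartanMatrix.D n) := by
  obtain ⟨c, hc, e, he, rfl, -⟩ := hα.exists_eq_signedRoots_D hΦ hred hM (by omega) hu ht
  have hut : u ≠ t := Fin.ne_of_val_ne (by omega)
  -- Changing the sign of the last coordinate exchanges e_{ℓ-1} - e_ℓ and e_{ℓ-1} + e_ℓ.
  let e' : Fin n → E := fun i => (if i = t then -1 else 1 : ℤˣ) • e i
  have he' : ∀ i k, inner ℝ (e' i) (e' k) = if i = k then c else 0 := by
    intro i k
    simp only [e', inner_units_smul_left, inner_units_smul_right, he]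
    rcases eq_or_ne i k with rfl | hik
    · rw [← mul_assoc, units_mul_self, one_mul]
    · simp [hik]
  have ht' : e' t = -e t := by simp [e']
  have hne : ∀ i, i ≠ t → e' i = e i := fun i hi => by simp [e', hi]
  have hα' : signedBasis e (e u + e t) ∘ Equiv.swap u t = signedBasis e' (e' u + e' t) := by
    funext i
    rw [Function.comp_apply, ht', hne u hut]
    by_cases hi : i = u
    · subst hi
      rw [Equiv.swap_apply_left, signedBasis_last ht, signedBasis_of_lt (i := i) (k := t) (by omega),
        ht', hne i hut, sub_neg_eq_add]
    by_cases hi' : i = t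
    · subst hi'
      rw [Equiv.swap_apply_right, signedBasis_last ht,
        signedBasis_of_lt (i := u) (k := i) (by omega), sub_eq_add_neg]
    · rw [Equiv.swap_apply_of_ne_of_ne hi hi']
      simp only [Fin.ext_iff] at hi hi'
      obtain ⟨k, hk⟩ : ∃ k : Fin n, i.val + 1 = k.val := ⟨⟨i + 1, by omega⟩, rfl⟩
      rw [signedBasis_of_lt hk, signedBasis_of_lt hk, hne i (Fin.ne_of_val_ne hi'),
        hne k (Fin.ne_of_val_ne (by omega))]
  rw [hα']
  exact hasCartanMatrix_signedBasis_D hc he' (by omega) hu ht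

end Folding

namespace Folding

variable {E : Type*} [NormedAddCommGroup E] [InnerProductSpace ℝ E]
variable {n : ℕ}

/-! ### Type `A` -/

theorem exists_mem_weylGroup_differenceRoots {c d : ℝ} {e : Fin n → E} (hc : 0 < c)
    (he : ∀ i k, inner ℝ (e i) (e k) = (if i = k then c else 0) + d) (π : Equiv.Perm (Fin n)) :
    ∃ w ∈ weylGroup (differenceRoots e), ∀ i k, w (e i - e k) = e (π i) - e (π k) ∧
      w (e i) = e (π i) := by
  suffices ∃ w ∈ weylGroup (differenceRoots e), ∀ i, w (e i) = e (π i) by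
    obtain ⟨w, hw, h⟩ := this
    exact ⟨w, hw, fun i k => ⟨by rw [map_sub, h, h], h i⟩⟩
  induction π using Equiv.Perm.swap_induction_on with
  | one => exact ⟨1, one_mem _, fun i => rfl⟩
  | swap_mul σ x y hxy ih =>
    obtain ⟨w, hw, h⟩ := ih
    refine ⟨refl (e x - e y) * w,
      mul_mem (Subgroup.subset_closure ⟨_, ⟨x, y, hxy, rfl⟩, rfl⟩) hw, fun i => ?_⟩
    rw [LinearIsometryEquiv.coe_mul, Function.comp_apply, h, refl_differenceRoots hc he hxy]
    rfl

theorem sum_ite_mod_eq {g N : ℕ} (hg : 0 < g) (hN : g ∣ N) {r : ℕ} (hr : r < g) :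
    ∑ i : Fin N, (if i.val % g = r then (1 : ℝ) else 0) = (N / g : ℕ) := by
  rw [Fin.sum_univ_eq_sum_range (fun i => if i % g = r then (1 : ℝ) else 0), Finset.sum_boole,
    ← Nat.count_eq_card_filter_range]
  have h := Nat.count_modEq_card N hg r
  rw [Nat.mod_eq_zero_of_dvd hN, if_neg (Nat.not_lt_zero _), add_zero] at h
  rw [← h]
  congr 2
  funext x
  rw [Nat.ModEq, Nat.mod_eq_of_lt hr]

variable {Φ : Set E} {α : Fin n → E} {j : Fin n} {ω : E ≃ₗᵢ[ℝ] E}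

/-- Here ω shifts the coordinate indices by j + 1 modulo n + 1. The orbits are the residue classes
modulo g, each of size K = (n+1)/g, and the averages of the e_i are the g class means. -/
theorem fold_A_eq_differenceRoots (hΦ : IsRootSystem ⊤ Φ) (hred : IsReduced Φ)
    (hα : IsBasis ⊤ Φ α) (hω : IsOmega Φ α j ω) (hM : HasCartanMatrix α (CartanMatrix.A n)) :
    0 < orderOf ω ∧ ∃ c d : ℝ, 0 < c ∧ ∃ f : Fin (Nat.gcd (n + 1) (j + 1)) → E,
      (∀ i k, inner ℝ (f i) (f k) = (if i = k then c else 0) + d) ∧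
      foldedRoots Φ ω = differenceRoots f := by
  obtain ⟨c, d, hc, e, he, rfl, rfl⟩ := hα.exists_eq_differenceRoots hΦ hred hM
  have hj := j.isLt
  obtain ⟨v, hv, hve⟩ :=
    exists_mem_weylGroup_differenceRoots hc he (Equiv.addRight j.succ)
  replace hve : ∀ i, v (e i) = e (i + j.succ) := fun i => (hve i i).2
  have hωv : ω = v := by
    refine hω.eq hΦ hred hα hv fun i => ?_
    have hi := i.isLt
    have h1 : ∀ i : Fin (n + 1), (i + j.succ).val = (i.val + (j.val + 1)) % (n + 1) := fun i => by
      rw [Fin.val_add, Fin.val_succ]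
    have hvi : v (differenceBasis e i) = e (i.castSucc + j.succ) - e (i.succ + j.succ) := by
      rw [differenceBasis, map_sub, hve, hve]
    rcases lt_trichotomy (i.val + j.val + 1) n with h | h | h
    · refine .inl ⟨⟨i + j + 1, h⟩, Fin.ne_of_val_ne (by simp; omega), ?_⟩
      rw [hvi, differenceBasis]
      congr 2
      · refine Fin.ext ?_
        rw [h1, Nat.mod_eq_of_lt (by simp; omega)]
        simp; omega
      · refine Fin.ext ?_
        rw [h1, Nat.mod_eq_of_lt (by simp; omega)]
        simp; omega
    -- This simple root is shifted to e_n - e_0, the negative of the highest root. The witness is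
    -- the highest root minus `α j`.
    · refine .inr ⟨(e 0 - e j.castSucc) + (e j.succ - e (Fin.last n)), add_mem
        (sub_mem_cone_differenceBasis e (Fin.zero_le _))
        (sub_mem_cone_differenceBasis e (Fin.le_last _)), ?_⟩
      have h2 : i.castSucc + j.succ = Fin.last n := Fin.ext (by
        rw [h1, Nat.mod_eq_of_lt (by simp; omega)]; simp; omega)
      have h3 : i.succ + j.succ = 0 := Fin.ext (by
        rw [h1, show i.succ.val + (j.val + 1) = n + 1 by simp; omega, Nat.mod_self]; rfl)
      rw [hvi, h2, h3, differenceBasis]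
      abel
    · refine .inl ⟨⟨i + j - n, by omega⟩, Fin.ne_of_val_ne (by simp; omega), ?_⟩
      rw [hvi, differenceBasis]
      congr 2
      · refine Fin.ext ?_
        rw [h1, Nat.mod_eq_sub_mod (by simp; omega), Nat.mod_eq_of_lt (by simp; omega)]
        simp; omega
      · refine Fin.ext ?_
        rw [h1, Nat.mod_eq_sub_mod (by simp; omega), Nat.mod_eq_of_lt (by simp; omega)]
        simp; omega
  have hord : 0 < orderOf ω := hΦ.orderOf_pos (hωv ▸ hv)
  refine ⟨hord, ?_⟩
  generalize hg : Nat.gcd (n + 1) (j + 1) = g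
  have hgn : g ∣ n + 1 := hg ▸ Nat.gcd_dvd_left _ _
  have hgj : g ∣ j + 1 := hg ▸ Nat.gcd_dvd_right _ _
  have hg0 : 0 < g := Nat.pos_of_dvd_of_pos hgn (Nat.succ_pos n)
  have hgle : g ≤ n + 1 := Nat.le_of_dvd (Nat.succ_pos n) hgn
  let h : ℕ → E := fun x => average ω (e (Fin.ofNat (n + 1) x))
  have hper₁ : ∀ x q, h (x + (n + 1) * q) = h x := fun x q => by
    simp only [h]
    congr 2
    exact Fin.ext (by simp [Fin.ofNat])
  have hper₂ : ∀ x q, h (x + (j + 1) * q) = h x := fun x q => by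
    induction q with
    | zero => rfl
    | succ q ih =>
      rw [← ih]
      simp only [h]
      rw [← average_map (ω := ω) (e (Fin.ofNat (n + 1) (x + (j + 1) * q))), hωv, hve]
      congr 2
      refine Fin.ext ?_
      rw [Fin.val_add, Fin.val_succ]
      simp [Fin.ofNat, Nat.mul_succ, add_assoc]
  -- The averages have periods n + 1 and j + 1, hence also their gcd, by Bézout.
  have hper : Function.Periodic h g := fun x => by
    obtain ⟨q, -, hq⟩ := Nat.exists_mul_mod_eq_gcd (n := j + 1) (k := n + 1)
      (lt_of_le_of_lt (Nat.gcd_le_left _ (Nat.succ_pos _)) (by omega))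
    rw [Nat.gcd_comm, hg] at hq
    rw [← hper₁ (x + g) ((j + 1) * q / (n + 1)), ← hq, add_assoc, Nat.mod_add_div, hper₂]
  have hmod : ∀ i : Fin (n + 1), average ω (e i) = h (i.val % g) := fun i => by
    rw [hper.map_mod_nat]
    simp [h]
  obtain ⟨K, hK⟩ : ∃ K : ℝ, K = ((n + 1) / g : ℕ) := ⟨_, rfl⟩
  have hK0 : 0 < K := by
    rw [hK]
    exact_mod_cast Nat.div_pos hgle hg0
  let S : ℕ → E := fun r => ∑ i : Fin (n + 1), (if i.val % g = r then (1 : ℝ) else 0) • e i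
  have hcard : ∀ r, r < g → ∑ i : Fin (n + 1), (if i.val % g = r then (1 : ℝ) else 0) = K :=
    fun r hr => hK ▸ sum_ite_mod_eq hg0 hgn hr
  have hSω : ∀ r, ω (S r) = S r := fun r => by
    simp only [S, map_sum, map_smul]
    rw [hωv]
    conv_rhs => rw [← Equiv.sum_comp (Equiv.addRight j.succ)]
    refine Finset.sum_congr rfl fun i _ => ?_
    rw [hve, Equiv.coe_addRight, Fin.val_add, Nat.mod_mod_of_dvd _ hgn, Fin.val_succ,
      Nat.add_mod, Nat.mod_eq_zero_of_dvd hgj, add_zero, Nat.mod_mod]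
  -- The class sum is fixed by ω, so it equals its average, which is `K` equal terms. This yields
  -- the Gram matrix of the averages without knowing the order of ω.
  have hSh : ∀ r, r < g → S r = K • h r := fun r hr => by
    rw [← average_of_map_eq hord (hSω r), ← hcard r hr, Finset.sum_smul]
    simp only [S]
    rw [← averageMap_apply, map_sum]
    refine Finset.sum_congr rfl fun i _ => ?_
    rw [map_smul, averageMap_apply, hmod]
    split_ifs with hi
    · rw [hi]
    · simp
  have hSS : ∀ r s, r < g → s < g →
      inner ℝ (S r) (S s) = (if r = s then K * c else 0) + K * K * d := fun r s hr hs => by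
    have h1 : ∀ i : Fin (n + 1), ∑ k : Fin (n + 1), (if k.val % g = s then (1 : ℝ) else 0) *
        ((if i = k then c else 0) + d) = (if i.val % g = s then c else 0) + K * d := fun i => by
      simp only [mul_add, Finset.sum_add_distrib, ← Finset.sum_mul, hcard s hs]
      simp
    have h3 : inner ℝ (S r) (S s) = ∑ i : Fin (n + 1), (if i.val % g = r then (1 : ℝ) else 0) *
        ((if i.val % g = s then c else 0) + K * d) := by
      simp only [S]
      rw [sum_inner]
      refine Finset.sum_congr rfl fun i _ => ?_
      simp only [inner_smul_left, inner_sum, inner_smul_right, he, conj_trivial]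
      rw [← h1 i, Finset.mul_sum]
      exact Finset.sum_congr rfl fun k _ => mul_left_comm _ _ _
    have h2 : ∀ i : Fin (n + 1), (if i.val % g = r then (1 : ℝ) else 0) *
        ((if i.val % g = s then c else 0) + K * d) =
        (if i.val % g = r then (1 : ℝ) else 0) * ((if r = s then c else 0) + K * d) := fun i => by
      by_cases hi : i.val % g = r
      · rw [hi]
      · simp [hi]
    rw [h3, Finset.sum_congr rfl fun i _ => h2 i, ← Finset.sum_mul, hcard r hr]
    split_ifs <;> ring
  have hf : ∀ i k : Fin g, inner ℝ (h i) (h k) = (if i = k then c / K else 0) + d := fun i k => by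
    have h1 := hSS i k i.isLt k.isLt
    rw [hSh _ i.isLt, hSh _ k.isLt, inner_smul_left, inner_smul_right, conj_trivial] at h1
    have h2 : K * (K * inner ℝ (h i) (h k)) = K * (K * ((if i = k then c / K else 0) + d)) := by
      rw [h1]
      simp only [Fin.ext_iff]
      split_ifs <;> field_simp
      ring
    exact mul_left_cancel₀ hK0.ne' (mul_left_cancel₀ hK0.ne' h2)
  have hcK : 0 < c / K := div_pos hc hK0
  refine ⟨c / K, d, hcK, fun i => h i, hf, Set.Subset.antisymm ?_ ?_⟩
  · rintro y ⟨hy, _, ⟨i, k, _, rfl⟩, rfl⟩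
    rw [average_sub, hmod, hmod] at hy ⊢
    refine ⟨⟨i % g, Nat.mod_lt _ hg0⟩, ⟨k % g, Nat.mod_lt _ hg0⟩, fun h' => hy ?_, rfl⟩
    rw [Fin.mk.inj h', sub_self]
  · intro y hy
    refine ⟨(isRootSystem_differenceRoots hcK hf).ne_zero hy, ?_⟩
    obtain ⟨i, k, hik, rfl⟩ := hy
    refine ⟨_, ⟨⟨i, by omega⟩, ⟨k, by omega⟩, fun h' => hik (Fin.ext (Fin.mk.inj h')), rfl⟩, ?_⟩
    rw [average_sub, hmod, hmod]
    simp only [Nat.mod_eq_of_lt i.isLt, Nat.mod_eq_of_lt k.isLt]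

theorem fold_A (hΦ : IsRootSystem ⊤ Φ) (hred : IsReduced Φ) (hα : IsBasis ⊤ Φ α)
    (hω : IsOmega Φ α j ω) (hM : HasCartanMatrix α (CartanMatrix.A n)) :
    (Nat.gcd (n + 1) (j + 1) = 1 →
      IsRootSystem (fixedSpace ω) (foldedRoots Φ ω) ∧ foldedRoots Φ ω = ∅) ∧
    (Nat.gcd (n + 1) (j + 1) ≠ 1 → IsReducedOfType (fixedSpace ω) (foldedRoots Φ ω)
      (CartanMatrix.A (Nat.gcd (n + 1) (j + 1) - 1))) := by
  have h := fold_A_eq_differenceRoots hΦ hred hα hω hM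
  have hg0 : Nat.gcd (n + 1) (j + 1) ≠ 0 := Nat.gcd_ne_zero_left (Nat.succ_ne_zero n)
  generalize Nat.gcd (n + 1) (j + 1) = g at h hg0 ⊢
  obtain ⟨m, rfl⟩ := Nat.exists_eq_succ_of_ne_zero hg0
  obtain ⟨hord, c, d, hc, f, hf, hfold⟩ := h
  rw [← span_foldedRoots hΦ hord, hfold]
  have hroot := isRootSystem_differenceRoots hc hf
  refine ⟨fun hm => ⟨hroot, ?_⟩, fun _ => ⟨hroot, isReduced_differenceRoots hc hf, _,
    isBasis_differenceRoots hc hf, hasCartanMatrix_differenceBasis hc hf⟩⟩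
  -- For g = 1 there is a single averaged vector, hence no difference of two distinct ones.
  obtain rfl : m = 0 := by omega
  refine Set.eq_empty_of_forall_notMem ?_
  rintro _ ⟨i, k, hik, _⟩
  exact hik (Subsingleton.elim (α := Fin 1) i k)

end Folding

namespace Folding

variable {E : Type*} [NormedAddCommGroup E] [InnerProductSpace ℝ E]

/-! ### Lattices with integral Gram matrix -/

/-- The integral combination of the vectors `γ i` with coefficients `x`. -/
def latticeVec {m : ℕ} (γ : Fin m → E) (x : Fin m → ℤ) : E := ∑ i, x i • γ i

/-- The bilinear form with Gram matrix `G`. -/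
def gramForm {m : ℕ} (G : Matrix (Fin m) (Fin m) ℤ) (x y : Fin m → ℤ) : ℤ :=
  ∑ i, ∑ k, x i * G i k * y k

/-- The nonzero lattice vectors of norm at most `N`. -/
def shortVectors {m : ℕ} (γ : Fin m → E) (G : Matrix (Fin m) (Fin m) ℤ) (N : ℤ) : Set E :=
  {v | ∃ y : Fin m → ℤ, y ≠ 0 ∧ gramForm G y y ≤ N ∧ v = latticeVec γ y}

section Lattice

variable {m : ℕ} {γ : Fin m → E} {G : Matrix (Fin m) (Fin m) ℤ} {c : ℝ}

theorem latticeVec_add (x y : Fin m → ℤ) :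
    latticeVec γ (x + y) = latticeVec γ x + latticeVec γ y := by
  simp [latticeVec, add_smul, Finset.sum_add_distrib]

theorem latticeVec_zsmul (k : ℤ) (x : Fin m → ℤ) :
    latticeVec γ (k • x) = k • latticeVec γ x := by
  simp [latticeVec, Finset.smul_sum, mul_smul]

theorem latticeVec_neg (x : Fin m → ℤ) : latticeVec γ (-x) = -latticeVec γ x := by
  simp [latticeVec]

theorem latticeVec_sub (x y : Fin m → ℤ) :
    latticeVec γ (x - y) = latticeVec γ x - latticeVec γ y := by
  rw [sub_eq_add_neg, latticeVec_add, latticeVec_neg, sub_eq_add_neg]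

theorem latticeVec_single (i : Fin m) : latticeVec γ (Pi.single i 1) = γ i := by
  simp [latticeVec, Pi.single_apply]

theorem latticeVec_sum {ι : Type*} (s : Finset ι) (x : ι → Fin m → ℤ) :
    latticeVec γ (∑ i ∈ s, x i) = ∑ i ∈ s, latticeVec γ (x i) := by
  simp only [latticeVec, Finset.sum_apply, Finset.sum_smul]
  exact Finset.sum_comm

theorem inner_latticeVec (hG : ∀ i k, inner ℝ (γ i) (γ k) = c * (G i k : ℝ)) (x y : Fin m → ℤ) :
    inner ℝ (latticeVec γ x) (latticeVec γ y) = c * (gramForm G x y : ℝ) := by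
  simp only [latticeVec, gramForm, sum_inner, inner_sum, ← Int.cast_smul_eq_zsmul ℝ,
    inner_smul_left, inner_smul_right, hG, Int.cast_sum, Int.cast_mul, Finset.mul_sum,
    conj_trivial]
  rw [Finset.sum_comm]
  refine Finset.sum_congr rfl fun i _ => Finset.sum_congr rfl fun k _ => ?_
  ring

theorem corootPairing_latticeVec (hc : c ≠ 0)
    (hG : ∀ i k, inner ℝ (γ i) (γ k) = c * (G i k : ℝ)) {x y : Fin m → ℤ} {p : ℤ}
    (hx : gramForm G x x ≠ 0) (hp : 2 * gramForm G x y = gramForm G x x * p) :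
    corootPairing (latticeVec γ x) (latticeVec γ y) = p := by
  have hx' : (gramForm G x x : ℝ) ≠ 0 := by exact_mod_cast hx
  have hp' : 2 * (gramForm G x y : ℝ) = gramForm G x x * p := by exact_mod_cast hp
  rw [corootPairing, inner_latticeVec hG, inner_latticeVec hG, div_eq_iff (mul_ne_zero hc hx')]
  linear_combination c * hp'

theorem refl_latticeVec (hc : c ≠ 0)
    (hG : ∀ i k, inner ℝ (γ i) (γ k) = c * (G i k : ℝ)) {x y : Fin m → ℤ} {p : ℤ}
    (hx : gramForm G x x ≠ 0) (hp : 2 * gramForm G x y = gramForm G x x * p) :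
    refl (latticeVec γ x) (latticeVec γ y) = latticeVec γ (y - p • x) := by
  rw [refl_apply, corootPairing_latticeVec hc hG hx hp, latticeVec_sub, latticeVec_zsmul,
    Int.cast_smul_eq_zsmul]

theorem gramForm_sum_right {ι : Type*} (s : Finset ι) (x : Fin m → ℤ) (y : ι → Fin m → ℤ) :
    gramForm G x (∑ i ∈ s, y i) = ∑ i ∈ s, gramForm G x (y i) := by
  simp only [gramForm, Finset.sum_apply, Finset.mul_sum]
  exact (Finset.sum_congr rfl fun _ _ => Finset.sum_comm).trans Finset.sum_comm

theorem gramForm_zsmul_right (k : ℤ) (x y : Fin m → ℤ) :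
    gramForm G x (k • y) = k * gramForm G x y := by
  simp only [gramForm, Pi.smul_apply, smul_eq_mul, Finset.mul_sum]
  refine Finset.sum_congr rfl fun i _ => Finset.sum_congr rfl fun k _ => ?_
  ring

theorem dvd_gramForm {x : Fin m → ℤ} {q : ℤ} (h : ∀ k, q ∣ 2 * gramForm G x (Pi.single k 1))
    (y : Fin m → ℤ) : q ∣ 2 * gramForm G x y := by
  have hy : y = ∑ k, y k • (Pi.single k 1 : Fin m → ℤ) := by
    funext i
    simp [Finset.sum_apply, Pi.single_apply]
  rw [hy, gramForm_sum_right, Finset.mul_sum]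
  refine Finset.dvd_sum fun k _ => ?_
  rw [gramForm_zsmul_right, mul_left_comm]
  exact Dvd.dvd.mul_left (h k) _

/-- The condition under which the short vectors form a root system with basis `γ`. -/
def IsShortAdmissible (G : Matrix (Fin m) (Fin m) ℤ) (N : ℤ) : Prop :=
  {y : Fin m → ℤ | gramForm G y y ≤ N}.Finite ∧ (∀ i, G i i ≤ N) ∧
  ∀ y, y ≠ 0 → gramForm G y y ≤ N → 2 ≤ gramForm G y y ∧
    (∀ k, gramForm G y y ∣ 2 * gramForm G y (Pi.single k 1)) ∧
    ((∀ k, 0 ≤ y k) ∨ ∀ k, y k ≤ 0)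

variable {N : ℤ}

theorem inner_self_shortVectors (hc : 0 < c)
    (hG : ∀ i k, inner ℝ (γ i) (γ k) = c * (G i k : ℝ)) (hN : IsShortAdmissible G N) {v : E}
    (hv : v ∈ shortVectors γ G N) : c * 2 ≤ inner ℝ v v ∧ inner ℝ v v ≤ c * N := by
  obtain ⟨y, hy, hyN, rfl⟩ := hv
  rw [inner_latticeVec hG]
  have h1 : (2 : ℝ) ≤ gramForm G y y := by exact_mod_cast (hN.2.2 y hy hyN).1
  have h2 : (gramForm G y y : ℝ) ≤ N := by exact_mod_cast hyN
  constructor <;> gcongr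

/-- By the divisibility condition the reflections preserve the lattice. They are isometries, so they
preserve the bound on the norm as well. -/
theorem isRootSystem_shortVectors (hc : 0 < c)
    (hG : ∀ i k, inner ℝ (γ i) (γ k) = c * (G i k : ℝ)) (hN : IsShortAdmissible G N) :
    IsRootSystem (Submodule.span ℝ (shortVectors γ G N)) (shortVectors γ G N) where
  finite := (hN.1.image (latticeVec γ)).subset (by
    rintro _ ⟨y, _, hy, rfl⟩; exact ⟨y, hy, rfl⟩)
  zero_notMem h := by
    have := (inner_self_shortVectors hc hG hN h).1
    rw [inner_zero_left] at this
    linarith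
  span_eq := rfl
  refl_mem := by
    rintro _ ⟨x, hx, hxN, rfl⟩ _ ⟨y, hy, hyN, rfl⟩
    obtain ⟨h2, hdvd, _⟩ := hN.2.2 x hx hxN
    obtain ⟨p, hp⟩ := dvd_gramForm hdvd y
    have hr := refl_latticeVec hc.ne' hG (by omega) hp
    rw [hr]
    have hin : inner ℝ (latticeVec γ (y - p • x)) (latticeVec γ (y - p • x)) =
        inner ℝ (latticeVec γ y) (latticeVec γ y) := by
      rw [← hr, LinearIsometryEquiv.inner_map_map]
    rw [inner_latticeVec hG, inner_latticeVec hG] at hin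
    have hform : gramForm G (y - p • x) (y - p • x) = gramForm G y y := by
      exact_mod_cast mul_left_cancel₀ hc.ne' hin
    refine ⟨_, fun h0 => ?_, hform ▸ hyN, rfl⟩
    have := (hN.2.2 y hy hyN).1
    rw [← hform, h0] at this
    simp [gramForm] at this
  integral := by
    rintro _ ⟨x, hx, hxN, rfl⟩ _ ⟨y, hy, hyN, rfl⟩
    obtain ⟨h2, hdvd, _⟩ := hN.2.2 x hx hxN
    obtain ⟨p, hp⟩ := dvd_gramForm hdvd y
    exact ⟨p, corootPairing_latticeVec hc.ne' hG (by omega) hp⟩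

/-- Short vectors have norm between 2 and `N` in units of `c`, and N < 8 = 4 · 2 excludes doubles.
-/
theorem isReduced_shortVectors (hc : 0 < c)
    (hG : ∀ i k, inner ℝ (γ i) (γ k) = c * (G i k : ℝ)) (hN : IsShortAdmissible G N) (hN8 : N < 8) :
    IsReduced (shortVectors γ G N) := by
  intro a ha
  refine isIndivisible_of_norm_sq (m := c * 2)
    (fun b hb => (inner_self_shortVectors hc hG hN hb).1) ?_
  refine (inner_self_shortVectors hc hG hN ha).2.trans_lt ?_
  have : (N : ℝ) < 8 := by exact_mod_cast hN8
  nlinarith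

theorem isBasis_shortVectors (hc : 0 < c)
    (hG : ∀ i k, inner ℝ (γ i) (γ k) = c * (G i k : ℝ)) (hN : IsShortAdmissible G N) (hN8 : N < 8)
    (hγ : LinearIndependent ℝ γ) :
    IsBasis (Submodule.span ℝ (shortVectors γ G N)) (shortVectors γ G N) γ := by
  refine isBasis_of_mem_cone hγ (fun i => Submodule.subset_span ⟨i, rfl⟩) (fun i => ?_) ?_
    (fun i => isReduced_shortVectors hc hG hN hN8 _ ?_)
  · refine ⟨Pi.single i 1, by simp, ?_, (latticeVec_single i).symm⟩
    simpa [gramForm, Pi.single_apply] using hN.2.1 i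
  · rintro _ ⟨y, hy, hyN, rfl⟩
    rcases (hN.2.2 y hy hyN).2.2 with h | h
    · left
      refine sum_mem fun i _ => ?_
      obtain ⟨p, hp⟩ := Int.eq_ofNat_of_zero_le (h i)
      rw [hp, natCast_zsmul]
      exact nsmul_mem (apply_mem_cone γ i) p
    · right
      rw [← latticeVec_neg]
      refine sum_mem fun i _ => ?_
      obtain ⟨p, hp⟩ := Int.eq_ofNat_of_zero_le (neg_nonneg.2 (h i))
      rw [Pi.neg_apply, hp, natCast_zsmul]
      exact nsmul_mem (apply_mem_cone γ i) p
  · refine ⟨Pi.single i 1, by simp, ?_, (latticeVec_single i).symm⟩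
    simpa [gramForm, Pi.single_apply] using hN.2.1 i

end Lattice

/-! ### Folding simply laced root systems -/

section FoldLattice

variable {n m : ℕ} {Φ : Set E} {α : Fin n → E} {ω : E ≃ₗᵢ[ℝ] E}

theorem inner_average_right {x : E} (hω : 0 < orderOf ω) (hx : ω x = x) (y : E) :
    inner ℝ x (average ω y) = inner ℝ x y := by
  have h1 : ∀ t, inner ℝ x ((ω ^ t) y) = inner ℝ x y := by
    intro t
    induction t with
    | zero => rfl
    | succ t ih =>
      rw [pow_succ', LinearIsometryEquiv.coe_mul, Function.comp_apply]
      nth_rewrite 1 [← hx]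
      rw [LinearIsometryEquiv.inner_map_map, ih]
  have h0 : (orderOf ω : ℝ) ≠ 0 := by exact_mod_cast hω.ne'
  simp only [average, inner_smul_right, inner_sum, h1, Finset.sum_const, Nat.card_Icc,
    Nat.add_sub_cancel, nsmul_eq_mul]
  field_simp

/-- Reflecting in a family of orthogonal roots with a common average `γ`, whose sum is fixed, has
the same effect on averages as reflecting in `γ`. -/
theorem exists_average_eq_refl (hΦ : IsRootSystem ⊤ Φ) (hω : 0 < orderOf ω) {ι : Type*}
    {S : Finset ι} (hS : S.Nonempty) {a : ι → E} {d : ℝ} {γ : E} (ha : ∀ i ∈ S, a i ∈ Φ)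
    (hin : ∀ i ∈ S, ∀ k ∈ S, i ≠ k → inner ℝ (a i) (a k) = 0)
    (hd : ∀ i ∈ S, inner ℝ (a i) (a i) = d) (hav : ∀ i ∈ S, average ω (a i) = γ)
    (hfix : ω (∑ i ∈ S, a i) = ∑ i ∈ S, a i) {b : E} (hb : b ∈ Φ) :
    ∃ b' ∈ Φ, average ω b' = refl γ (average ω b) := by
  classical
  -- The reflections in orthogonal roots are applied one after another. Each leaves the pairings
  -- with the remaining ones unchanged.
  have hroot : ∀ T ⊆ S, b - ∑ i ∈ T, corootPairing (a i) b • a i ∈ Φ := by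
    intro T
    induction T using Finset.induction_on with
    | empty => intro _; simpa using hb
    | insert i T hi ih =>
      intro hT
      have hiS := hT (Finset.mem_insert_self i T)
      have hTS : T ⊆ S := (Finset.subset_insert i T).trans hT
      have h := hΦ.refl_mem _ (ha i hiS) _ (ih hTS)
      have hp : corootPairing (a i) (b - ∑ k ∈ T, corootPairing (a k) b • a k) =
          corootPairing (a i) b := by
        rw [sub_eq_add_neg, corootPairing_add, corootPairing_neg, corootPairing_sum,
          Finset.sum_eq_zero, neg_zero, add_zero]
        intro k hk
        have h0 : corootPairing (a i) (a k) = 0 := by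
          simp [corootPairing, hin i hiS k (hTS hk) (by rintro rfl; exact hi hk)]
        rw [corootPairing_smul, h0, mul_zero]
      rw [refl_apply, hp, sub_sub, add_comm] at h
      rwa [Finset.sum_insert hi]
  refine ⟨_, hroot S subset_rfl, ?_⟩
  obtain ⟨i₀, hi₀⟩ := hS
  have hd0 : d ≠ 0 := by
    rw [← hd i₀ hi₀]
    exact inner_self_ne_zero.2 (hΦ.ne_zero (ha i₀ hi₀))
  have hcard : (S.card : ℝ) ≠ 0 := by
    exact_mod_cast (Finset.card_pos.2 ⟨i₀, hi₀⟩).ne'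
  have hav' : ∀ i ∈ S, averageMap ω (a i) = γ := hav
  have hγS : ∑ i ∈ S, a i = (S.card : ℝ) • γ := by
    rw [← average_of_map_eq hω hfix, ← averageMap_apply, map_sum,
      Finset.sum_congr rfl hav', Finset.sum_const, Nat.cast_smul_eq_nsmul]
  have hγ : γ = (S.card : ℝ)⁻¹ • ∑ i ∈ S, a i := by
    rw [hγS, smul_smul, inv_mul_cancel₀ hcard, one_smul]
  have hγfix : ω γ = γ := by rw [hγ, map_smul, hfix]
  have hγγ : inner ℝ γ γ = (S.card : ℝ)⁻¹ * d := by
    have h1 : ∀ i ∈ S, ∑ k ∈ S, inner ℝ (a i) (a k) = d := fun i hi => by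
      rw [Finset.sum_eq_single_of_mem i hi fun k hk hki => hin i hi k hk hki.symm, hd i hi]
    rw [hγ, inner_smul_left, inner_smul_right, sum_inner, conj_trivial]
    simp only [inner_sum]
    rw [Finset.sum_congr rfl h1, Finset.sum_const, nsmul_eq_mul]
    field_simp
  -- As γ is the mean of the orthogonal a_i, its squared length is d/|S|. So the coroot of γ is the
  -- sum of the coroots of the a_i, and pairing with the fixed vector γ does not notice the
  -- averaging.
  have hp : corootPairing γ (average ω b) = ∑ i ∈ S, corootPairing (a i) b := by
    rw [corootPairing, inner_average_right hω hγfix, hγγ, hγ, inner_smul_left, sum_inner,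
      conj_trivial]
    have h1 : ∀ i ∈ S, corootPairing (a i) b = 2 * inner ℝ (a i) b / d := fun i hi => by
      rw [corootPairing, hd i hi]
    rw [Finset.sum_congr rfl h1, ← Finset.sum_div, ← Finset.mul_sum]
    field_simp
  rw [refl_apply, hp, average_sub, ← averageMap_apply (∑ i ∈ S, _), map_sum, Finset.sum_smul]
  congr 1
  refine Finset.sum_congr rfl fun i hi => ?_
  rw [map_smul, averageMap_apply, hav i hi]

/-- Every root is an integral combination of simple roots, and in the simply laced case all roots
have the same length. -/
theorem IsBasis.exists_latticeVec (hΦ : IsRootSystem ⊤ Φ) (hred : IsReduced Φ)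
    (hα : IsBasis ⊤ Φ α) {d : ℝ} (hd : ∀ i, inner ℝ (α i) (α i) = d) {b : E} (hb : b ∈ Φ) :
    (∃ x, b = latticeVec α x) ∧ inner ℝ b b = d := by
  constructor
  · obtain ⟨c, h | h⟩ := hα.nonneg_or_nonpos b hb
    · exact ⟨fun i => c i, by rw [h]; simp [latticeVec]⟩
    · exact ⟨fun i => -c i, by rw [h]; simp [latticeVec]⟩
  · obtain ⟨w, -, i, rfl⟩ := hα.exists_conj hΦ hred hb
    rw [LinearIsometryEquiv.inner_map_map, hd]

/-- The hypothesis 2c = N c' says that the bound on the short vectors is exactly the squared length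
of the roots of Φ. The sets `S k` consist of orthogonal simple roots with average `γ k` and fixed
sum; in the applications they are orbits of ω. -/
theorem foldedRoots_eq_shortVectors (hΦ : IsRootSystem ⊤ Φ) (hred : IsReduced Φ)
    (hα : IsBasis ⊤ Φ α) (hω : 0 < orderOf ω) {G : Matrix (Fin n) (Fin n) ℤ} {c : ℝ}
    (hG : ∀ i k, inner ℝ (α i) (α k) = c * (G i k : ℝ)) (hG2 : ∀ i, G i i = 2)
    {γ : Fin m → E} {G' : Matrix (Fin m) (Fin m) ℤ} {c' : ℝ} (hc' : 0 < c')
    (hG' : ∀ i k, inner ℝ (γ i) (γ k) = c' * (G' i k : ℝ)) {N : ℤ} (hN : IsShortAdmissible G' N)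
    (hN8 : N < 8) (hγ : LinearIndependent ℝ γ) (hcN : 2 * c = N * c')
    (A : Fin n → Fin m → ℤ) (hA : ∀ i, average ω (α i) = latticeVec γ (A i))
    (S : Fin m → Finset (Fin n)) (hSne : ∀ k, (S k).Nonempty)
    (hSA : ∀ k, ∀ i ∈ S k, A i = Pi.single k 1)
    (hSG : ∀ k, ∀ i ∈ S k, ∀ i' ∈ S k, i ≠ i' → G i i' = 0)
    (hSω : ∀ k, ω (∑ i ∈ S k, α i) = ∑ i ∈ S k, α i) :
    foldedRoots Φ ω = shortVectors γ G' N := by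
  have hd : ∀ i, inner ℝ (α i) (α i) = N * c' := fun i => by
    rw [hG, hG2, ← hcN]; push_cast; ring
  have hSav : ∀ k, ∀ i ∈ S k, average ω (α i) = γ k := fun k i hi => by
    rw [hA, hSA k i hi, latticeVec_single]
  have hbasis := isBasis_shortVectors hc' hG' hN hN8 hγ
  have hroot := isRootSystem_shortVectors hc' hG' hN
  apply Set.Subset.antisymm
  · rintro _ ⟨h0, b, hb, rfl⟩
    obtain ⟨⟨x, hx⟩, hbb⟩ := hα.exists_latticeVec hΦ hred hd hb
    have hav : average ω b = latticeVec γ (∑ i, x i • A i) := by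
      rw [latticeVec_sum, hx, latticeVec, ← averageMap_apply, map_sum]
      refine Finset.sum_congr rfl fun i _ => ?_
      rw [map_zsmul, averageMap_apply, hA, latticeVec_zsmul]
    refine ⟨_, fun h => h0 ?_, ?_, hav⟩
    · rw [hav, h]; simp [latticeVec]
    -- Averaging does not lengthen a vector, and all roots have squared length N c'.
    · have h1 : inner ℝ (average ω b) (average ω b) ≤ inner ℝ b b := by
        rw [real_inner_self_eq_norm_sq, real_inner_self_eq_norm_sq]
        exact pow_le_pow_left₀ (norm_nonneg _) (norm_average_le hω b) 2
      rw [hbb, hav, inner_latticeVec hG', mul_comm] at h1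
      exact_mod_cast le_of_mul_le_mul_right h1 hc'
  -- The averages of the roots contain the basis γ and are stable under its reflections, so they
  -- contain the whole root system with basis γ.
  · have hsub : shortVectors γ G' N ⊆ average ω '' Φ := by
      refine hbasis.subset hroot (isReduced_shortVectors hc' hG' hN hN8) (fun k => ?_) ?_
      · obtain ⟨i, hi⟩ := hSne k
        exact ⟨α i, hα.mem i, hSav k i hi⟩
      · rintro k _ ⟨b, hb, rfl⟩
        obtain ⟨b', hb', h⟩ := exists_average_eq_refl hΦ hω (hSne k) (fun i _ => hα.mem i)
          (fun i hi i' hi' hne => by rw [hG, hSG k i hi i' hi' hne]; simp)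
          (fun i _ => hd i) (hSav k) (hSω k) hb
        exact ⟨b', hb', h⟩
    intro v hv
    obtain ⟨b, hb, h⟩ := hsub hv
    exact ⟨hroot.ne_zero hv, b, hb, h⟩

end FoldLattice

end Folding

namespace Folding

variable {E : Type*} [NormedAddCommGroup E] [InnerProductSpace ℝ E]

/-! ### Computing with coordinates in a simply laced root system -/

section Coordinates

variable {n : ℕ} {Φ : Set E} {α : Fin n → E} {ω : E ≃ₗᵢ[ℝ] E} {G : Matrix (Fin n) (Fin n) ℤ} {c : ℝ}

/-- The reflection in a vector `a` with `gramForm G a a = 2`, in coordinates. -/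
def latticeRefl (G : Matrix (Fin n) (Fin n) ℤ) (a x : Fin n → ℤ) : Fin n → ℤ :=
  x - gramForm G a x • a

theorem refl_eq_latticeRefl (hc : 0 < c) (hG : ∀ i k, inner ℝ (α i) (α k) = c * (G i k : ℝ))
    {a : Fin n → ℤ} (ha : gramForm G a a = 2) (x : Fin n → ℤ) :
    refl (latticeVec α a) (latticeVec α x) = latticeVec α (latticeRefl G a x) :=
  refl_latticeVec hc.ne' hG (by omega) (by rw [ha])

/-- Certifies that explicit coordinate vectors are roots: a path of simple reflections leads to them
from a known root. -/
theorem latticeVec_mem_of_isChain (hΦ : IsRootSystem ⊤ Φ) (hα : IsBasis ⊤ Φ α) (hc : 0 < c)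
    (hG : ∀ i k, inner ℝ (α i) (α k) = c * (G i k : ℝ)) (hG2 : ∀ i, G i i = 2)
    {L : List (Fin n → ℤ)} {x : Fin n → ℤ}
    (hL : (x :: L).IsChain fun x y => ∃ i, y = latticeRefl G (Pi.single i 1) x)
    (hx : latticeVec α x ∈ Φ) : ∀ y ∈ x :: L, latticeVec α y ∈ Φ := by
  induction L generalizing x with
  | nil => simpa using hx
  | cons z L ih =>
    obtain ⟨⟨i, hz⟩, hL'⟩ := List.isChain_cons_cons.1 hL
    have hzΦ : latticeVec α z ∈ Φ := by
      rw [hz, ← refl_eq_latticeRefl hc hG (by simp [gramForm, Pi.single_apply, hG2]),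
        latticeVec_single]
      exact hΦ.refl_mem _ (hα.mem i) _ hx
    intro y hy
    rcases List.mem_cons.1 hy with rfl | hy
    · exact hx
    · exact ih hL' hzΦ y hy

theorem prod_refl_latticeVec (hc : 0 < c) (hG : ∀ i k, inner ℝ (α i) (α k) = c * (G i k : ℝ))
    {as : List (Fin n → ℤ)} (has : ∀ a ∈ as, gramForm G a a = 2) (x : Fin n → ℤ) :
    (as.map fun a => refl (latticeVec α a)).prod (latticeVec α x) =
      latticeVec α (as.foldr (latticeRefl G) x) := by
  induction as with
  | nil => simp
  | cons a as ih =>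
    rw [List.map_cons, List.prod_cons, LinearIsometryEquiv.coe_mul, Function.comp_apply,
      ih fun b hb => has b (List.mem_cons_of_mem _ hb),
      refl_eq_latticeRefl hc hG (has a List.mem_cons_self)]
    rfl

/-- Reduces the identification of ω to integer computations: the product of the reflections listed
in `as`, the last acting first, must meet the sign criterion of `IsOmega.eq`. -/
theorem IsOmega.map_eq_latticeVec (hΦ : IsRootSystem ⊤ Φ) (hred : IsReduced Φ) (hα : IsBasis ⊤ Φ α)
    {j : Fin n} (hω : IsOmega Φ α j ω) (hc : 0 < c)
    (hG : ∀ i k, inner ℝ (α i) (α k) = c * (G i k : ℝ)) {as : List (Fin n → ℤ)}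
    (hasΦ : ∀ a ∈ as, latticeVec α a ∈ Φ) (has : ∀ a ∈ as, gramForm G a a = 2)
    {Y : Fin n → Fin n → ℤ} (hY : ∀ i, as.foldr (latticeRefl G) (Pi.single i 1) = Y i)
    (h : ∀ i, (∃ k, k ≠ j ∧ Y i = Pi.single k 1) ∨
      ∀ l, 0 ≤ -Y i l - (Pi.single j 1 : Fin n → ℤ) l) :
    ω ∈ weylGroup Φ ∧ ∀ i, ω (α i) = latticeVec α (Y i) := by
  set v := (as.map fun a => refl (latticeVec α a)).prod with hv
  have hvW : v ∈ weylGroup Φ := by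
    refine Subgroup.list_prod_mem _ fun g hg => ?_
    obtain ⟨a, ha, rfl⟩ := List.mem_map.1 hg
    exact Subgroup.subset_closure ⟨_, hasΦ a ha, rfl⟩
  have hvα : ∀ i, v (α i) = latticeVec α (Y i) := fun i => by
    rw [← latticeVec_single (γ := α) i, hv, prod_refl_latticeVec hc hG has, hY]
  have hωv : ω = v := by
    refine hω.eq hΦ hred hα hvW fun i => ?_
    rcases h i with ⟨k, hk, hYk⟩ | hYi
    · exact Or.inl ⟨k, hk, by rw [hvα, hYk, latticeVec_single]⟩
    · refine Or.inr ⟨latticeVec α (-Y i - Pi.single j 1), ?_, ?_⟩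
      · refine sum_mem fun l _ => ?_
        obtain ⟨p, hp⟩ := Int.eq_ofNat_of_zero_le (hYi l)
        rw [Pi.sub_apply, Pi.neg_apply, hp, natCast_zsmul]
        exact nsmul_mem (apply_mem_cone α l) p
      · rw [hvα, latticeVec_sub, latticeVec_single, latticeVec_neg]
        abel
  exact hωv ▸ ⟨hvW, hvα⟩

theorem HasCartanMatrix.inner_self_eq (hα0 : ∀ i, α i ≠ 0) (hG : HasCartanMatrix α G) {i k : Fin n}
    (h1 : G i k = -1) (h2 : G k i = -1) :
    inner ℝ (α i) (α i) = inner ℝ (α k) (α k) := by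
  have e1 := hG i k
  have e2 := hG k i
  have n1 : inner ℝ (α i) (α i) ≠ 0 := inner_self_ne_zero.2 (hα0 i)
  have n2 : inner ℝ (α k) (α k) ≠ 0 := inner_self_ne_zero.2 (hα0 k)
  rw [corootPairing, h1, div_eq_iff n2] at e1
  rw [corootPairing, h2, div_eq_iff n1, real_inner_comm] at e2
  push_cast at e1 e2
  linarith

theorem HasCartanMatrix.inner_eq_of_inner_self_eq (hα0 : ∀ i, α i ≠ 0) (hG : HasCartanMatrix α G)
    (hd : ∀ i, inner ℝ (α i) (α i) = 2 * c) (i k : Fin n) :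
    inner ℝ (α i) (α k) = c * (G i k : ℝ) := by
  have h := hG i k
  rw [corootPairing, div_eq_iff (inner_self_ne_zero.2 (hα0 k)), hd, real_inner_comm] at h
  linarith

theorem hasCartanMatrix_of_inner_eq (hc : 0 < c)
    (hG : ∀ i k, inner ℝ (α i) (α k) = c * (G i k : ℝ)) {M : Matrix (Fin n) (Fin n) ℤ}
    (h0 : ∀ i, G i i ≠ 0) (h : ∀ i k, 2 * G k i = M i k * G k k) : HasCartanMatrix α M := by
  intro i k
  have h1 : (G k k : ℝ) ≠ 0 := by exact_mod_cast h0 k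
  have h2 : 2 * (G k i : ℝ) = M i k * G k k := by exact_mod_cast h i k
  rw [corootPairing, hG, hG, div_eq_iff (mul_ne_zero hc.ne' h1)]
  linear_combination c * h2

/-- A box that contains all short vectors makes admissibility a finite check. -/
theorem isShortAdmissible_of_abs_le {N : ℤ} (B : Fin n → ℤ)
    (hB : ∀ y, gramForm G y y ≤ N → ∀ k, |y k| ≤ B k) (hN : ∀ i, G i i ≤ N)
    (h : ∀ y, (∀ k, |y k| ≤ B k) → y ≠ 0 → gramForm G y y ≤ N → 2 ≤ gramForm G y y ∧
      (∀ k, gramForm G y y ∣ 2 * gramForm G y (Pi.single k 1)) ∧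
      ((∀ k, 0 ≤ y k) ∨ ∀ k, y k ≤ 0)) : IsShortAdmissible G N := by
  refine ⟨(Set.finite_Icc (-B) B).subset fun y hy => ?_, hN, fun y hy hyN => h y (hB y hyN) hy hyN⟩
  exact ⟨fun k => (abs_le.1 (hB y hy k)).1, fun k => (abs_le.1 (hB y hy k)).2⟩

end Coordinates

end Folding

namespace Folding

variable {E : Type*} [NormedAddCommGroup E] [InnerProductSpace ℝ E]

/-! ### Type `E₆` -/

section E6

variable {Φ : Set E} {α : Fin 6 → E} {ω : E ≃ₗᵢ[ℝ] E}

/-- A Gram matrix of a basis of type `G₂`. -/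
def gramG2 : Matrix (Fin 2) (Fin 2) ℤ := !![6, -3; -3, 2]

theorem gramForm_gramG2 (y : Fin 2 → ℤ) :
    gramForm gramG2 y y = 6 * y 0 ^ 2 - 6 * y 0 * y 1 + 2 * y 1 ^ 2 := by
  simp [gramForm, gramG2, Fin.sum_univ_two]
  ring

set_option maxRecDepth 100000 in
theorem isShortAdmissible_gramG2 : IsShortAdmissible gramG2 6 := by
  refine isShortAdmissible_of_abs_le ![2, 3] (fun y hy => ?_) (by decide) ?_
  · rw [gramForm_gramG2] at hy
    -- Twice the form is (3 y_0 - 2 y_1)² + 3 y_0², and also 3 (2 y_0 - y_1)² + y_1².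
    have h0 : |y 0| ≤ 2 := abs_le.2 (by
      constructor <;> nlinarith [sq_nonneg (3 * y 0 - 2 * y 1)])
    have h1 : |y 1| ≤ 3 := abs_le.2 (by
      constructor <;> nlinarith [sq_nonneg (2 * y 0 - y 1)])
    intro k
    fin_cases k
    · exact h0
    · exact h1
  · have key : ∀ a ∈ Finset.Icc (-2 : ℤ) 2, ∀ b ∈ Finset.Icc (-3 : ℤ) 3, ![a, b] ≠ 0 →
        gramForm gramG2 ![a, b] ![a, b] ≤ 6 → 2 ≤ gramForm gramG2 ![a, b] ![a, b] ∧
        (∀ k, gramForm gramG2 ![a, b] ![a, b] ∣ 2 * gramForm gramG2 ![a, b] (Pi.single k 1)) ∧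
        ((∀ k, 0 ≤ ![a, b] k) ∨ ∀ k, ![a, b] k ≤ 0) := by decide +kernel
    intro y hy
    have h := key (y 0) (Finset.mem_Icc.2 (abs_le.1 (hy 0))) (y 1)
      (Finset.mem_Icc.2 (abs_le.1 (hy 1)))
    rwa [show ![y 0, y 1] = y from by funext i; fin_cases i <;> rfl] at h

/-- The images of the simple roots under `ω`. -/
def omegaE6 : Fin 6 → Fin 6 → ℤ :=
  ![![0, 0, 0, 0, 0, 1], ![0, 0, 1, 0, 0, 0], ![0, 0, 0, 0, 1, 0], ![0, 0, 0, 1, 0, 0],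
    ![0, 1, 0, 0, 0, 0], ![-1, -2, -2, -3, -2, -1]]

/-- The roots of `E₆` in whose reflections `ω` factorizes. -/
def reflRootsE6 : List (Fin 6 → ℤ) :=
  [![1, 1, 1, 1, 0, 0], ![0, 1, 0, 1, 1, 1], ![0, 0, 1, 1, 1, 1], ![1, 1, 1, 2, 2, 1]]

/-- A sequence of roots of `E₆`, each a simple reflection of the previous one. -/
def chainE6 : List (Fin 6 → ℤ) :=
  [![1, 0, 1, 0, 0, 0], ![1, 0, 1, 1, 0, 0], ![1, 1, 1, 1, 0, 0], ![0, 1, 1, 1, 0, 0],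
    ![0, 1, 0, 1, 0, 0], ![0, 1, 0, 1, 1, 0], ![0, 1, 0, 1, 1, 1], ![0, 0, 0, 1, 1, 1],
    ![0, 0, 1, 1, 1, 1], ![1, 0, 1, 1, 1, 1], ![1, 1, 1, 1, 1, 1], ![1, 1, 1, 2, 1, 1],
    ![1, 1, 1, 2, 2, 1]]

set_option maxRecDepth 100000 in
theorem isChain_chainE6 : ((Pi.single 0 1 : Fin 6 → ℤ) :: chainE6).IsChain fun x y =>
    ∃ i, y = latticeRefl CartanMatrix.E₆ (Pi.single i 1) x := by decide +kernel

set_option maxRecDepth 100000 in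
theorem foldr_reflRootsE6 : ∀ i, reflRootsE6.foldr (latticeRefl CartanMatrix.E₆) (Pi.single i 1) =
    omegaE6 i := by decide +kernel

theorem exists_gram_E6 (hΦ : IsRootSystem ⊤ Φ) (hα : IsBasis ⊤ Φ α)
    (hM : HasCartanMatrix α CartanMatrix.E₆) :
    ∃ c : ℝ, 0 < c ∧ ∀ i k, inner ℝ (α i) (α k) = c * (CartanMatrix.E₆ i k : ℝ) := by
  have h0 : ∀ i, α i ≠ 0 := hα.ne_zero hΦ
  have e1 := hM.inner_self_eq h0 (i := 0) (k := 2) rfl rfl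
  have e2 := hM.inner_self_eq h0 (i := 2) (k := 3) rfl rfl
  have e3 := hM.inner_self_eq h0 (i := 1) (k := 3) rfl rfl
  have e4 := hM.inner_self_eq h0 (i := 3) (k := 4) rfl rfl
  have e5 := hM.inner_self_eq h0 (i := 4) (k := 5) rfl rfl
  have hpos : 0 < inner ℝ (α 0) (α 0) := real_inner_self_pos.2 (h0 0)
  refine ⟨inner ℝ (α 0) (α 0) / 2, by linarith, hM.inner_eq_of_inner_self_eq h0 fun i => ?_⟩
  fin_cases i <;> simp only [Fin.zero_eta, Fin.mk_one, Fin.reduceFinMk] <;> linarith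

theorem omega_apply_E6 (hΦ : IsRootSystem ⊤ Φ) (hred : IsReduced Φ) (hα : IsBasis ⊤ Φ α)
    (hω : IsOmega Φ α 0 ω) {c : ℝ} (hc : 0 < c)
    (hG : ∀ i k, inner ℝ (α i) (α k) = c * (CartanMatrix.E₆ i k : ℝ)) :
    ω ∈ weylGroup Φ ∧ ∀ i, ω (α i) = latticeVec α (omegaE6 i) := by
  have hchain := latticeVec_mem_of_isChain hΦ hα hc hG (by decide) isChain_chainE6
    (by rw [latticeVec_single]; exact hα.mem 0)
  refine hω.map_eq_latticeVec hΦ hred hα hc hG (as := reflRootsE6) (fun a ha => hchain a ?_)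
    (by decide +kernel) foldr_reflRootsE6 (by decide +kernel)
  have hsub : ∀ a ∈ reflRootsE6, a ∈ Pi.single 0 1 :: chainE6 := by decide +kernel
  exact hsub a ha

end E6

end Folding

/-! ### The folding of `E₆` to `G₂` -/

namespace Folding

variable {E : Type*} [NormedAddCommGroup E] [InnerProductSpace ℝ E]

theorem isReducedOfType_of_eq_shortVectors {m : ℕ} {Φ : Set E} {ω : E ≃ₗᵢ[ℝ] E}
    (hΦ : IsRootSystem ⊤ Φ) (hω : 0 < orderOf ω) {γ : Fin m → E}
    {G : Matrix (Fin m) (Fin m) ℤ} {c : ℝ} {N : ℤ} (hc : 0 < c)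
    (hG : ∀ i k, inner ℝ (γ i) (γ k) = c * (G i k : ℝ)) (hN : IsShortAdmissible G N) (hN8 : N < 8)
    {M : Matrix (Fin m) (Fin m) ℤ} (hM : HasCartanMatrix γ M) (hdet : M.det ≠ 0)
    (h : foldedRoots Φ ω = shortVectors γ G N) :
    IsReducedOfType (fixedSpace ω) (foldedRoots Φ ω) M := by
  rw [← span_foldedRoots hΦ hω, h]
  exact ⟨isRootSystem_shortVectors hc hG hN, isReduced_shortVectors hc hG hN hN8, γ,
    isBasis_shortVectors hc hG hN hN8 (hM.linearIndependent hdet), hM⟩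

section E6

variable {Φ : Set E} {α : Fin 6 → E} {ω : E ≃ₗᵢ[ℝ] E}

/-- The basis of the folding of `E₆`. -/
noncomputable def foldedBasisE6 (α : Fin 6 → E) : Fin 2 → E :=
  ![α 3, (1 / 3 : ℝ) • (α 1 + α 2 + α 4)]

theorem inner_foldedBasisE6 {c : ℝ}
    (hG : ∀ i k, inner ℝ (α i) (α k) = c * (CartanMatrix.E₆ i k : ℝ)) (i k : Fin 2) :
    inner ℝ (foldedBasisE6 α i) (foldedBasisE6 α k) = c / 3 * (gramG2 i k : ℝ) := by
  fin_cases i <;> fin_cases k <;>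
    simp [foldedBasisE6, gramG2, inner_add_left, inner_add_right, inner_smul_left,
      inner_smul_right, hG, CartanMatrix.E₆, -inner_self_eq_norm_sq_to_K] <;> ring

/-- The coordinates of the averages of the simple roots. -/
def averageE6 : Fin 6 → Fin 2 → ℤ :=
  ![![-1, -2], ![0, 1], ![0, 1], ![1, 0], ![0, 1], ![-1, -2]]

/-- ω rotates the extended diagram: α_0 ↦ α_5 ↦ -θ in one arm orbit, and α_1 ↦ α_2 ↦ α_4 ↦ α_1 in
the other, with α_3 fixed. The average of α_0 follows from the relation given by α_5 ↦ -θ. -/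
theorem average_E6 (hω : 0 < orderOf ω) (h : ∀ i, ω (α i) = latticeVec α (omegaE6 i)) (i : Fin 6) :
    average ω (α i) = latticeVec (foldedBasisE6 α) (averageE6 i) := by
  have h0 : ω (α 0) = α 5 := by simp [h, omegaE6, latticeVec, Fin.sum_univ_six]
  have h1 : ω (α 1) = α 2 := by simp [h, omegaE6, latticeVec, Fin.sum_univ_six]
  have h2 : ω (α 2) = α 4 := by simp [h, omegaE6, latticeVec, Fin.sum_univ_six]
  have h3 : ω (α 3) = α 3 := by simp [h, omegaE6, latticeVec, Fin.sum_univ_six]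
  have h4 : ω (α 4) = α 1 := by simp [h, omegaE6, latticeVec, Fin.sum_univ_six]
  have h5 : ω (α 5) = -(α 0 + (2 : ℝ) • α 1 + (2 : ℝ) • α 2 + (3 : ℝ) • α 3 + (2 : ℝ) • α 4 +
      α 5) := by
    simp only [h, omegaE6, latticeVec, Fin.sum_univ_six, ← Int.cast_smul_eq_zsmul ℝ]
    simp
    module
  have a0 := average_map (ω := ω) (α 0)
  have a1 := average_map (ω := ω) (α 1)
  have a2 := average_map (ω := ω) (α 2)
  have a3 := average_of_map_eq hω h3
  have a5 := average_map (ω := ω) (α 5)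
  rw [h0] at a0
  rw [h1] at a1
  rw [h2] at a2
  rw [h5] at a5
  have as := average_of_map_eq hω (show ω (α 1 + α 2 + α 4) = α 1 + α 2 + α 4 by
    rw [map_add, map_add, h1, h2, h4]; abel)
  simp only [average_neg, average_add, average_smul] at a5 as
  rw [a0, a2, a1, a3] at a5
  rw [a2, a1] at as
  have b1 : average ω (α 1) = (1 / 3 : ℝ) • (α 1 + α 2 + α 4) := by
    rw [← as]; module
  -- With A_0 = A_5 and A_1 = A_2 = A_4 for the averages, the relation `a5` reads -(2 A_0 + 6 A_1 +
  -- 3 α_3) = A_0.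
  have b0 : average ω (α 0) = -(α 3 + (2 : ℝ) • average ω (α 1)) := by
    linear_combination (norm := module) (-1 / 3 : ℝ) • a5
  rw [b1] at b0 a1
  rw [a1] at a2
  rw [b0] at a0
  fin_cases i <;>
    simp [averageE6, latticeVec, foldedBasisE6, Fin.sum_univ_two, a0, a1, a2, a3, b0, b1] <;>
    module

/-- The folding of `E₆` at its first node. -/
theorem fold_E6_zero (hΦ : IsRootSystem ⊤ Φ) (hred : IsReduced Φ) (hα : IsBasis ⊤ Φ α)
    (hω : IsOmega Φ α 0 ω) (hM : HasCartanMatrix α CartanMatrix.E₆) :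
    IsReducedOfType (fixedSpace ω) (foldedRoots Φ ω) CartanMatrix.G₂ := by
  obtain ⟨c, hc, hG⟩ := exists_gram_E6 hΦ hα hM
  obtain ⟨hW, h⟩ := omega_apply_E6 hΦ hred hα hω hc hG
  have hord := hΦ.orderOf_pos hW
  have hG' := inner_foldedBasisE6 hG
  have hc' : 0 < c / 3 := by positivity
  have hM' : HasCartanMatrix (foldedBasisE6 α) CartanMatrix.G₂ :=
    hasCartanMatrix_of_inner_eq hc' hG' (by decide) (by decide)
  have hdet : CartanMatrix.G₂.det ≠ 0 := by rw [CartanMatrix.G₂_det]; decide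
  refine isReducedOfType_of_eq_shortVectors hΦ hord hc' hG' isShortAdmissible_gramG2 (by norm_num)
    hM' hdet ?_
  refine foldedRoots_eq_shortVectors hΦ hred hα hord hG (by decide) hc' hG'
    isShortAdmissible_gramG2 (by norm_num) (hM'.linearIndependent hdet) (by push_cast; ring)
    -- The orbits of ω that consist of simple roots. The orbit of α_0 also contains -θ and
    -- contributes no simple root of the folding.
    averageE6 (average_E6 hord h) ![{3}, {1, 2, 4}] (by decide) (by decide)
    (by simp only [CartanMatrix.E₆, Matrix.of_apply]; decide) ?_
  intro k
  fin_cases k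
  · simp [h, omegaE6, latticeVec, Fin.sum_univ_six]
  · simp [h, omegaE6, latticeVec, Fin.sum_univ_six]
    abel

/-- The folding of `E₆` at either of its extreme nodes. -/
theorem fold_E6 (hΦ : IsRootSystem ⊤ Φ) (hred : IsReduced Φ) (hα : IsBasis ⊤ Φ α) {j : Fin 6}
    (hω : IsOmega Φ α j ω) (hM : HasCartanMatrix α CartanMatrix.E₆) (hj : j = 0 ∨ j = 5) :
    IsReducedOfType (fixedSpace ω) (foldedRoots Φ ω) CartanMatrix.G₂ := by
  rcases hj with rfl | rfl
  · exact fold_E6_zero hΦ hred hα hω hM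
  -- The symmetry of the diagram of `E₆` exchanges its two extreme nodes.
  · let σ : Equiv.Perm (Fin 6) := Equiv.swap 0 5 * Equiv.swap 2 4
    have hσ : ∀ i k, CartanMatrix.E₆ (σ i) (σ k) = CartanMatrix.E₆ i k := by
      simp only [CartanMatrix.E₆, Matrix.of_apply]; decide
    have hσ5 : σ.symm 5 = 0 := by decide
    have hω' := hω.comp_perm σ
    rw [hσ5] at hω'
    exact fold_E6_zero hΦ hred (hα.comp_perm σ) hω' fun i k => (hM (σ i) (σ k)).trans
      (by rw [hσ])

end E6

/-! ### Type `E₇` -/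

section E7

variable {Φ : Set E} {α : Fin 7 → E} {ω : E ≃ₗᵢ[ℝ] E}

/-- A Gram matrix of a basis of type `F₄`. -/
def gramF4 : Matrix (Fin 4) (Fin 4) ℤ :=
  !![4, -2, 0, 0; -2, 4, -2, 0; 0, -2, 2, -1; 0, 0, -1, 2]

theorem gramForm_gramF4 (y : Fin 4 → ℤ) :
    gramForm gramF4 y y = 4 * y 0 ^ 2 + 4 * y 1 ^ 2 + 2 * y 2 ^ 2 + 2 * y 3 ^ 2 -
      4 * y 0 * y 1 - 4 * y 1 * y 2 - 2 * y 2 * y 3 := by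
  simp [gramForm, gramF4, Fin.sum_univ_four]
  ring

/-- To bound one coordinate, squares are completed along the chain from its ends towards that
coordinate. For instance the form equals (2y_3 - y_2)²/2 + (3y_2 - 4y_1)²/6 + (2y_1 - 3y_0)²/3 +
y_0². -/
theorem abs_le_of_gramForm_gramF4 {y : Fin 4 → ℤ} (hy : gramForm gramF4 y y ≤ 4) :
    |y 0| ≤ 2 ∧ |y 1| ≤ 3 ∧ |y 2| ≤ 4 ∧ |y 3| ≤ 2 := by
  rw [gramForm_gramF4] at hy
  have h0 : y 0 ^ 2 ≤ 4 := by
    nlinarith [sq_nonneg (2 * y 3 - y 2), sq_nonneg (3 * y 2 - 4 * y 1),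
      sq_nonneg (2 * y 1 - 3 * y 0)]
  have h1 : y 1 ^ 2 ≤ 12 := by
    nlinarith [sq_nonneg (2 * y 0 - y 1), sq_nonneg (3 * y 2 - 4 * y 1),
      sq_nonneg (2 * y 3 - y 2)]
  have h2 : y 2 ^ 2 ≤ 24 := by
    nlinarith [sq_nonneg (2 * y 0 - y 1), sq_nonneg (3 * y 1 - 2 * y 2),
      sq_nonneg (2 * y 3 - y 2)]
  have h3 : y 3 ^ 2 ≤ 8 := by
    nlinarith [sq_nonneg (2 * y 0 - y 1), sq_nonneg (3 * y 1 - 2 * y 2),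
      sq_nonneg (2 * y 2 - 3 * y 3)]
  refine ⟨abs_le.2 ⟨?_, ?_⟩, abs_le.2 ⟨?_, ?_⟩, abs_le.2 ⟨?_, ?_⟩, abs_le.2 ⟨?_, ?_⟩⟩ <;> nlinarith

set_option maxRecDepth 100000 in
theorem isShortAdmissible_gramF4 : IsShortAdmissible gramF4 4 := by
  refine isShortAdmissible_of_abs_le ![2, 3, 4, 2] (fun y hy => ?_) (by decide) ?_
  · obtain ⟨h0, h1, h2, h3⟩ := abs_le_of_gramForm_gramF4 hy
    intro k
    fin_cases k
    · exact h0
    · exact h1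
    · exact h2
    · exact h3
  · have key : ∀ a ∈ Finset.Icc (-2 : ℤ) 2, ∀ b ∈ Finset.Icc (-3 : ℤ) 3,
        ∀ c ∈ Finset.Icc (-4 : ℤ) 4, ∀ d ∈ Finset.Icc (-2 : ℤ) 2, ![a, b, c, d] ≠ 0 →
        gramForm gramF4 ![a, b, c, d] ![a, b, c, d] ≤ 4 →
        2 ≤ gramForm gramF4 ![a, b, c, d] ![a, b, c, d] ∧
        (∀ k, gramForm gramF4 ![a, b, c, d] ![a, b, c, d] ∣
          2 * gramForm gramF4 ![a, b, c, d] (Pi.single k 1)) ∧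
        ((∀ k, 0 ≤ ![a, b, c, d] k) ∨ ∀ k, ![a, b, c, d] k ≤ 0) := by decide +kernel
    intro y hy
    have h := key (y 0) (Finset.mem_Icc.2 (abs_le.1 (hy 0))) (y 1)
      (Finset.mem_Icc.2 (abs_le.1 (hy 1))) (y 2) (Finset.mem_Icc.2 (abs_le.1 (hy 2))) (y 3)
      (Finset.mem_Icc.2 (abs_le.1 (hy 3)))
    rwa [show ![y 0, y 1, y 2, y 3] = y from by funext i; fin_cases i <;> rfl] at h

/-- The images of the simple roots under `ω`. -/
def omegaE7 : Fin 7 → Fin 7 → ℤ :=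
  ![![0, 0, 0, 0, 0, 1, 0], ![0, 1, 0, 0, 0, 0, 0], ![0, 0, 0, 0, 1, 0, 0],
    ![0, 0, 0, 1, 0, 0, 0], ![0, 0, 1, 0, 0, 0, 0], ![1, 0, 0, 0, 0, 0, 0],
    ![-2, -2, -3, -4, -3, -2, -1]]

/-- The roots of `E₇` in whose reflections `ω` factorizes. -/
def reflRootsE7 : List (Fin 7 → ℤ) :=
  [![1, 1, 2, 2, 1, 1, 1], ![1, 1, 1, 2, 2, 1, 1], ![0, 1, 1, 2, 2, 2, 1]]

/-- A sequence of roots of `E₇`, each a simple reflection of the previous one. -/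
def chainE7 : List (Fin 7 → ℤ) :=
  [![1, 0, 1, 0, 0, 0, 0], ![1, 0, 1, 1, 0, 0, 0], ![1, 1, 1, 1, 0, 0, 0],
    ![1, 1, 1, 1, 1, 0, 0], ![1, 1, 1, 2, 1, 0, 0], ![1, 1, 2, 2, 1, 0, 0],
    ![1, 1, 2, 2, 1, 1, 0], ![1, 1, 2, 2, 1, 1, 1], ![1, 1, 1, 2, 1, 1, 1],
    ![1, 1, 1, 2, 2, 1, 1], ![0, 1, 1, 2, 2, 1, 1], ![0, 1, 1, 2, 2, 2, 1]]

set_option maxRecDepth 100000 in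
theorem isChain_chainE7 : ((Pi.single 0 1 : Fin 7 → ℤ) :: chainE7).IsChain fun x y =>
    ∃ i, y = latticeRefl CartanMatrix.E₇ (Pi.single i 1) x := by decide +kernel

set_option maxRecDepth 100000 in
theorem foldr_reflRootsE7 : ∀ i, reflRootsE7.foldr (latticeRefl CartanMatrix.E₇) (Pi.single i 1) =
    omegaE7 i := by decide +kernel

theorem exists_gram_E7 (hΦ : IsRootSystem ⊤ Φ) (hα : IsBasis ⊤ Φ α)
    (hM : HasCartanMatrix α CartanMatrix.E₇) :
    ∃ c : ℝ, 0 < c ∧ ∀ i k, inner ℝ (α i) (α k) = c * (CartanMatrix.E₇ i k : ℝ) := by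
  have h0 : ∀ i, α i ≠ 0 := hα.ne_zero hΦ
  have e1 := hM.inner_self_eq h0 (i := 0) (k := 2) rfl rfl
  have e2 := hM.inner_self_eq h0 (i := 2) (k := 3) rfl rfl
  have e3 := hM.inner_self_eq h0 (i := 1) (k := 3) rfl rfl
  have e4 := hM.inner_self_eq h0 (i := 3) (k := 4) rfl rfl
  have e5 := hM.inner_self_eq h0 (i := 4) (k := 5) rfl rfl
  have e6 := hM.inner_self_eq h0 (i := 5) (k := 6) rfl rfl
  have hpos : 0 < inner ℝ (α 0) (α 0) := real_inner_self_pos.2 (h0 0)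
  refine ⟨inner ℝ (α 0) (α 0) / 2, by linarith, hM.inner_eq_of_inner_self_eq h0 fun i => ?_⟩
  fin_cases i <;> simp only [Fin.zero_eta, Fin.mk_one, Fin.reduceFinMk] <;> linarith

theorem omega_apply_E7 (hΦ : IsRootSystem ⊤ Φ) (hred : IsReduced Φ) (hα : IsBasis ⊤ Φ α)
    (hω : IsOmega Φ α 6 ω) {c : ℝ} (hc : 0 < c)
    (hG : ∀ i k, inner ℝ (α i) (α k) = c * (CartanMatrix.E₇ i k : ℝ)) :
    ω ∈ weylGroup Φ ∧ ∀ i, ω (α i) = latticeVec α (omegaE7 i) := by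
  have hchain := latticeVec_mem_of_isChain hΦ hα hc hG (by decide) isChain_chainE7
    (by rw [latticeVec_single]; exact hα.mem 0)
  refine hω.map_eq_latticeVec hΦ hred hα hc hG (as := reflRootsE7) (fun a ha => hchain a ?_)
    (by decide +kernel) foldr_reflRootsE7 (by decide +kernel)
  have hsub : ∀ a ∈ reflRootsE7, a ∈ Pi.single 0 1 :: chainE7 := by decide +kernel
  exact hsub a ha

/-- The basis of the folding of `E₇`. -/
noncomputable def foldedBasisE7 (α : Fin 7 → E) : Fin 4 → E :=
  ![α 1, α 3, (1 / 2 : ℝ) • (α 2 + α 4), (1 / 2 : ℝ) • (α 0 + α 5)]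

theorem inner_foldedBasisE7 {c : ℝ}
    (hG : ∀ i k, inner ℝ (α i) (α k) = c * (CartanMatrix.E₇ i k : ℝ)) (i k : Fin 4) :
    inner ℝ (foldedBasisE7 α i) (foldedBasisE7 α k) = c / 2 * (gramF4 i k : ℝ) := by
  fin_cases i <;> fin_cases k <;>
    simp [foldedBasisE7, gramF4, inner_add_left, inner_add_right, inner_smul_left,
      inner_smul_right, hG, CartanMatrix.E₇, -inner_self_eq_norm_sq_to_K] <;> ring

/-- The coordinates of the averages of the simple roots. -/
def averageE7 : Fin 7 → Fin 4 → ℤ :=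
  ![![0, 0, 0, 1], ![1, 0, 0, 0], ![0, 0, 1, 0], ![0, 1, 0, 0], ![0, 0, 1, 0], ![0, 0, 0, 1],
    ![-1, -2, -3, -2]]

/-- ω flips the extended diagram: it exchanges α_0 and α_5, α_2 and α_4, α_6 and -θ, and fixes α_1
and α_3. -/
theorem average_E7 (hω : 0 < orderOf ω) (h : ∀ i, ω (α i) = latticeVec α (omegaE7 i)) (i : Fin 7) :
    average ω (α i) = latticeVec (foldedBasisE7 α) (averageE7 i) := by
  have h0 : ω (α 0) = α 5 := by simp [h, omegaE7, latticeVec, Fin.sum_univ_seven]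
  have h1 : ω (α 1) = α 1 := by simp [h, omegaE7, latticeVec, Fin.sum_univ_seven]
  have h2 : ω (α 2) = α 4 := by simp [h, omegaE7, latticeVec, Fin.sum_univ_seven]
  have h3 : ω (α 3) = α 3 := by simp [h, omegaE7, latticeVec, Fin.sum_univ_seven]
  have h4 : ω (α 4) = α 2 := by simp [h, omegaE7, latticeVec, Fin.sum_univ_seven]
  have h5 : ω (α 5) = α 0 := by simp [h, omegaE7, latticeVec, Fin.sum_univ_seven]
  have h6 : ω (α 6) = -((2 : ℝ) • α 0 + (2 : ℝ) • α 1 + (3 : ℝ) • α 2 + (4 : ℝ) • α 3 +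
      (3 : ℝ) • α 4 + (2 : ℝ) • α 5 + α 6) := by
    simp only [h, omegaE7, latticeVec, Fin.sum_univ_seven, ← Int.cast_smul_eq_zsmul ℝ]
    simp
    module
  have a0 := average_map (ω := ω) (α 0)
  have a1 := average_of_map_eq hω h1
  have a2 := average_map (ω := ω) (α 2)
  have a3 := average_of_map_eq hω h3
  have a6 := average_map (ω := ω) (α 6)
  rw [h0] at a0
  rw [h2] at a2
  rw [h6] at a6
  have as := average_of_map_eq hω (show ω (α 2 + α 4) = α 2 + α 4 by
    rw [map_add, h2, h4]; abel)
  have at' := average_of_map_eq hω (show ω (α 0 + α 5) = α 0 + α 5 by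
    rw [map_add, h0, h5]; abel)
  simp only [average_neg, average_add, average_smul] at a6 as at'
  rw [a0, a1, a2, a3] at a6
  rw [a2] at as
  rw [a0] at at'
  have b2 : average ω (α 2) = (1 / 2 : ℝ) • (α 2 + α 4) := by
    rw [← as]; module
  have b0 : average ω (α 0) = (1 / 2 : ℝ) • (α 0 + α 5) := by
    rw [← at']; module
  -- The relation `a6` from α_6 ↦ -θ contains the average of α_6 on both sides, hence the factor
  -- 1/2.
  have b6 : average ω (α 6) = -(α 1 + (2 : ℝ) • α 3 + (3 : ℝ) • average ω (α 2) +
      (2 : ℝ) • average ω (α 0)) := by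
    linear_combination (norm := module) (-1 / 2 : ℝ) • a6
  rw [b2, b0] at b6
  rw [b0] at a0
  rw [b2] at a2
  fin_cases i <;>
    simp [averageE7, latticeVec, foldedBasisE7, Fin.sum_univ_four, a0, a1, a2, a3, b0, b2, b6] <;>
    module

/-- The folding of `E₇` at its last node. -/
theorem fold_E7 (hΦ : IsRootSystem ⊤ Φ) (hred : IsReduced Φ) (hα : IsBasis ⊤ Φ α)
    (hω : IsOmega Φ α 6 ω) (hM : HasCartanMatrix α CartanMatrix.E₇) :
    IsReducedOfType (fixedSpace ω) (foldedRoots Φ ω) CartanMatrix.F₄ := by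
  obtain ⟨c, hc, hG⟩ := exists_gram_E7 hΦ hα hM
  obtain ⟨hW, h⟩ := omega_apply_E7 hΦ hred hα hω hc hG
  have hord := hΦ.orderOf_pos hW
  have hG' := inner_foldedBasisE7 hG
  have hc' : 0 < c / 2 := by positivity
  have hM' : HasCartanMatrix (foldedBasisE7 α) CartanMatrix.F₄ :=
    hasCartanMatrix_of_inner_eq hc' hG' (by decide) (by decide)
  have hdet : CartanMatrix.F₄.det ≠ 0 := by rw [CartanMatrix.F₄_det]; decide
  refine isReducedOfType_of_eq_shortVectors hΦ hord hc' hG' isShortAdmissible_gramF4 (by norm_num)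
    hM' hdet ?_
  refine foldedRoots_eq_shortVectors hΦ hred hα hord hG (by decide) hc' hG'
    isShortAdmissible_gramF4 (by norm_num) (hM'.linearIndependent hdet) (by push_cast; ring)
    averageE7 (average_E7 hord h) ![{1}, {3}, {2, 4}, {0, 5}] (by decide) (by decide)
    (by simp only [CartanMatrix.E₇, Matrix.of_apply]; decide) ?_
  intro k
  fin_cases k
  · simp [h, omegaE7, latticeVec, Fin.sum_univ_seven]
  · simp [h, omegaE7, latticeVec, Fin.sum_univ_seven]
  · simp [h, omegaE7, latticeVec, Fin.sum_univ_seven]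
    abel
  · simp [h, omegaE7, latticeVec, Fin.sum_univ_seven]
    abel

end E7

end Folding

/-! ### Renumbering of nodes and assembly of the cases -/

namespace Folding

variable {E : Type*} [NormedAddCommGroup E] [InnerProductSpace ℝ E]

/-- The two diagrams are the same with the nodes numbered in opposite orders. -/
theorem IsReducedOfType.B_two_of_C_two {V : Submodule ℝ E} {Φ : Set E}
    (h : IsReducedOfType V Φ (CartanMatrix.C 2)) : IsReducedOfType V Φ (CartanMatrix.B 2) := by
  obtain ⟨hΦ, hred, α, hα, hM⟩ := h
  refine ⟨hΦ, hred, α ∘ Equiv.swap 0 1, hα.comp_perm _, fun i k => ?_⟩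
  refine (hM _ _).trans ?_
  rw [CartanMatrix.B_two, CartanMatrix.C_two]
  fin_cases i <;> fin_cases k <;> simp

/-- The folding of `D_ℓ` at either of its last two nodes. -/
theorem fold_D_last_two {n : ℕ} {Φ : Set E} {α : Fin n → E} {ω : E ≃ₗᵢ[ℝ] E}
    (hΦ : IsRootSystem ⊤ Φ) (hred : IsReduced Φ) (hα : IsBasis ⊤ Φ α) {j : Fin n}
    (hω : IsOmega Φ α j ω) (hn : 4 ≤ n) (hM : HasCartanMatrix α (CartanMatrix.D n))
    (hj : (j : ℕ) + 1 = n - 1 ∨ (j : ℕ) + 1 = n) :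
    (Even n → IsReducedOfType (fixedSpace ω) (foldedRoots Φ ω) (CartanMatrix.C (n / 2))) ∧
      (Odd n → IsOfTypeBC (fixedSpace ω) (foldedRoots Φ ω) ((n - 3) / 2)) := by
  rcases hj with hj | hj
  -- The node ℓ - 1 is carried to ℓ by the graph automorphism exchanging the last two nodes.
  · let t : Fin n := ⟨n - 1, by omega⟩
    have ht : t.val + 1 = n := by simp only [t]; omega
    refine fold_D_last hΦ hred (hα.comp_perm (Equiv.swap j t)) (hω.comp_perm _) hn
      (hasCartanMatrix_D_swap hΦ hred hα hn hM (by omega) ht) ?_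
    rw [Equiv.symm_swap, Equiv.swap_apply_left, ht]
  · exact fold_D_last hΦ hred hα hω hn hM hj

end Folding

open Folding in
theorem theorem4p7 {E : Type*} [NormedAddCommGroup E] [InnerProductSpace ℝ E]
    [FiniteDimensional ℝ E] (Φ : Set E) (hΦ : IsRootSystem ⊤ Φ) (hred : IsReduced Φ)
    (ℓ : ℕ) (α : Fin ℓ → E) (hα : IsBasis ⊤ Φ α)
    (j : Fin ℓ) (ω : E ≃ₗᵢ[ℝ] E) (hω : IsOmega Φ α j ω) :
    -- the simple root written `α_(j+1)` in the usual numbering is `α j` here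
    -- type `A_ℓ`
    (HasCartanMatrix α (CartanMatrix.A ℓ) →
      (Nat.gcd (ℓ + 1) (j + 1) = 1 →
        IsRootSystem (fixedSpace ω) (foldedRoots Φ ω) ∧ foldedRoots Φ ω = ∅) ∧
      (Nat.gcd (ℓ + 1) (j + 1) ≠ 1 →
        IsReducedOfType (fixedSpace ω) (foldedRoots Φ ω)
          (CartanMatrix.A (Nat.gcd (ℓ + 1) (j + 1) - 1)))) ∧
    -- type `B_ℓ`
    (2 ≤ ℓ → HasCartanMatrix α (CartanMatrix.B ℓ) → (j : ℕ) + 1 = 1 →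
      (ℓ = 2 → IsReducedOfType (fixedSpace ω) (foldedRoots Φ ω) (CartanMatrix.A 1)) ∧
      (3 ≤ ℓ → IsReducedOfType (fixedSpace ω) (foldedRoots Φ ω) (CartanMatrix.B (ℓ - 1)))) ∧
    -- type `C_ℓ`
    (3 ≤ ℓ → HasCartanMatrix α (CartanMatrix.C ℓ) → (j : ℕ) + 1 = ℓ →
      (Odd ℓ → IsOfTypeBC (fixedSpace ω) (foldedRoots Φ ω) ((ℓ - 1) / 2)) ∧
      (Even ℓ → IsReducedOfType (fixedSpace ω) (foldedRoots Φ ω) (CartanMatrix.C (ℓ / 2)))) ∧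
    -- type `D_ℓ`, first node
    (4 ≤ ℓ → HasCartanMatrix α (CartanMatrix.D ℓ) → (j : ℕ) + 1 = 1 →
      IsReducedOfType (fixedSpace ω) (foldedRoots Φ ω) (CartanMatrix.B (ℓ - 2))) ∧
    -- type `D_ℓ`, one of the last two nodes
    (4 ≤ ℓ → HasCartanMatrix α (CartanMatrix.D ℓ) → ((j : ℕ) + 1 = ℓ - 1 ∨ (j : ℕ) + 1 = ℓ) →
      (Even ℓ → IsReducedOfType (fixedSpace ω) (foldedRoots Φ ω) (CartanMatrix.C (ℓ / 2))) ∧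
      (ℓ = 4 → IsReducedOfType (fixedSpace ω) (foldedRoots Φ ω) (CartanMatrix.B 2)) ∧
      (Odd ℓ → IsOfTypeBC (fixedSpace ω) (foldedRoots Φ ω) ((ℓ - 3) / 2))) ∧
    -- type `E_6`
    (∀ h : ℓ = 6, HasCartanMatrix (fun i : Fin 6 => α (Fin.cast h.symm i)) CartanMatrix.E₆ →
      ((j : ℕ) + 1 = 1 ∨ (j : ℕ) + 1 = 6) →
      IsReducedOfType (fixedSpace ω) (foldedRoots Φ ω) CartanMatrix.G₂) ∧
    -- type `E_7`
    (∀ h : ℓ = 7, HasCartanMatrix (fun i : Fin 7 => α (Fin.cast h.symm i)) CartanMatrix.E₇ →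
      (j : ℕ) + 1 = 7 →
      IsReducedOfType (fixedSpace ω) (foldedRoots Φ ω) CartanMatrix.F₄) := by
  refine ⟨fold_A hΦ hred hα hω, fun h2 hM hj => ⟨?_, fun _ => fold_B hΦ hred hα hω h2 hM (by omega)⟩,
    fun h3 hM hj => fold_C hΦ hred hα hω h3 hM hj,
    fun h4 hM hj => fold_D_first hΦ hred hα hω h4 hM (by omega), fun h4 hM hj => ?_, ?_, ?_⟩
  -- The case of rank 2 is the general one of type B: it yields B₁, whose Cartan matrix is that of
  -- A₁.
  · rintro rfl
    have h := fold_B hΦ hred hα hω h2 hM (by omega)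
    rwa [← CartanMatrix.B_one]
  · have h := fold_D_last_two hΦ hred hα hω h4 hM hj
    refine ⟨h.1, ?_, h.2⟩
    rintro rfl
    exact (h.1 (by decide)).B_two_of_C_two
  · rintro rfl hM hj
    exact fold_E6 hΦ hred hα hω hM (by omega)
  · rintro rfl hM hj
    obtain rfl : j = 6 := by omega
    exact fold_E7 hΦ hred hα hω hM
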